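/- Let $F$ be R. Thompson's group of all piecewise-linear increasing homeomorphisms of $[0,1]$ onto itself with finitely many break points of the derivative, all of them in $\mathbb{Z}[\frac12]$, and all slopes integer powers of $2$. For a set $U\subset(0,1)$ let $H_U=\{f\in F : f(u)=u \text{ for all } u\in U\}$. If a group $G$ is generated by a finite set $S$ and a subgroup $H\le G$ is generated by a finite set $T$, let $\delta_{S,T}\colon\mathbb{N}\to\mathbb{N}$ be the smallest function such that every $h\in H$ that is a product of at most $n$ elements of $S\cup S^{-1}$ is a product of at most $\delta_{S,T}(n)$ elements of $T\cup T^{-1}$. A finitely generated subgroup $H$ of a finitely generated group $G$ is called undistorted in $G$ if, for all finite generating sets $S$ of $G$ and $T$ of $H$, the function $\delta_{S,T}$ is bounded above by a linear function, i.e. there is a constant $C$ with $\delta_{S,T}(n)\le Cn$ for all $n\in\mathbb{N}$. Theorem. Let $U$ be a finite set of rational numbers in $(0,1)$. Then $F$ and $H_U$ are finitely generated, and the subgroup $H_U$ is undistorted in $F$. -/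

import Mathlib

/-! ### Thompson's group `F` as a group of homeomorphisms of the unit interval -/

/-- The real number `x` belongs to `ℤ[1/2]`. -/
def IsDyadicReal (x : ℝ) : Prop :=
  ∃ (m : ℤ) (n : ℕ), x = (m : ℝ) / 2 ^ n

/-- The increasing self-bijection `f` of `[0,1]` (automatically a homeomorphism) is piecewise
linear, with all slopes powers of `2` and all break points in `ℤ[1/2]`: there is a finite set `B`
of dyadic numbers such that on each closed interval whose interior avoids `B` the map `f` is
affine with slope an integer power of `2`. -/
def IsThompson (f : unitInterval ≃o unitInterval) : Prop :=
  ∃ B : Finset ℝ, (∀ d ∈ B, IsDyadicReal d) ∧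
    ∀ a b : unitInterval, a < b → (∀ d ∈ B, ¬ ((a : ℝ) < d ∧ d < (b : ℝ))) →
      ∃ (k : ℤ) (c : ℝ), ∀ x : unitInterval, a ≤ x → x ≤ b →
        ((f x : unitInterval) : ℝ) = (2 : ℝ) ^ k * (x : ℝ) + c

theorem IsDyadicReal.zero : IsDyadicReal 0 := ⟨0, 0, by simp⟩

theorem IsDyadicReal.add {x y : ℝ} (hx : IsDyadicReal x) (hy : IsDyadicReal y) :
    IsDyadicReal (x + y) := by
  obtain ⟨m, n, rfl⟩ := hx
  obtain ⟨m', n', rfl⟩ := hy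
  refine ⟨m * 2 ^ n' + m' * 2 ^ n, n + n', ?_⟩
  push_cast
  rw [pow_add]
  field_simp

theorem IsDyadicReal.sub {x y : ℝ} (hx : IsDyadicReal x) (hy : IsDyadicReal y) :
    IsDyadicReal (x - y) := by
  obtain ⟨m, n, rfl⟩ := hx
  obtain ⟨m', n', rfl⟩ := hy
  refine ⟨m * 2 ^ n' - m' * 2 ^ n, n + n', ?_⟩
  push_cast
  rw [pow_add]
  field_simp

theorem IsDyadicReal.zpow_mul {x : ℝ} (hx : IsDyadicReal x) (k : ℤ) :
    IsDyadicReal ((2 : ℝ) ^ k * x) := by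
  obtain ⟨m, n, rfl⟩ := hx
  obtain ⟨j, rfl | rfl⟩ := k.eq_nat_or_neg
  · refine ⟨2 ^ j * m, n, ?_⟩
    push_cast
    rw [zpow_natCast]
    ring
  · refine ⟨m, n + j, ?_⟩
    rw [zpow_neg, zpow_natCast, pow_add]
    field_simp

/-- Below any `x > 0` there is a point `b < x` that is `0` or in `B`, with no point of `B`
strictly between. -/
theorem exists_break_below (B : Finset ℝ) (x : unitInterval) (hx : 0 < x) :
    ∃ b : unitInterval, b < x ∧ (b = 0 ∨ (b : ℝ) ∈ B) ∧
      ∀ d ∈ B, ¬ ((b : ℝ) < d ∧ d < (x : ℝ)) := by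
  classical
  set A : Finset ℝ := insert 0 (B.filter fun d => 0 < d ∧ d < (x : ℝ)) with hA
  have hne : A.Nonempty := ⟨0, by simp [hA]⟩
  have hx' : (0 : ℝ) < x := hx
  have hmem := A.max'_mem hne
  have hle : ∀ d ∈ A, d ≤ A.max' hne := fun d hd => A.le_max' d hd
  generalize A.max' hne = b at hmem hle
  have hb : b = 0 ∨ (b ∈ B ∧ 0 < b ∧ b < (x : ℝ)) := by simpa [hA] using hmem
  have hb0 : 0 ≤ b := by rcases hb with h | h <;> linarith
  have hbx : b < (x : ℝ) := by rcases hb with h | h <;> linarith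
  refine ⟨⟨b, hb0, hbx.le.trans x.2.2⟩, hbx, ?_, ?_⟩
  · rcases hb with h | h
    · exact Or.inl (Subtype.ext h)
    · exact Or.inr h.1
  · rintro d hd ⟨h1, h2⟩
    have h1' : b < d := h1
    have := hle d (by simp only [hA, Finset.mem_insert, Finset.mem_filter]
                      exact Or.inr ⟨hd, by linarith, h2⟩)
    linarith

theorem orderIso_apply_zero (f : unitInterval ≃o unitInterval) : f 0 = 0 := by
  have h : f ⊥ = ⊥ := map_bot f
  exact h

/-- An element of `F` maps dyadic numbers to dyadic numbers, in both directions. -/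
theorem dyadic_iff_of_breaks {f : unitInterval ≃o unitInterval} {B : Finset ℝ}
    (hB : ∀ d ∈ B, IsDyadicReal d)
    (hf : ∀ a b : unitInterval, a < b → (∀ d ∈ B, ¬ ((a : ℝ) < d ∧ d < (b : ℝ))) →
      ∃ (k : ℤ) (c : ℝ), ∀ x : unitInterval, a ≤ x → x ≤ b →
        ((f x : unitInterval) : ℝ) = (2 : ℝ) ^ k * (x : ℝ) + c)
    (x : unitInterval) : IsDyadicReal (f x : unitInterval) ↔ IsDyadicReal x := by
  classical
  have key : ∀ (N : ℕ) (x : unitInterval), (B.filter fun d => d < (x : ℝ)).card ≤ N →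
      (IsDyadicReal (f x : unitInterval) ↔ IsDyadicReal x) := by
    intro N
    induction N with
    | zero =>
      intro x hcard
      rcases (show (0 : unitInterval) = x ∨ 0 < x from eq_or_lt_of_le bot_le) with h0 | h0
      · rw [← h0, orderIso_apply_zero]
      obtain ⟨b, hbx, hb, hbB⟩ := exists_break_below B x h0
      obtain ⟨k, c, h⟩ := hf b x hbx hbB
      have hemp : B.filter (fun d => d < (x : ℝ)) = ∅ := by simpa using hcard
      have hb0 : b = 0 := by
        rcases hb with hb | hb
        · exact hb
        · have : (b : ℝ) ∈ B.filter (fun d => d < (x : ℝ)) := by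
            simp only [Finset.mem_filter]; exact ⟨hb, hbx⟩
          rw [hemp] at this
          simp at this
      subst hb0
      have e1 := h x hbx.le le_rfl
      have e0 := h 0 le_rfl hbx.le
      rw [orderIso_apply_zero] at e0
      have hc : c = 0 := by simpa using e0.symm
      rw [e1, hc, add_zero]
      refine ⟨fun hd => ?_, fun hd => hd.zpow_mul k⟩
      have := hd.zpow_mul (-k)
      rwa [← mul_assoc, ← zpow_add₀ two_ne_zero, neg_add_cancel, zpow_zero, one_mul] at this
    | succ N ih =>
      intro x hcard
      rcases (show (0 : unitInterval) = x ∨ 0 < x from eq_or_lt_of_le bot_le) with h0 | h0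
      · rw [← h0, orderIso_apply_zero]
      obtain ⟨b, hbx, hb, hbB⟩ := exists_break_below B x h0
      obtain ⟨k, c, h⟩ := hf b x hbx hbB
      have hbd : IsDyadicReal b ∧ IsDyadicReal (f b : unitInterval) := by
        rcases hb with hb | hb
        · subst hb
          rw [orderIso_apply_zero]
          exact ⟨IsDyadicReal.zero, IsDyadicReal.zero⟩
        · have hlt : (B.filter fun d => d < (b : ℝ)).card <
              (B.filter fun d => d < (x : ℝ)).card := by
            apply Finset.card_lt_card
            rw [Finset.ssubset_iff_of_subset]
            · refine ⟨b, ?_, ?_⟩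
              · simp only [Finset.mem_filter]; exact ⟨hb, hbx⟩
              · simp
            · intro d hd
              simp only [Finset.mem_filter] at hd ⊢
              exact ⟨hd.1, hd.2.trans hbx⟩
          exact ⟨hB _ hb, (ih b (by omega)).2 (hB _ hb)⟩
      have e1 := h x hbx.le le_rfl
      have e0 := h b le_rfl hbx.le
      have e : ((f x : unitInterval) : ℝ) = (f b : unitInterval) + (2 : ℝ) ^ k * (x - b) := by
        rw [e1, e0]; ring
      constructor
      · intro hd
        have h3 := ((hd.sub hbd.2).zpow_mul (-k)).add hbd.1
        rw [e, add_sub_cancel_left, ← mul_assoc, ← zpow_add₀ two_ne_zero, neg_add_cancel,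
          zpow_zero, one_mul, sub_add_cancel] at h3
        exact h3
      · intro hd
        rw [e]
        exact hbd.2.add ((hd.sub hbd.1).zpow_mul k)
  exact key _ x le_rfl

theorem IsThompson.one : IsThompson 1 := by
  refine ⟨∅, by simp, fun a b _ _ => ⟨0, 0, fun x _ _ => ?_⟩⟩
  simp

/-- The image under `g` of the points of `B` in `[0,1]`, as a finite set of reals. -/
theorem exists_image_breaks (g : unitInterval ≃o unitInterval) (B : Finset ℝ)
    (hB : ∀ x : unitInterval, (x : ℝ) ∈ B → IsDyadicReal (g x : unitInterval)) :
    ∃ B' : Finset ℝ, (∀ d ∈ B', IsDyadicReal d) ∧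
      ∀ x : unitInterval, (x : ℝ) ∈ B → ((g x : unitInterval) : ℝ) ∈ B' := by
  classical
  have hfin : {x : unitInterval | (x : ℝ) ∈ B}.Finite :=
    B.finite_toSet.preimage Subtype.val_injective.injOn
  refine ⟨hfin.toFinset.image fun x => ((g x : unitInterval) : ℝ), ?_, ?_⟩
  · intro d hd
    simp only [Finset.mem_image, Set.Finite.mem_toFinset, Set.mem_ofPred_eq] at hd
    obtain ⟨x, hx, rfl⟩ := hd
    exact hB x hx
  · intro x hx
    simp only [Finset.mem_image, Set.Finite.mem_toFinset, Set.mem_ofPred_eq]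
    exact ⟨x, hx, rfl⟩

theorem IsThompson.mul {f g : unitInterval ≃o unitInterval} (hf : IsThompson f)
    (hg : IsThompson g) : IsThompson (f * g) := by
  classical
  obtain ⟨B, hB, hf⟩ := hf
  obtain ⟨D, hD, hg⟩ := hg
  obtain ⟨E, hE, hBE⟩ := exists_image_breaks g.symm B (by
    intro x hx
    rw [← dyadic_iff_of_breaks hD hg]
    simpa using hB _ hx)
  refine ⟨D ∪ E, ?_, ?_⟩
  · intro d hd
    rcases Finset.mem_union.1 hd with h | h
    · exact hD d h
    · exact hE d h
  · intro a b hab h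
    obtain ⟨k, c, h1⟩ := hg a b hab fun d hd => h d (Finset.mem_union_left _ hd)
    obtain ⟨l, e, h2⟩ := hf (g a) (g b) (g.lt_iff_lt.2 hab) (by
      rintro d hd ⟨h3, h4⟩
      have hd0 : (0 : ℝ) ≤ d := (g a).2.1.trans h3.le
      have hd1 : d ≤ (1 : ℝ) := h4.le.trans (g b).2.2
      refine h _ (Finset.mem_union_right _ (hBE ⟨d, hd0, hd1⟩ hd)) ⟨?_, ?_⟩
      · have : a < g.symm ⟨d, hd0, hd1⟩ := g.lt_symm_apply.2 h3
        exact this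
      · have : g.symm ⟨d, hd0, hd1⟩ < b := g.symm_apply_lt.2 h4
        exact this)
    refine ⟨l + k, 2 ^ l * c + e, fun x hax hxb => ?_⟩
    have h5 := h2 (g x) (g.le_iff_le.2 hax) (g.le_iff_le.2 hxb)
    rw [h1 x hax hxb] at h5
    rw [zpow_add₀ two_ne_zero]
    change ((f (g x) : unitInterval) : ℝ) = _
    rw [h5]
    ring

theorem IsThompson.inv {f : unitInterval ≃o unitInterval} (hf : IsThompson f) :
    IsThompson f⁻¹ := by
  obtain ⟨B, hB, hf⟩ := hf
  obtain ⟨E, hE, hBE⟩ := exists_image_breaks f B (by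
    intro x hx
    rw [dyadic_iff_of_breaks hB hf]
    exact hB _ hx)
  refine ⟨E, hE, ?_⟩
  intro a b hab h
  obtain ⟨k, c, h1⟩ := hf (f.symm a) (f.symm b) (f.symm.lt_iff_lt.2 hab) (by
    rintro d hd ⟨h3, h4⟩
    have hd0 : (0 : ℝ) ≤ d := (f.symm a).2.1.trans h3.le
    have hd1 : d ≤ (1 : ℝ) := h4.le.trans (f.symm b).2.2
    refine h _ (hBE ⟨d, hd0, hd1⟩ hd) ⟨?_, ?_⟩
    · have : a < f ⟨d, hd0, hd1⟩ := f.symm_apply_lt.1 h3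
      exact this
    · have : f ⟨d, hd0, hd1⟩ < b := f.lt_symm_apply.1 h4
      exact this)
  refine ⟨-k, -(2 ^ (-k) * c), fun x hax hxb => ?_⟩
  have h5 := h1 (f.symm x) (f.symm.le_iff_le.2 hax) (f.symm.le_iff_le.2 hxb)
  rw [f.apply_symm_apply] at h5
  change ((f.symm x : unitInterval) : ℝ) = _
  rw [h5, mul_add, ← mul_assoc, ← zpow_add₀ two_ne_zero, neg_add_cancel, zpow_zero]
  ring

/-- Thompson's group `F`, as a group of increasing homeomorphisms of `[0,1]` under composition. -/
def thompsonF : Subgroup (unitInterval ≃o unitInterval) where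
  carrier := {f | IsThompson f}
  one_mem' := IsThompson.one
  mul_mem' := IsThompson.mul
  inv_mem' := IsThompson.inv

/-- The subgroup `H_U` of `F`: all elements of `F` that fix every point of `U`. -/
def thompsonStab (U : Set unitInterval) : Subgroup thompsonF where
  carrier := {f | ∀ u ∈ U, (f : unitInterval ≃o unitInterval) u = u}
  one_mem' := fun _ _ => rfl
  mul_mem' := by
    intro f g hf hg u hu
    change (f : unitInterval ≃o unitInterval) ((g : unitInterval ≃o unitInterval) u) = u
    rw [hg u hu, hf u hu]
  inv_mem' := by
    intro f hf u hu
    change (f : unitInterval ≃o unitInterval).symm u = u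
    rw [OrderIso.symm_apply_eq]
    exact (hf u hu).symm

/-! ### Word length, distortion function, undistorted subgroups -/

/-- The word length of `g` over `S`: the least number of factors in a product of elements of `S`
and their inverses that is equal to `g` (`⊤` if there is no such product). -/
noncomputable def wordLength {G : Type*} [Group G] (S : Set G) (g : G) : ℕ∞ :=
  ⨅ (l : List G) (_ : ∀ x ∈ l, x ∈ S ∨ x⁻¹ ∈ S) (_ : l.prod = g), (l.length : ℕ∞)

/-- The distortion function of the subgroup `H` with respect to `S` and `T`: the smallest function
`δ` such that each element of `H` that is a product of at most `n` elements of `S ∪ S⁻¹` is a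
product of at most `δ n` elements of `T ∪ T⁻¹`. -/
noncomputable def distortion {G : Type*} [Group G] (H : Subgroup G) (S T : Set G) (n : ℕ) : ℕ∞ :=
  ⨆ (h : G) (_ : h ∈ H) (_ : wordLength S h ≤ (n : ℕ∞)), wordLength T h

/-- `H` is an undistorted subgroup of `G`: both groups are finitely generated, and for all finite
generating sets `S` of `G` and `T` of `H` the distortion function is bounded above by a linear
function. -/
def IsUndistorted {G : Type*} [Group G] (H : Subgroup G) : Prop :=
  Group.FG G ∧ H.FG ∧
    ∀ S T : Finset G, Subgroup.closure (S : Set G) = ⊤ → Subgroup.closure (T : Set G) = H →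
      ∃ C : ℕ, ∀ n : ℕ, distortion H (S : Set G) (T : Set G) n ≤ (C : ℕ∞) * (n : ℕ∞)

/-! All word lengths are compared through one function on `F`. Extend the elements of `F` by the
identity to the line, call the intervals [k/2^n, (k+1)/2^n] with n ≥ 0 cells, and let `complexity f`
be the number of cells that f does not carry affinely onto a cell, plus the same number for f⁻¹. On
`F` it is finite, invariant under inversion and subadditive (`badCells_mul`), hence at most linear
in word length. So it suffices (`isUndistorted_of_norm`) to find a finite subset of H_U over which
each f in H_U is a word of length O(`complexity f` + 1); U = ∅ gives the finite generation of `F`.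

For the elements supported in a dyadic interval, `vineMap` identifies its interior with the line so
that unit intervals become cells shrinking geometrically towards both ends. The elements turn into
homeomorphisms of the line that are integer translations near ±∞, with few bad cells. Scanning the
line from left to right and precomposing with the inverse of the map that doubles [0, 1] whenever a
bad unit cell is met removes all bad cells in linearly many steps (`exists_word_badCells_eq_empty`).
Doing this for the map and then for an inverse leaves a translation (`isWord_of_isTame`). At dyadic
fixed points an element can be cut into pieces, with a bounded increase of complexity (`exists_cut`,
`linGen_of_gaps`).

At a fixed point u that is rational but not dyadic no cut is possible. The slope there is 2^s with
|s| ≤ `complexity f`, and the possible s form a cyclic group, so a power of one fixed element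
corrects the slope to 1 (`LinGen.of_hasExp_zero`). Since the denominator of u is fixed, f is then
the identity at all distances up to a constant times 2^(-`badCount f`) from u
(`apply_eq_self_of_hasExp_zero`). Rationality also yields an element of `F` that contracts a
neighbourhood of u; conjugation by a power of it, with linear exponent, makes f the identity on a
fixed neighbourhood with dyadic ends (`LinGen.of_conj`). Those ends are dyadic fixed points, where
cutting works. `linGen_fixF` treats the points of U one at a time. -/

/-- `g` is a product of at most `n` elements of `T` and inverses of elements of `T`. -/
def IsWord {G : Type*} [Group G] (T : Set G) (n : ℕ) (g : G) : Prop :=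
  ∃ l : List G, (∀ x ∈ l, x ∈ T ∨ x⁻¹ ∈ T) ∧ l.prod = g ∧ l.length ≤ n

/-! ### Calculus of words -/

namespace IsWord

variable {G : Type*} [Group G] {T : Set G}

theorem one (T : Set G) (n : ℕ) : IsWord T n (1 : G) := ⟨[], by simp, rfl, by simp⟩

theorem of_mem {g : G} (h : g ∈ T) : IsWord T 1 g := ⟨[g], by simp [h], by simp, by simp⟩

theorem mono {S : Set G} {m n : ℕ} {g : G} (h : IsWord S m g) (hST : S ⊆ T) (hmn : m ≤ n) :
    IsWord T n g := by
  obtain ⟨l, h1, h2, h3⟩ := h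
  exact ⟨l, fun x hx => (h1 x hx).imp (fun h => hST h) (fun h => hST h), h2, h3.trans hmn⟩

theorem mul {m n : ℕ} {g h : G} (hg : IsWord T m g) (hh : IsWord T n h) :
    IsWord T (m + n) (g * h) := by
  obtain ⟨l, h1, h2, h3⟩ := hg
  obtain ⟨l', h1', h2', h3'⟩ := hh
  refine ⟨l ++ l', ?_, by simp [h2, h2'], by simp; omega⟩
  intro x hx
  rcases List.mem_append.1 hx with h | h
  · exact h1 x h
  · exact h1' x h

theorem inv {n : ℕ} {g : G} (hg : IsWord T n g) : IsWord T n g⁻¹ := by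
  obtain ⟨l, h1, h2, h3⟩ := hg
  refine ⟨(l.map fun x => x⁻¹).reverse, ?_, by rw [← h2, List.prod_inv_reverse], by simpa⟩
  intro x hx
  simp only [List.mem_reverse, List.mem_map] at hx
  obtain ⟨y, hy, rfl⟩ := hx
  rw [inv_inv]
  exact (h1 y hy).symm

theorem pow {n : ℕ} {g : G} (hg : IsWord T n g) (k : ℕ) : IsWord T (k * n) (g ^ k) := by
  induction k with
  | zero => simpa using one T 0
  | succ k ih => rw [pow_succ, add_mul, one_mul]; exact ih.mul hg

theorem zpow {n : ℕ} {g : G} (hg : IsWord T n g) (k : ℤ) :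
    IsWord T (k.natAbs * n) (g ^ k) := by
  obtain ⟨j, rfl | rfl⟩ := k.eq_nat_or_neg
  · simpa using hg.pow j
  · simpa using (hg.pow j).inv

/-- Rewriting the letters of a word as words over another alphabet. -/
theorem subst {S : Set G} {m n : ℕ} {g : G} (hg : IsWord S n g)
    (h : ∀ s ∈ S, IsWord T m s) : IsWord T (m * n) g := by
  obtain ⟨l, h1, h2, h3⟩ := hg
  suffices h : IsWord T (m * l.length) g from h.mono subset_rfl (by gcongr)
  clear h3
  induction l generalizing g with
  | nil => subst h2; exact one T _
  | cons x l ih =>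
    subst h2
    rw [List.prod_cons, List.length_cons, mul_add, mul_one, add_comm]
    refine mul ?_ (ih (fun y hy => h1 y (List.mem_cons_of_mem _ hy)) rfl)
    rcases h1 x List.mem_cons_self with hx | hx
    · exact h x hx
    · simpa using (h _ hx).inv

theorem mem_closure {n : ℕ} {g : G} (hg : IsWord T n g) : g ∈ Subgroup.closure T := by
  obtain ⟨l, h1, rfl, -⟩ := hg
  refine Subgroup.list_prod_mem _ fun x hx => ?_
  rcases h1 x hx with h | h
  · exact Subgroup.subset_closure h
  · simpa using inv_mem (Subgroup.subset_closure h)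

theorem exists_of_mem_closure {g : G} (hg : g ∈ Subgroup.closure T) : ∃ n, IsWord T n g := by
  induction hg using Subgroup.closure_induction with
  | mem x hx => exact ⟨1, of_mem hx⟩
  | one => exact ⟨0, one T 0⟩
  | mul x y _ _ hx hy =>
    obtain ⟨m, hm⟩ := hx
    obtain ⟨n, hn⟩ := hy
    exact ⟨m + n, hm.mul hn⟩
  | inv x _ hx =>
    obtain ⟨m, hm⟩ := hx
    exact ⟨m, hm.inv⟩

/-- Finitely many letters have a common length bound, so a change of finite alphabet costs only a
constant factor. -/
theorem exists_uniform (S : Finset G) (h : ∀ s ∈ S, s ∈ Subgroup.closure T) :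
    ∃ m, ∀ s ∈ S, IsWord T m s := by
  classical
  induction S using Finset.induction_on with
  | empty => exact ⟨0, by simp⟩
  | insert a S _ ih =>
    obtain ⟨m, hm⟩ := ih fun s hs => h s (Finset.mem_insert_of_mem hs)
    obtain ⟨n, hn⟩ := exists_of_mem_closure (h a (Finset.mem_insert_self _ _))
    refine ⟨m + n, fun s hs => ?_⟩
    rcases Finset.mem_insert.1 hs with rfl | hs
    · exact hn.mono subset_rfl (by omega)
    · exact (hm s hs).mono subset_rfl (by omega)

/-- An infimum of natural numbers that lies below a finite bound is attained, so the extended length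
can be traded for an explicit word. -/
theorem wordLength_le_iff {n : ℕ} {g : G} : wordLength T g ≤ (n : ℕ∞) ↔ IsWord T n g := by
  constructor
  · intro h
    by_contra hc
    have : ((n + 1 : ℕ) : ℕ∞) ≤ wordLength T g := by
      refine le_iInf fun l => le_iInf fun h1 => le_iInf fun h2 => ?_
      by_contra h3
      refine hc ⟨l, h1, h2, ?_⟩
      have : l.length < n + 1 := by exact_mod_cast not_le.1 h3
      omega
    have := this.trans h
    norm_cast at this
    omega
  · rintro ⟨l, h1, h2, h3⟩
    exact (iInf_le_of_le l (iInf_le_of_le h1 (iInf_le_of_le h2 le_rfl))).trans (by exact_mod_cast h3)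

/-- A subadditive symmetric function grows at most linearly on words. -/
theorem norm_le {M : G → ℕ} (h1 : M 1 = 0) (hmul : ∀ g h, M (g * h) ≤ M g + M h)
    (hinv : ∀ g, M g⁻¹ = M g) {c n : ℕ} {g : G} (hg : IsWord T n g) (hT : ∀ t ∈ T, M t ≤ c) :
    M g ≤ c * n := by
  obtain ⟨l, hl, rfl, hn⟩ := hg
  suffices h : M l.prod ≤ c * l.length from h.trans (by gcongr)
  clear hn
  induction l with
  | nil => simp [h1]
  | cons x l ih =>
    rw [List.prod_cons, List.length_cons, mul_add, mul_one, add_comm]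
    refine (hmul _ _).trans (add_le_add ?_ (ih fun y hy => hl y (List.mem_cons_of_mem _ hy)))
    rcases hl x List.mem_cons_self with hx | hx
    · exact hT x hx
    · rw [← hinv]; exact hT _ hx

end IsWord

/-- A criterion for a subgroup to be undistorted: the word length in the subgroup is bounded
linearly in terms of a subadditive function on the whole group. -/
theorem isUndistorted_of_norm {G : Type*} [Group G] (H : Subgroup G) (M : G → ℕ) (h1 : M 1 = 0)
    (hmul : ∀ g h, M (g * h) ≤ M g + M h) (hinv : ∀ g, M g⁻¹ = M g) (S₀ T₀ : Finset G)
    (hS₀ : Subgroup.closure (S₀ : Set G) = ⊤) (hT₀ : (T₀ : Set G) ⊆ H) (C : ℕ)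
    (hC : ∀ g ∈ H, IsWord (T₀ : Set G) (C * (M g + 1)) g) : IsUndistorted H := by
  refine ⟨⟨S₀, hS₀⟩, ⟨T₀, le_antisymm ((Subgroup.closure_le _).2 hT₀)
    fun g hg => (hC g hg).mem_closure⟩, fun S T _ hT => ?_⟩
  obtain ⟨m, hm⟩ := IsWord.exists_uniform (T := (T : Set G)) T₀ (by rw [hT]; exact fun s hs => hT₀ hs)
  obtain ⟨c, hc⟩ : ∃ c, ∀ s ∈ (S : Set G), M s ≤ c :=
    ⟨S.sup M, fun s hs => Finset.le_sup (f := M) hs⟩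
  -- A letter of `T₀` costs `m` letters of `T`, and `c` bounds `M` on `S`. The length is at most m *
  -- C * (c * n + 1), and the 1 is absorbed into n when n ≥ 1.
  refine ⟨m * (C * (c + 1)), fun n => iSup_le fun g => iSup_le fun hg => iSup_le fun hn => ?_⟩
  rw [IsWord.wordLength_le_iff] at hn
  have : ((m * (C * (c + 1)) : ℕ) : ℕ∞) * (n : ℕ∞) = ((m * (C * (c + 1)) * n : ℕ) : ℕ∞) := by
    push_cast; rfl
  rw [this, IsWord.wordLength_le_iff]
  -- For n = 0 nothing absorbs the additive constant in `hC`; but then the word is empty.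
  rcases Nat.eq_zero_or_pos n with rfl | hpos
  · obtain ⟨l, -, rfl, hl⟩ := hn
    have : l = [] := by simpa using hl
    subst this
    exact IsWord.one _ _
  · have hMg := hn.norm_le h1 hmul hinv hc
    refine ((hC g hg).subst hm).mono subset_rfl ?_
    rw [mul_assoc, mul_assoc]
    gcongr
    nlinarith

/-! ### Dyadic cells, good and bad -/

/-- The point with affine coordinate `t` in the cell `I = (k, n)`, that is, in the standard dyadic
interval `[k / 2 ^ n, (k + 1) / 2 ^ n]`. -/
noncomputable def cellPt (I : ℤ × ℕ) (t : ℝ) : ℝ := (I.1 + t) / 2 ^ I.2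

/-- `f` maps the cell `I` affinely onto the cell `J`. -/
def CellMap (f : ℝ → ℝ) (I J : ℤ × ℕ) : Prop :=
  ∀ t : ℝ, 0 ≤ t → t ≤ 1 → f (cellPt I t) = cellPt J t

/-- `f` maps the cell `I` affinely onto some cell. -/
def IsGood (f : ℝ → ℝ) (I : ℤ × ℕ) : Prop := ∃ J, CellMap f I J

/-- The cells that `f` does not map affinely onto a cell. -/
def badCells (f : ℝ ≃o ℝ) : Set (ℤ × ℕ) := {I | ¬ IsGood f I}

/-- The number of cells that `f` does not map affinely onto a cell. -/
noncomputable def badCount (f : ℝ ≃o ℝ) : ℕ := (badCells f).ncard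

theorem cellPt_strictMono (I : ℤ × ℕ) : StrictMono (cellPt I) := by
  intro s t hst
  unfold cellPt
  gcongr

theorem cellPt_one_sub_zero (I : ℤ × ℕ) : cellPt I 1 - cellPt I 0 = 1 / 2 ^ I.2 := by
  unfold cellPt; field_simp; ring

/-- The length determines the level, and then the left end determines the index. -/
theorem cell_ext {I J : ℤ × ℕ} (h0 : cellPt I 0 = cellPt J 0) (h1 : cellPt I 1 = cellPt J 1) :
    I = J := by
  have h2 : (1 : ℝ) / 2 ^ I.2 = 1 / 2 ^ J.2 := by
    rw [← cellPt_one_sub_zero, ← cellPt_one_sub_zero, h0, h1]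
  have h3 : I.2 = J.2 := by
    have : (2 : ℝ) ^ I.2 = 2 ^ J.2 := by simpa using h2
    exact pow_right_injective₀ (by norm_num) (by norm_num) this
  unfold cellPt at h0
  rw [h3] at h0
  have h4 : (I.1 : ℝ) = J.1 := by
    have : (2 : ℝ) ^ J.2 ≠ 0 := by positivity
    field_simp at h0
    linarith
  exact Prod.ext (by exact_mod_cast h4) h3

namespace CellMap

theorem comp {f g : ℝ → ℝ} {I J K : ℤ × ℕ} (hg : CellMap g I J) (hf : CellMap f J K) :
    CellMap (fun x => f (g x)) I K := fun t h0 h1 => by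
  change f (g _) = _
  rw [hg t h0 h1, hf t h0 h1]

theorem mul {f g : ℝ ≃o ℝ} {I J K : ℤ × ℕ} (hg : CellMap g I J) (hf : CellMap f J K) :
    CellMap (f * g : ℝ ≃o ℝ) I K := hg.comp hf

theorem inv {f : ℝ ≃o ℝ} {I J : ℤ × ℕ} (hf : CellMap f I J) :
    CellMap (f⁻¹ : ℝ ≃o ℝ) J I := fun t h0 h1 => by
  change f.symm _ = _
  rw [← hf t h0 h1, f.symm_apply_apply]

theorem unique {f : ℝ → ℝ} {I J K : ℤ × ℕ} (hJ : CellMap f I J) (hK : CellMap f I K) : J = K :=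
  cell_ext ((hJ 0 le_rfl zero_le_one).symm.trans (hK 0 le_rfl zero_le_one))
    ((hJ 1 zero_le_one le_rfl).symm.trans (hK 1 zero_le_one le_rfl))

theorem injective {f : ℝ ≃o ℝ} {I J K : ℤ × ℕ} (hJ : CellMap f I K) (hK : CellMap f J K) :
    I = J := hJ.inv.unique hK.inv

end CellMap

theorem badCells_one : badCells 1 = ∅ := by
  ext I
  simp only [badCells, Set.mem_ofPred_eq, Set.mem_empty_iff_false, iff_false, not_not]
  exact ⟨I, fun t _ _ => rfl⟩

theorem isGood_of_badCells_eq_empty {f : ℝ ≃o ℝ} (h : badCells f = ∅) (I : ℤ × ℕ) :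
    IsGood f I := by
  by_contra hI
  have : I ∈ badCells f := hI
  rw [h] at this
  exact this

/-- Comparison of the numbers of bad cells along an injective correspondence of cells. -/
theorem finite_ncard_le_of_image {α : Type*} {A B : Set α} (φ : α → α → Prop)
    (hB : B.Finite) (h : ∀ a ∈ A, ∃ b ∈ B, φ a b)
    (hinj : ∀ a a' b, φ a b → φ a' b → a = a') : A.Finite ∧ A.ncard ≤ B.ncard := by
  classical
  choose! F hF using h
  have hmaps : ∀ a ∈ A, F a ∈ B := fun a ha => (hF a ha).1
  have hi : Set.InjOn F A := fun a ha a' ha' e =>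
    hinj a a' (F a) (hF a ha).2 (e ▸ (hF a' ha').2)
  refine ⟨Set.Finite.of_injOn hmaps hi hB, Set.ncard_le_ncard_of_injOn F hmaps hi hB⟩

/-- A cell that is bad for `f * g` is either bad for `g` or carried by `g` onto a cell that is bad
for `f`; the cells of the second kind inject into the bad cells of `f`. -/
theorem badCells_mul {f g : ℝ ≃o ℝ} (hf : (badCells f).Finite) (hg : (badCells g).Finite) :
    (badCells (f * g)).Finite ∧ badCount (f * g) ≤ badCount f + badCount g := by
  have hsub : badCells (f * g) ⊆ badCells g ∪ {I | ∃ J ∈ badCells f, CellMap g I J} := by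
    intro I hI
    by_cases h : IsGood g I
    · obtain ⟨J, hJ⟩ := h
      exact Or.inr ⟨J, fun ⟨K, hK⟩ => hI ⟨K, hJ.mul hK⟩, hJ⟩
    · exact Or.inl h
  have h2 : ({I | ∃ J ∈ badCells f, CellMap g I J} : Set (ℤ × ℕ)).Finite ∧
      ({I | ∃ J ∈ badCells f, CellMap g I J} : Set (ℤ × ℕ)).ncard ≤ (badCells f).ncard :=
    finite_ncard_le_of_image (fun I J => CellMap g I J) hf (fun I hI => hI)
      fun I J K h h' => h.injective h'
  refine ⟨(hg.union h2.1).subset hsub, ?_⟩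
  have h3 := Set.ncard_le_ncard hsub (hg.union h2.1)
  have h4 := Set.ncard_union_le (badCells g) {I | ∃ J ∈ badCells f, CellMap g I J}
  unfold badCount
  omega

/-! ### Subcells -/

/-- The `j`-th of the `2 ^ m` cells into which `I` is divided by halving `m` times. -/
def subcell (I : ℤ × ℕ) (m : ℕ) (j : ℤ) : ℤ × ℕ := (2 ^ m * I.1 + j, I.2 + m)

theorem cellPt_subcell (I : ℤ × ℕ) (m : ℕ) (j : ℤ) (t : ℝ) :
    cellPt (subcell I m j) t = cellPt I ((j + t) / 2 ^ m) := by
  unfold cellPt subcell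
  push_cast
  rw [pow_add]
  field_simp
  ring

/-- An affine bijection between cells matches their dyadic subdivisions. Hence goodness passes to
smaller cells. -/
theorem CellMap.subcell {f : ℝ → ℝ} {I J : ℤ × ℕ} (h : CellMap f I J) {m : ℕ} {j : ℤ}
    (h0 : 0 ≤ j) (h1 : j < 2 ^ m) : CellMap f (subcell I m j) (subcell J m j) := by
  intro t ht0 ht1
  have h0' : (0 : ℝ) ≤ j := by exact_mod_cast h0
  have h1' : (j : ℝ) + 1 ≤ 2 ^ m := by exact_mod_cast h1
  rw [cellPt_subcell, cellPt_subcell]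
  refine h _ (by positivity) ?_
  rw [div_le_one (by positivity)]
  linarith

theorem IsGood.subcell {f : ℝ → ℝ} {I : ℤ × ℕ} (h : IsGood f I) {m : ℕ} {j : ℤ}
    (h0 : 0 ≤ j) (h1 : j < 2 ^ m) : IsGood f (subcell I m j) := by
  obtain ⟨J, hJ⟩ := h
  exact ⟨_, hJ.subcell h0 h1⟩

/-- The cell of level `n` that contains `(k, n + m)`. -/
theorem eq_subcell (k : ℤ) (n m : ℕ) :
    (k, n + m) = subcell (k / 2 ^ m, n) m (k % 2 ^ m) ∧ 0 ≤ k % 2 ^ m ∧ k % 2 ^ m < 2 ^ m := by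
  have hpos : (0 : ℤ) < 2 ^ m := by positivity
  refine ⟨?_, Int.emod_nonneg _ hpos.ne', Int.emod_lt_of_pos _ hpos⟩
  unfold subcell
  rw [Int.mul_ediv_add_emod]

/-- The cell of level `n` that contains `u` (with its left end point, without the right one). -/
noncomputable def cellAt (u : ℝ) (n : ℕ) : ℤ × ℕ := (⌊2 ^ n * u⌋, n)

theorem cellPt_cellAt (u : ℝ) (n : ℕ) : cellPt (cellAt u n) (Int.fract (2 ^ n * u)) = u := by
  unfold cellPt cellAt
  rw [Int.floor_add_fract]
  field_simp

theorem cellAt_add (u : ℝ) (n m : ℕ) :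
    ∃ j : ℤ, 0 ≤ j ∧ j < 2 ^ m ∧ cellAt u (n + m) = subcell (cellAt u n) m j := by
  obtain ⟨h1, h2, h3⟩ := eq_subcell ⌊2 ^ (n + m) * u⌋ n m
  refine ⟨_, h2, h3, ?_⟩
  have h4 : ⌊(2 : ℝ) ^ (n + m) * u⌋ / 2 ^ m = ⌊2 ^ n * u⌋ := by
    have h5 : (2 : ℝ) ^ n * u = 2 ^ (n + m) * u / ((2 ^ m : ℕ) : ℝ) := by
      rw [pow_add]; push_cast; field_simp
    rw [h5, Int.floor_div_natCast]
    push_cast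
    rfl
  rw [h4] at h1
  exact h1

/-! ### Nested cells and the complexity -/

/-- Along an infinite sequence of different cells that cannot turn from good to bad, all cells are
good after `badCount f` steps. -/
theorem isGood_of_badCount_le {f : ℝ ≃o ℝ} (hf : (badCells f).Finite) {c : ℕ → ℤ × ℕ}
    (hc : Function.Injective c) (h : ∀ i, IsGood f (c i) → IsGood f (c (i + 1))) {n : ℕ}
    (hn : badCount f ≤ n) : IsGood f (c n) := by
  by_contra hbad
  have hall : ∀ i ≤ n, c i ∈ badCells f := by
    intro i hi hgood
    exact hbad (Nat.le_induction hgood (fun k _ hk => h k hk) n hi)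
  have h1 : (c '' (Finset.range (n + 1) : Set ℕ)) ⊆ badCells f := by
    rintro _ ⟨i, hi, rfl⟩
    exact hall i (by simpa [Nat.lt_succ_iff] using hi)
  have h2 := Set.ncard_le_ncard h1 hf
  rw [Set.ncard_image_of_injective _ hc, Set.ncard_coe_finset, Finset.card_range] at h2
  unfold badCount at hn
  omega

theorem isGood_cellAt {f : ℝ ≃o ℝ} (hf : (badCells f).Finite) (u : ℝ) {n : ℕ}
    (hn : badCount f ≤ n) : IsGood f (cellAt u n) := by
  refine isGood_of_badCount_le (c := cellAt u) hf (fun m n h => congrArg Prod.snd h) ?_ hn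
  intro i hi
  obtain ⟨j, h0, h1, h2⟩ := cellAt_add u i 1
  rw [h2]
  exact hi.subcell h0 h1

/-- A symmetric subadditive version of `badCount`. -/
noncomputable def complexity (f : ℝ ≃o ℝ) : ℕ := badCount f + badCount f⁻¹

theorem complexity_one : complexity 1 = 0 := by
  simp [complexity, badCount, badCells_one]

theorem complexity_inv (f : ℝ ≃o ℝ) : complexity f⁻¹ = complexity f := by
  unfold complexity; rw [inv_inv, add_comm]

/-- The increasing homeomorphisms of the line that map all but finitely many cells affinely onto
cells, together with their inverses. -/
def cellGroup : Subgroup (ℝ ≃o ℝ) where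
  carrier := {f | (badCells f).Finite ∧ (badCells f⁻¹).Finite}
  one_mem' := by simp [badCells_one]
  mul_mem' := fun {f g} hf hg => ⟨(badCells_mul hf.1 hg.1).1, by
    rw [mul_inv_rev]; exact (badCells_mul hg.2 hf.2).1⟩
  inv_mem' := fun {f} hf => ⟨hf.2, by rw [inv_inv]; exact hf.1⟩

theorem complexity_mul {f g : ℝ ≃o ℝ} (hf : f ∈ cellGroup) (hg : g ∈ cellGroup) :
    complexity (f * g) ≤ complexity f + complexity g := by
  have h1 := (badCells_mul hf.1 hg.1).2
  have h2 := (badCells_mul hg.2 hf.2).2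
  unfold complexity
  rw [mul_inv_rev]
  omega

theorem complexity_pow {g : ℝ ≃o ℝ} (hg : g ∈ cellGroup) (n : ℕ) :
    complexity (g ^ n) ≤ n * complexity g := by
  induction n with
  | zero => simp [complexity_one]
  | succ n ih =>
    rw [pow_succ, add_mul, one_mul]
    exact (complexity_mul (pow_mem hg n) hg).trans (by omega)

theorem complexity_zpow {g : ℝ ≃o ℝ} (hg : g ∈ cellGroup) (k : ℤ) :
    complexity (g ^ k) ≤ k.natAbs * complexity g := by
  obtain ⟨j, rfl | rfl⟩ := k.eq_nat_or_neg
  · simpa using complexity_pow hg j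
  · simpa [complexity_inv] using complexity_pow hg j

/-! ### The group of the real line: generation by a translation and a splitting map -/

/-- The translation `x ↦ x + 1`. -/
noncomputable def lineShift : ℝ ≃o ℝ := OrderIso.addRight 1

theorem StrictMono.max_of {f g : ℝ → ℝ} (hf : StrictMono f) (hg : StrictMono g) :
    StrictMono fun x => max (f x) (g x) := fun _ _ h => max_lt_max (hf h) (hg h)

theorem StrictMono.min_of {f g : ℝ → ℝ} (hf : StrictMono f) (hg : StrictMono g) :
    StrictMono fun x => min (f x) (g x) := fun _ _ h => min_lt_min (hf h) (hg h)

/-- The map that doubles `[0, 1]`, is the identity to the left and the translation by `1` to the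
right of it. -/
noncomputable def lineSplit : ℝ ≃o ℝ where
  toFun x := max x (min (2 * x) (x + 1))
  invFun x := min x (max (x / 2) (x - 1))
  left_inv x := by
    dsimp only
    rcases le_total x 0 with h | h
    · rw [min_eq_left (by linarith : 2 * x ≤ x + 1), max_eq_left (by linarith : 2 * x ≤ x),
        max_eq_left (by linarith : x - 1 ≤ x / 2), min_eq_left (by linarith)]
    · rcases le_total x 1 with h' | h'
      · rw [min_eq_left (by linarith : 2 * x ≤ x + 1), max_eq_right (by linarith : x ≤ 2 * x),
          max_eq_left (by linarith : 2 * x - 1 ≤ 2 * x / 2), min_eq_right (by linarith)]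
        ring
      · rw [min_eq_right (by linarith : x + 1 ≤ 2 * x), max_eq_right (by linarith : x ≤ x + 1),
          max_eq_right (by linarith : (x + 1) / 2 ≤ x + 1 - 1), min_eq_right (by linarith)]
        ring
  right_inv x := by
    dsimp only
    rcases le_total x 0 with h | h
    · rw [max_eq_left (by linarith : x - 1 ≤ x / 2), min_eq_left (by linarith : x ≤ x / 2),
        min_eq_left (by linarith : 2 * x ≤ x + 1), max_eq_left (by linarith)]
    · rcases le_total x 2 with h' | h'
      · rw [max_eq_left (by linarith : x - 1 ≤ x / 2), min_eq_right (by linarith : x / 2 ≤ x),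
          min_eq_left (by linarith : 2 * (x / 2) ≤ x / 2 + 1), max_eq_right (by linarith)]
        ring
      · rw [max_eq_right (by linarith : x / 2 ≤ x - 1), min_eq_right (by linarith : x - 1 ≤ x),
          min_eq_right (by linarith : x - 1 + 1 ≤ 2 * (x - 1)), max_eq_right (by linarith)]
        ring
  map_rel_iff' := by
    intro x y
    have : StrictMono fun x : ℝ => max x (min (2 * x) (x + 1)) := by
      refine StrictMono.max_of (f := fun x => x) strictMono_id (StrictMono.min_of
        (f := fun x => 2 * x) (g := fun x => x + 1) ?_ ?_) <;> intro a b h <;> dsimp <;> linarith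
    exact this.le_iff_le

theorem lineShift_apply (x : ℝ) : lineShift x = x + 1 := rfl

theorem lineShift_zpow_apply (c : ℤ) (x : ℝ) : (lineShift ^ c) x = x + c := by
  have hn : ∀ (n : ℕ) (x : ℝ), (lineShift ^ n) x = x + n := by
    intro n
    induction n with
    | zero => intro x; simp
    | succ n ih =>
      intro x
      rw [pow_succ]
      change (lineShift ^ n) (lineShift x) = _
      rw [ih, lineShift_apply]
      push_cast
      ring
  obtain ⟨n, rfl | rfl⟩ := c.eq_nat_or_neg
  · simpa using hn n x
  · rw [zpow_neg, zpow_natCast]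
    change (lineShift ^ n).symm x = _
    rw [OrderIso.symm_apply_eq, hn]
    push_cast
    ring

theorem lineSplit_of_nonpos {x : ℝ} (h : x ≤ 0) : lineSplit x = x := by
  change max x (min (2 * x) (x + 1)) = x
  rw [min_eq_left (by linarith), max_eq_left (by linarith)]

theorem lineSplit_of_mem {x : ℝ} (h0 : 0 ≤ x) (h1 : x ≤ 1) : lineSplit x = 2 * x := by
  change max x (min (2 * x) (x + 1)) = _
  rw [min_eq_left (by linarith), max_eq_right (by linarith)]

theorem lineSplit_of_one_le {x : ℝ} (h : 1 ≤ x) : lineSplit x = x + 1 := by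
  change max x (min (2 * x) (x + 1)) = _
  rw [min_eq_right (by linarith), max_eq_right (by linarith)]

theorem cellMap_lineShift_zpow (c k : ℤ) (n : ℕ) :
    CellMap (lineShift ^ c : ℝ ≃o ℝ) (k, n) (k + c * 2 ^ n, n) := by
  intro t _ _
  rw [lineShift_zpow_apply]
  unfold cellPt
  push_cast
  field_simp
  ring

theorem badCells_lineShift_zpow (c : ℤ) : badCells (lineShift ^ c) = ∅ := by
  ext ⟨k, n⟩
  simp only [badCells, Set.mem_ofPred_eq, Set.mem_empty_iff_false, iff_false, not_not]
  exact ⟨_, cellMap_lineShift_zpow c k n⟩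

theorem cellMap_lineSplit_neg {k : ℤ} (hk : k < 0) (n : ℕ) :
    CellMap lineSplit (k, n) (k, n) := by
  intro t _ ht
  refine lineSplit_of_nonpos ?_
  have : (k : ℝ) + 1 ≤ 0 := by exact_mod_cast hk
  exact div_nonpos_of_nonpos_of_nonneg (by dsimp; linarith) (by positivity)

theorem cellMap_lineSplit_mid {k : ℤ} {n : ℕ} (hk : 0 ≤ k) (hk' : k < 2 ^ (n + 1)) :
    CellMap lineSplit (k, n + 1) (k, n) := by
  intro t ht ht'
  have h0 : (0 : ℝ) ≤ k := by exact_mod_cast hk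
  have h1 : (k : ℝ) + 1 ≤ 2 ^ (n + 1) := by exact_mod_cast hk'
  unfold cellPt
  dsimp
  rw [lineSplit_of_mem (by positivity) (by rw [div_le_one (by positivity)]; linarith), pow_succ]
  field_simp

theorem cellMap_lineSplit_right {k : ℤ} {n : ℕ} (hk : 2 ^ n ≤ k) :
    CellMap lineSplit (k, n) (k + 2 ^ n, n) := by
  intro t ht ht'
  have h1 : (2 : ℝ) ^ n ≤ k := by exact_mod_cast hk
  unfold cellPt
  dsimp
  rw [lineSplit_of_one_le (by rw [le_div_iff₀ (by positivity)]; linarith)]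
  push_cast
  field_simp
  ring

/-- The cell `(0, 0)` is stretched onto [0, 2], which is longer than any cell; the smaller cells in
[0, 1] only double in length. -/
theorem isGood_lineSplit {I : ℤ × ℕ} (h : I ≠ (0, 0)) : IsGood lineSplit I := by
  obtain ⟨k, n⟩ := I
  rcases lt_or_ge k 0 with hk | hk
  · exact ⟨_, cellMap_lineSplit_neg hk n⟩
  rcases lt_or_ge k (2 ^ n) with hk' | hk'
  · cases n with
    | zero => exact absurd (by norm_num at hk'; simp; omega) h
    | succ n => exact ⟨_, cellMap_lineSplit_mid hk hk'⟩
  · exact ⟨_, cellMap_lineSplit_right hk'⟩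

/-- The preimage of [0, 1] under the inverse is [0, 2], which is no cell. That `(0, 0)` is never an
image is what makes the number of bad cells drop when `lineSplit⁻¹` is applied first. -/
theorem isGood_lineSplit_inv (I : ℤ × ℕ) :
    ∃ J, J ≠ (0, 0) ∧ CellMap (lineSplit⁻¹ : ℝ ≃o ℝ) I J := by
  obtain ⟨k, n⟩ := I
  rcases lt_or_ge k 0 with hk | hk
  · exact ⟨(k, n), by simp; omega, (cellMap_lineSplit_neg hk n).inv⟩
  rcases lt_or_ge k (2 ^ (n + 1)) with hk' | hk'
  · exact ⟨(k, n + 1), by simp, (cellMap_lineSplit_mid hk hk').inv⟩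
  · have h0 : (1 : ℤ) ≤ 2 ^ n := by exact_mod_cast Nat.one_le_two_pow
    refine ⟨(k - 2 ^ n, n), ?_, ?_⟩
    · rw [pow_succ] at hk'
      simp only [ne_eq, Prod.mk.injEq, not_and]
      omega
    · have := (cellMap_lineSplit_right (k := k - 2 ^ n) (n := n) (by rw [pow_succ] at hk'; omega)).inv
      rwa [sub_add_cancel] at this

theorem badCells_lineSplit_subset : badCells lineSplit ⊆ {(0, 0)} := by
  intro I hI
  by_contra h
  exact hI (isGood_lineSplit h)

theorem badCells_lineSplit_inv : badCells lineSplit⁻¹ = ∅ := by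
  ext I
  simp only [badCells, Set.mem_ofPred_eq, Set.mem_empty_iff_false, iff_false, not_not]
  obtain ⟨J, -, h⟩ := isGood_lineSplit_inv I
  exact ⟨J, h⟩

theorem badCells_mul_eq_empty {f g : ℝ ≃o ℝ} (hf : badCells f = ∅) (hg : badCells g = ∅) :
    badCells (f * g) = ∅ := by
  ext I
  simp only [badCells, Set.mem_ofPred_eq, Set.mem_empty_iff_false, iff_false, not_not]
  obtain ⟨J, hJ⟩ := isGood_of_badCells_eq_empty hg I
  obtain ⟨K, hK⟩ := isGood_of_badCells_eq_empty hf J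
  exact ⟨K, hJ.mul hK⟩

/-! ### Behaviour near infinity -/

/-- `f` is a translation by an integer of absolute value at most `b` on `[b, ∞)`, and likewise
on `(-∞, -b]`. -/
def IsTame (b : ℕ) (f : ℝ → ℝ) : Prop :=
  (∃ s : ℤ, |s| ≤ b ∧ ∀ x : ℝ, b ≤ x → f x = x + s) ∧
    ∃ s : ℤ, |s| ≤ b ∧ ∀ x : ℝ, x ≤ -b → f x = x + s

namespace IsTame

/-- The inner map moves a point beyond ±(a + b) by at most `b`, so the point stays where the outer
map is a translation. -/
theorem mul {a b : ℕ} {f g : ℝ ≃o ℝ} (hf : IsTame a f) (hg : IsTame b g) :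
    IsTame (a + b) (f * g : ℝ ≃o ℝ) := by
  obtain ⟨⟨s, hs, h1⟩, ⟨t, ht, h2⟩⟩ := hf
  obtain ⟨⟨s', hs', h1'⟩, ⟨t', ht', h2'⟩⟩ := hg
  rw [abs_le] at hs ht hs' ht'
  have r1 : (-b : ℝ) ≤ s' := by exact_mod_cast hs'.1
  have r2 : (t' : ℝ) ≤ b := by exact_mod_cast ht'.2
  have ra : (0 : ℝ) ≤ a := by positivity
  constructor
  · refine ⟨s + s', by rw [abs_le]; push_cast; omega, fun x hx => ?_⟩
    push_cast at hx
    change f (g x) = _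
    rw [h1' x (by linarith), h1 _ (by linarith)]
    push_cast
    ring
  · refine ⟨t + t', by rw [abs_le]; push_cast; omega, fun x hx => ?_⟩
    push_cast at hx
    change f (g x) = _
    rw [h2' x (by linarith), h2 _ (by linarith)]
    push_cast
    ring

/-- The inverse is known on the image of [b, ∞), which contains [2b, ∞) because the shift is at most
`b`; hence the factor 2. The other end is similar. -/
theorem inv {b : ℕ} {f : ℝ ≃o ℝ} (hf : IsTame b f) : IsTame (2 * b) (f⁻¹ : ℝ ≃o ℝ) := by
  obtain ⟨⟨s, hs, h1⟩, ⟨t, ht, h2⟩⟩ := hf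
  rw [abs_le] at hs ht
  have r1 : (s : ℝ) ≤ b := by exact_mod_cast hs.2
  have r2 : (-b : ℝ) ≤ t := by exact_mod_cast ht.1
  constructor
  · refine ⟨-s, by rw [abs_le]; push_cast; omega, fun x hx => ?_⟩
    push_cast at hx
    change f.symm x = _
    rw [OrderIso.symm_apply_eq, h1 _ (by push_cast; linarith)]
    push_cast
    ring
  · refine ⟨-t, by rw [abs_le]; push_cast; omega, fun x hx => ?_⟩
    push_cast at hx
    change f.symm x = _
    rw [OrderIso.symm_apply_eq, h2 _ (by push_cast; linarith)]
    push_cast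
    ring

theorem mono {a b : ℕ} {f : ℝ → ℝ} (hf : IsTame a f) (h : a ≤ b) : IsTame b f := by
  obtain ⟨⟨s, hs, h1⟩, ⟨t, ht, h2⟩⟩ := hf
  have r : (a : ℝ) ≤ b := by exact_mod_cast h
  refine ⟨⟨s, by omega, fun x hx => h1 x (by linarith)⟩,
    ⟨t, by omega, fun x hx => h2 x (by linarith)⟩⟩

/-- This confines the bad unit cells to the window from -b to b. -/
theorem isGood {b : ℕ} {f : ℝ → ℝ} (hf : IsTame b f) {j : ℤ} (hj : j < -b ∨ b ≤ j) :
    IsGood f (j, 0) := by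
  obtain ⟨⟨s, hs, h1⟩, ⟨t, ht, h2⟩⟩ := hf
  rcases hj with hj | hj
  · refine ⟨(j + t, 0), fun x hx hx' => ?_⟩
    have : (j : ℝ) + 1 ≤ -b := by exact_mod_cast hj
    unfold cellPt
    rw [h2 _ (by simp; linarith)]
    simp
    ring
  · refine ⟨(j + s, 0), fun x hx hx' => ?_⟩
    have : (b : ℝ) ≤ j := by exact_mod_cast hj
    unfold cellPt
    rw [h1 _ (by simp; linarith)]
    simp
    ring

theorem one : IsTame 0 (1 : ℝ ≃o ℝ) := ⟨⟨0, by simp⟩, ⟨0, by simp⟩⟩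

theorem lineShift : IsTame 1 lineShift := by
  refine ⟨⟨1, by simp, fun x _ => ?_⟩, ⟨1, by simp, fun x _ => ?_⟩⟩ <;>
    simp [lineShift_apply]

theorem lineSplit : IsTame 1 lineSplit := by
  refine ⟨⟨1, by simp, fun x hx => ?_⟩, ⟨0, by simp, fun x hx => ?_⟩⟩
  · rw [lineSplit_of_one_le (by simpa using hx)]; simp
  · rw [lineSplit_of_nonpos (by push_cast at hx; linarith)]; simp

end IsTame

/-- Properties of words in `lineShift` and `lineSplit`. -/
theorem IsWord.tame_badCount {n : ℕ} {w : ℝ ≃o ℝ} (hw : IsWord {lineShift, lineSplit} n w) :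
    IsTame (2 * n) w ∧ (badCells w).Finite ∧ badCount w ≤ n := by
  obtain ⟨l, hl, rfl, hn⟩ := hw
  suffices h : IsTame (2 * l.length) l.prod ∧ (badCells l.prod).Finite ∧
      badCount l.prod ≤ l.length from ⟨h.1.mono (by omega), h.2.1, h.2.2.trans hn⟩
  clear hn
  induction l with
  | nil => exact ⟨IsTame.one, by simp [badCells_one, badCount]⟩
  | cons x l ih =>
    obtain ⟨h1, h2, h3⟩ := ih fun y hy => hl y (List.mem_cons_of_mem _ hy)
    have hx : IsTame 2 x ∧ (badCells x).Finite ∧ badCount x ≤ 1 := by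
      have hs1 := badCells_lineShift_zpow 1
      have hs2 := badCells_lineShift_zpow (-1)
      rw [zpow_one] at hs1
      rw [zpow_neg, zpow_one] at hs2
      have hy := badCells_lineSplit_subset
      have hy' := badCells_lineSplit_inv
      rcases hl x List.mem_cons_self with (rfl | hx) | (hx | hx)
      · exact ⟨IsTame.lineShift.mono (by norm_num), by simp [hs1], by simp [badCount, hs1]⟩
      · rw [Set.mem_singleton_iff] at hx
        subst hx
        exact ⟨IsTame.lineSplit.mono (by norm_num), (Set.finite_singleton _).subset hy,
          (Set.ncard_le_ncard hy).trans (by simp)⟩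
      · rw [inv_eq_iff_eq_inv] at hx
        subst hx
        exact ⟨IsTame.lineShift.inv, by simp [hs2], by simp [badCount, hs2]⟩
      · rw [Set.mem_singleton_iff, inv_eq_iff_eq_inv] at hx
        subst hx
        exact ⟨IsTame.lineSplit.inv, by simp [hy'], by simp [badCount, hy']⟩
    have h4 := badCells_mul hx.2.1 h2
    rw [List.prod_cons, List.length_cons]
    exact ⟨(hx.1.mul h1).mono (by omega), h4.1, by omega⟩

/-! ### Removing bad cells by short words -/

/-- If the bad unit cells of `f` lie in `[0, r]`, all bad cells can be removed by a short word. -/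
theorem exists_word_badCells_eq_empty (n : ℕ) : ∀ (f : ℝ ≃o ℝ) (r : ℕ), (badCells f).Finite →
    2 * badCount f + r ≤ n → (∀ j : ℤ, j < 0 ∨ r ≤ j → IsGood f (j, 0)) →
    ∃ w, IsWord {lineShift, lineSplit} n w ∧ badCells (f * w) = ∅ ∧
      (badCells f⁻¹ = ∅ → badCells (f * w)⁻¹ = ∅) := by
  -- The potential 2 * `badCount f` + r decreases by at least one per letter. The clause on inverses
  -- ensures that a second run, on the inverse of the result of a first run, keeps what the first
  -- has achieved.
  induction n with
  | zero =>
    intro f r hf hn hr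
    refine ⟨1, IsWord.one _ _, ?_, by simp⟩
    rw [mul_one]
    exact (Set.ncard_eq_zero hf).1 (by unfold badCount at hn; omega)
  | succ n ih =>
    intro f r hf hn hr
    by_cases h0 : badCells f = ∅
    · exact ⟨1, IsWord.one _ _, by simpa, by simp⟩
    have hrpos : 0 < r := by
      rcases Nat.eq_zero_or_pos r with rfl | h
      · refine absurd ?_ h0
        ext ⟨k, m⟩
        simp only [badCells, Set.mem_ofPred_eq, Set.mem_empty_iff_false, iff_false, not_not]
        obtain ⟨h1, h2, h3⟩ := eq_subcell k 0 m
        rw [zero_add] at h1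
        rw [h1]
        exact (hr _ (by push_cast; exact lt_or_ge _ _)).subcell h2 h3
      · exact h
    by_cases hg : IsGood f (0, 0)
    -- If [0, 1] is good, a shift by 1 puts it to the left of the window, which becomes shorter by
    -- one.
    · have hτ := badCells_lineShift_zpow 1
      have hτ' := badCells_lineShift_zpow (-1)
      rw [zpow_one] at hτ
      rw [zpow_neg, zpow_one] at hτ'
      have hm := badCells_mul hf (g := lineShift) (by simp [hτ])
      have hc : badCount lineShift = 0 := by simp [badCount, hτ]
      obtain ⟨w, hw, h1, h2⟩ := ih (f * lineShift) (r - 1) hm.1 (by omega) (by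
        intro j hj
        obtain ⟨K, hK⟩ : IsGood f (j + 1, 0) := by
          rcases eq_or_ne j (-1) with rfl | hj'
          · simpa using hg
          · exact hr _ (by omega)
        have := cellMap_lineShift_zpow 1 j 0
        rw [zpow_one] at this
        exact ⟨K, CellMap.mul (by simpa using this) hK⟩)
      refine ⟨lineShift * w, ?_, by rwa [← mul_assoc], fun h => ?_⟩
      · rw [add_comm]
        exact (IsWord.of_mem (by simp)).mul hw
      · rw [← mul_assoc]
        refine h2 ?_
        rw [mul_inv_rev]
        exact badCells_mul_eq_empty hτ' h
    -- If [0, 1] is bad, `lineSplit⁻¹` removes at least one bad cell. The window grows by one, which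
    -- the weight 2 of the bad cells outweighs.
    · have hcount : (badCells (f * lineSplit⁻¹)).Finite ∧
          badCount (f * lineSplit⁻¹) + 1 ≤ badCount f := by
        have h1 := finite_ncard_le_of_image (A := badCells (f * lineSplit⁻¹))
          (B := badCells f \ {(0, 0)}) (fun I J => CellMap (lineSplit⁻¹ : ℝ ≃o ℝ) I J)
          (hf.subset Set.sdiff_subset) (fun I hI => by
            obtain ⟨J, hJ0, hJ⟩ := isGood_lineSplit_inv I
            exact ⟨J, ⟨fun ⟨K, hK⟩ => hI ⟨K, hJ.mul hK⟩, hJ0⟩, hJ⟩)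
          (fun I J K h h' => h.injective h')
        have h2 := Set.ncard_sdiff_singleton_add_one (s := badCells f) hg hf
        exact ⟨h1.1, by unfold badCount; omega⟩
      obtain ⟨w, hw, h1, h2⟩ := ih (f * lineSplit⁻¹) (r + 1) hcount.1 (by omega) (by
        intro j hj
        rcases lt_or_ge j 0 with hj' | hj'
        · obtain ⟨K, hK⟩ := hr j (Or.inl hj')
          exact ⟨K, (cellMap_lineSplit_neg hj' 0).inv.mul hK⟩
        · obtain ⟨K, hK⟩ := hr (j - 1) (Or.inr (by omega))
          have := (cellMap_lineSplit_right (k := j - 1) (n := 0) (by simp; omega)).inv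
          exact ⟨K, CellMap.mul (by simpa using this) hK⟩)
      refine ⟨lineSplit⁻¹ * w, ?_, by rwa [← mul_assoc], fun h => ?_⟩
      · rw [add_comm]
        exact (IsWord.of_mem (by simp)).inv.mul hw
      · rw [← mul_assoc]
        refine h2 ?_
        rw [mul_inv_rev, inv_inv]
        ext I
        simp only [badCells, Set.mem_ofPred_eq, Set.mem_empty_iff_false, iff_false, not_not]
        obtain ⟨J, hJ⟩ := isGood_of_badCells_eq_empty h I
        -- The only cell on which `lineSplit` could fail is `(0, 0)`; it is not an image under
        -- `f⁻¹`, being bad for `f`.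
        obtain ⟨K, hK⟩ : IsGood lineSplit J := isGood_lineSplit (by
          rintro rfl
          exact hg ⟨I, by simpa using hJ.inv⟩)
        exact ⟨K, hJ.mul hK⟩

/-- A homeomorphism without bad cells in either direction is a translation. -/
theorem exists_eq_lineShift_zpow {f : ℝ ≃o ℝ} (h : badCells f = ∅) (h' : badCells f⁻¹ = ∅) :
    ∃ c : ℤ, f = lineShift ^ c := by
  have h1 : ∀ j : ℤ, ∃ k : ℤ, CellMap f (j, 0) (k, 0) := by
    intro j
    obtain ⟨⟨k, s⟩, hJ⟩ := isGood_of_badCells_eq_empty h (j, 0)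
    obtain ⟨h2, h3, h4⟩ := eq_subcell k 0 s
    rw [zero_add] at h2
    -- The unit cell around the image `(k, s)` also goes to a cell `Q` under `f⁻¹`, so the unit cell
    -- `(j, 0)` sits in `Q` at depth `s`. Levels are nonnegative, which forces `s = 0`.
    obtain ⟨Q, hQ⟩ := isGood_of_badCells_eq_empty h' (k / 2 ^ s, 0)
    have h5 := hQ.subcell h3 h4
    rw [← h2] at h5
    have h6 := congrArg Prod.snd (hJ.inv.unique h5)
    have h7 : s = 0 := by
      have : 0 = Q.2 + s := h6
      omega
    subst h7
    exact ⟨k, hJ⟩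
  choose k hk using h1
  have hk' : ∀ (j : ℤ) (t : ℝ), 0 ≤ t → t ≤ 1 → f (j + t) = k j + t := by
    intro j t h0 h1
    have := hk j t h0 h1
    simpa [cellPt] using this
  have hstep : ∀ j, k (j + 1) = k j + 1 := by
    intro j
    have h2 := hk' j 1 zero_le_one le_rfl
    have h3 := hk' (j + 1) 0 le_rfl zero_le_one
    push_cast at h3
    rw [add_zero, h2, add_zero] at h3
    exact_mod_cast h3.symm
  have hall : ∀ j, k j = j + k 0 := by
    intro j
    induction j using Int.induction_on with
    | zero => simp
    | succ i ih => rw [hstep, ih]; ring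
    | pred i ih =>
      have := hstep (-i - 1)
      rw [sub_add_cancel] at this
      omega
  refine ⟨k 0, ?_⟩
  ext x
  rw [lineShift_zpow_apply]
  have := hk' ⌊x⌋ (Int.fract x) (Int.fract_nonneg _) (Int.fract_lt_one _).le
  rw [Int.floor_add_fract, hall] at this
  rw [this]
  push_cast
  linarith [Int.floor_add_fract x]

/-- A tame homeomorphism with few bad cells is a short word in `lineShift` and `lineSplit`. -/
theorem isWord_of_isTame {f : ℝ ≃o ℝ} (hf : f ∈ cellGroup) {b : ℕ} (hb : complexity f ≤ b)
    (ht : IsTame b f) : IsWord {lineShift, lineSplit} (261 * b) f := by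
  have hτ : ∀ c : ℤ, IsWord {lineShift, lineSplit} c.natAbs (lineShift ^ c) := fun c => by
    simpa using (IsWord.of_mem (T := {lineShift, lineSplit}) (g := lineShift) (by simp)).zpow c
  -- A shift by -a moves the window of bad unit cells to [0, 2a]. It costs `a` letters, and the
  -- removal of the bad cells 2m + 2a.
  have reduce : ∀ (e : ℝ ≃o ℝ) (a m : ℕ), (badCells e).Finite → badCount e ≤ m → IsTame a e →
      ∃ v, IsWord {lineShift, lineSplit} (2 * m + 3 * a) v ∧ badCells (e * v) = ∅ ∧
        (badCells e⁻¹ = ∅ → badCells (e * v)⁻¹ = ∅) := by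
    intro e a m he hm ha
    have h0 := badCells_lineShift_zpow (-a)
    have h1 := badCells_mul he (g := lineShift ^ (-a : ℤ)) (by rw [h0]; exact Set.finite_empty)
    have hc : badCount (lineShift ^ (-a : ℤ)) = 0 := by rw [badCount, h0, Set.ncard_empty]
    obtain ⟨w, hw, h2, h3⟩ := exists_word_badCells_eq_empty (2 * m + 2 * a) (e * lineShift ^ (-a : ℤ))
      (2 * a) h1.1 (by omega) (by
        intro j hj
        obtain ⟨K, hK⟩ := ha.isGood (j := j - a) (by push_cast at hj; omega)
        have := cellMap_lineShift_zpow (-a) j 0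
        exact ⟨K, CellMap.mul (by simpa [sub_eq_add_neg] using this) hK⟩)
    refine ⟨lineShift ^ (-a : ℤ) * w, ((hτ _).mul hw).mono subset_rfl (by simp; omega), by
      rwa [← mul_assoc], fun h => ?_⟩
    rw [← mul_assoc]
    refine h3 ?_
    rw [mul_inv_rev, ← zpow_neg]
    exact badCells_mul_eq_empty (badCells_lineShift_zpow _) h
  -- Here `v` has 5b letters and is tame with bound 10b. So `(f * v)⁻¹` has at most 6b bad cells and
  -- bound 22b, and `w` has 12b + 66b = 78b letters. The remaining translation is by at most 22b +
  -- 156b = 178b, and 78 + 178 + 5 = 261.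
  obtain ⟨v, hv, hv1, -⟩ := reduce f b b hf.1 (by unfold complexity at hb; omega) ht
  obtain ⟨w, hw, hw1, hw2⟩ := reduce (f * v)⁻¹ (22 * b) (6 * b)
    (by rw [mul_inv_rev]; exact (badCells_mul hv.inv.tame_badCount.2.1 hf.2).1)
    (by
      rw [mul_inv_rev]
      have h1 := (badCells_mul hv.inv.tame_badCount.2.1 hf.2).2
      have h2 := hv.inv.tame_badCount.2.2
      unfold complexity at hb
      omega)
    ((ht.mul hv.tame_badCount.1).inv.mono (by omega))
  obtain ⟨c, hc⟩ := exists_eq_lineShift_zpow hw1 (hw2 (by rwa [inv_inv]))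
  have hcb : c.natAbs ≤ 178 * b := by
    obtain ⟨⟨s, hs, h1⟩, -⟩ := ((ht.mul hv.tame_badCount.1).inv.mul hw.tame_badCount.1)
    rw [hc] at h1
    have h2 := h1 _ le_rfl
    rw [lineShift_zpow_apply] at h2
    have h3 : c = s := by
      have := add_left_cancel h2
      exact_mod_cast this
    subst h3
    rw [abs_le] at hs
    push_cast at hs
    omega
  have hfe : f = w * lineShift ^ (-c) * v⁻¹ := by
    rw [zpow_neg, ← hc]
    group
  rw [hfe]
  exact ((hw.mul (hτ _)).mul hv.inv).mono subset_rfl (by rw [Int.natAbs_neg]; omega)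

/-! ### Thompson's group as a group of homeomorphisms of the line -/

open Classical in
/-- The extension by the identity of a homeomorphism of the unit interval to the line. -/
noncomputable def lineExtFun (f : unitInterval ≃o unitInterval) (x : ℝ) : ℝ :=
  if h : x ∈ unitInterval then (f ⟨x, h⟩ : unitInterval) else x

theorem lineExtFun_coe (f : unitInterval ≃o unitInterval) (x : unitInterval) :
    lineExtFun f x = (f x : unitInterval) := dif_pos x.2

theorem lineExtFun_of_notMem (f : unitInterval ≃o unitInterval) {x : ℝ} (h : x ∉ unitInterval) :
    lineExtFun f x = x := dif_neg h

theorem lineExtFun_mul (f g : unitInterval ≃o unitInterval) (x : ℝ) :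
    lineExtFun (f * g) x = lineExtFun f (lineExtFun g x) := by
  by_cases h : x ∈ unitInterval
  · lift x to unitInterval using h
    simp only [lineExtFun_coe]
    rfl
  · simp only [lineExtFun_of_notMem _ h]

theorem lineExtFun_one (x : ℝ) : lineExtFun 1 x = x := by
  by_cases h : x ∈ unitInterval
  · lift x to unitInterval using h
    simp only [lineExtFun_coe]
    rfl
  · exact lineExtFun_of_notMem _ h

theorem lineExtFun_strictMono (f : unitInterval ≃o unitInterval) :
    StrictMono (lineExtFun f) := by
  intro x y hxy
  by_cases hx : x ∈ unitInterval <;> by_cases hy : y ∈ unitInterval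
  · lift x to unitInterval using hx
    lift y to unitInterval using hy
    rw [lineExtFun_coe, lineExtFun_coe]
    exact f.strictMono hxy
  · lift x to unitInterval using hx
    rw [lineExtFun_coe, lineExtFun_of_notMem _ hy]
    have : 1 < y := by
      by_contra h
      exact hy ⟨x.2.1.trans hxy.le, not_lt.1 h⟩
    exact (f x).2.2.trans_lt this
  · lift y to unitInterval using hy
    rw [lineExtFun_coe, lineExtFun_of_notMem _ hx]
    have : x < 0 := by
      by_contra h
      exact hx ⟨not_lt.1 h, hxy.le.trans y.2.2⟩
    exact this.trans_le (f y).2.1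
  · rwa [lineExtFun_of_notMem _ hx, lineExtFun_of_notMem _ hy]

/-- Extension by the identity, as a group homomorphism. -/
noncomputable def lineExt : (unitInterval ≃o unitInterval) →* (ℝ ≃o ℝ) where
  toFun f :=
    { toFun := lineExtFun f
      invFun := lineExtFun f⁻¹
      left_inv := fun x => by rw [← lineExtFun_mul, inv_mul_cancel, lineExtFun_one]
      right_inv := fun x => by rw [← lineExtFun_mul, mul_inv_cancel, lineExtFun_one]
      map_rel_iff' := (lineExtFun_strictMono f).le_iff_le }
  map_one' := by ext x; exact lineExtFun_one x
  map_mul' f g := by ext x; exact lineExtFun_mul f g x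

theorem lineExt_coe (f : unitInterval ≃o unitInterval) (x : unitInterval) :
    lineExt f x = (f x : unitInterval) := lineExtFun_coe f x

theorem lineExt_injective : Function.Injective lineExt := by
  intro f g h
  ext x
  rw [← lineExt_coe, ← lineExt_coe, h]

/-- Thompson's group `F`, acting on the line and supported in `[0, 1]`. -/
noncomputable def lineF : Subgroup (ℝ ≃o ℝ) := thompsonF.map lineExt

/-- `f` is piecewise linear on `[0, 1]` with slopes powers of `2` and dyadic break points. -/
def HasDyadicBreaks (f : ℝ → ℝ) : Prop :=
  ∃ B : Finset ℝ, (∀ d ∈ B, IsDyadicReal d) ∧ ∀ a b : ℝ, 0 ≤ a → a < b → b ≤ 1 →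
    (∀ d ∈ B, d ≤ a ∨ b ≤ d) → ∃ (k : ℤ) (c : ℝ), ∀ x, a ≤ x → x ≤ b → f x = (2 : ℝ) ^ k * x + c

theorem mem_lineF_iff {f : ℝ ≃o ℝ} :
    f ∈ lineF ↔ (∀ x, x ≤ 0 → f x = x) ∧ (∀ x, 1 ≤ x → f x = x) ∧ HasDyadicBreaks f := by
  constructor
  · rintro ⟨g, ⟨B, hB, hg⟩, rfl⟩
    have hout : ∀ x, (x ≤ 0 ∨ 1 ≤ x) → lineExt g x = x := by
      intro x hx
      by_cases h : x ∈ unitInterval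
      · lift x to unitInterval using h
        rw [lineExt_coe]
        rcases hx with hx | hx
        · have : x = 0 := le_antisymm hx x.2.1
          rw [this, orderIso_apply_zero]
        · have : x = 1 := le_antisymm x.2.2 hx
          have h1 : g 1 = 1 := by
            have : g ⊤ = ⊤ := map_top g
            exact this
          rw [this, h1]
      · exact lineExtFun_of_notMem g h
    refine ⟨fun x hx => hout x (Or.inl hx), fun x hx => hout x (Or.inr hx), B, hB, ?_⟩
    intro a b ha hab hb hd
    obtain ⟨k, c, h⟩ := hg ⟨a, ha, hab.le.trans hb⟩ ⟨b, ha.trans hab.le, hb⟩ hab (by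
      rintro d hdB ⟨h1, h2⟩
      have h1' : a < d := h1
      have h2' : d < b := h2
      rcases hd d hdB with h | h <;> linarith)
    refine ⟨k, c, fun x hax hxb => ?_⟩
    have := h ⟨x, ha.trans hax, hxb.trans hb⟩ hax hxb
    rw [← this, ← lineExt_coe]
  · rintro ⟨h0, h1, B, hB, hf⟩
    have e0 := h0 0 le_rfl
    have e1 := h1 1 le_rfl
    have e0' : f.symm 0 = 0 := by rw [OrderIso.symm_apply_eq, e0]
    have e1' : f.symm 1 = 1 := by rw [OrderIso.symm_apply_eq, e1]
    let g : unitInterval ≃o unitInterval :=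
      { toFun := fun x => ⟨f x, by rw [← e0]; exact f.monotone x.2.1,
          (f.monotone x.2.2).trans e1.le⟩
        invFun := fun x => ⟨f.symm x, by rw [← e0']; exact f.symm.monotone x.2.1,
          (f.symm.monotone x.2.2).trans e1'.le⟩
        left_inv := fun x => Subtype.ext (f.symm_apply_apply _)
        right_inv := fun x => Subtype.ext (f.apply_symm_apply _)
        map_rel_iff' := f.le_iff_le }
    have hg : ∀ x, ((g x : unitInterval) : ℝ) = f x := fun x => rfl
    refine ⟨g, ⟨B, hB, fun a b hab h => ?_⟩, ?_⟩
    · obtain ⟨k, c, h2⟩ := hf a b a.2.1 hab b.2.2 (fun d hd => by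
        by_contra h3
        push Not at h3
        exact h d hd h3)
      exact ⟨k, c, fun x hax hxb => by rw [hg]; exact h2 x hax hxb⟩
    · ext x
      by_cases h : x ∈ unitInterval
      · lift x to unitInterval using h
        rw [lineExt_coe, hg]
      · have h2 : lineExt g x = x := lineExtFun_of_notMem g h
        rw [h2]
        by_cases hx : x ≤ 0
        · rw [h0 x hx]
        · rw [h1 x]
          by_contra h3
          exact h ⟨(not_le.1 hx).le, (not_le.1 h3).le⟩

/-! ### Finiteness of the bad cells of the elements of `F` -/

theorem IsDyadicReal.apply_of_mem_lineF {f : ℝ ≃o ℝ} (hf : f ∈ lineF) {x : ℝ}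
    (hx : IsDyadicReal x) : IsDyadicReal (f x) := by
  obtain ⟨g, ⟨B, hB, hg⟩, rfl⟩ := hf
  by_cases h : x ∈ unitInterval
  · lift x to unitInterval using h
    rw [lineExt_coe]
    exact (dyadic_iff_of_breaks hB hg x).2 hx
  · have h2 : lineExt g x = x := lineExtFun_of_notMem g h
    rwa [h2]

theorem IsDyadicReal.exists_level {x : ℝ} (hx : IsDyadicReal x) :
    ∃ n₀ : ℕ, ∀ n ≥ n₀, ∃ m : ℤ, x = m / 2 ^ n := by
  obtain ⟨m, n, rfl⟩ := hx
  refine ⟨n, fun n' hn => ?_⟩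
  obtain ⟨j, rfl⟩ := Nat.exists_eq_add_of_le hn
  refine ⟨m * 2 ^ j, ?_⟩
  push_cast
  rw [pow_add]
  field_simp

theorem exists_common_level (B : Finset ℝ) (hB : ∀ d ∈ B, IsDyadicReal d) :
    ∃ n₀ : ℕ, ∀ n ≥ n₀, ∀ d ∈ B, ∃ m : ℤ, d = m / 2 ^ n := by
  classical
  induction B using Finset.induction_on with
  | empty => exact ⟨0, by simp⟩
  | insert a B _ ih =>
    obtain ⟨n₁, h1⟩ := ih fun d hd => hB d (Finset.mem_insert_of_mem hd)
    obtain ⟨n₂, h2⟩ := (hB a (Finset.mem_insert_self _ _)).exists_level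
    refine ⟨max n₁ n₂, fun n hn d hd => ?_⟩
    rcases Finset.mem_insert.1 hd with rfl | hd
    · exact h2 n (le_of_max_le_right hn)
    · exact h1 n (le_of_max_le_left hn) d hd

theorem IsDyadicReal.cellPt_zero (I : ℤ × ℕ) : IsDyadicReal (cellPt I 0) :=
  ⟨I.1, I.2, by simp [cellPt]⟩

/-- An affine map with slope a power of `2` and dyadic constant term is good on all small
subcells. -/
theorem exists_isGood_subcell {f : ℝ → ℝ} {I : ℤ × ℕ} {s : ℤ} {c : ℝ} (hc : IsDyadicReal c)
    (hf : ∀ t, 0 ≤ t → t ≤ 1 → f (cellPt I t) = 2 ^ s * cellPt I t + c) :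
    ∃ n₀ : ℕ, ∀ n ≥ n₀, ∀ j : ℤ, 0 ≤ j → j < 2 ^ n → IsGood f (subcell I n j) := by
  obtain ⟨r, hr⟩ := hc.exists_level
  -- The image of a subcell has length 2^(-L) with L = I.2 + n - s. The choice of `n` makes L ≥ r,
  -- so L is a natural number and `c` lies on the grid of level L.
  refine ⟨s.natAbs + r, fun n hn j h0 h1 => ?_⟩
  obtain ⟨L, hL⟩ : ∃ L : ℕ, (L : ℤ) = I.2 + n - s :=
    ⟨((I.2 : ℤ) + n - s).toNat, Int.toNat_of_nonneg (by omega)⟩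
  obtain ⟨m, hm⟩ := hr L (by omega)
  refine ⟨((subcell I n j).1 + m, L), fun t ht0 ht1 => ?_⟩
  have h0' : (0 : ℝ) ≤ j := by exact_mod_cast h0
  have h1' : (j : ℝ) + 1 ≤ 2 ^ n := by exact_mod_cast h1
  rw [cellPt_subcell, hf _ (by positivity) (by rw [div_le_one (by positivity)]; linarith),
    ← cellPt_subcell, hm]
  unfold cellPt
  have h2 : (2 : ℝ) ^ (subcell I n j).2 = 2 ^ s * 2 ^ L := by
    rw [← zpow_natCast, ← zpow_natCast, ← zpow_add₀ two_ne_zero, hL]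
    congr 1
    unfold subcell
    push_cast
    ring
  rw [h2]
  have h3 : (2 : ℝ) ^ s ≠ 0 := by positivity
  push_cast
  field_simp
  ring

theorem cellMap_self {f : ℝ → ℝ} {I : ℤ × ℕ}
    (h : ∀ x, cellPt I 0 ≤ x → x ≤ cellPt I 1 → f x = x) : CellMap f I I := fun _ h0 h1 =>
  h _ ((cellPt_strictMono I).monotone h0) ((cellPt_strictMono I).monotone h1)

/-- At a level where all breaks are grid points, f is affine on each cell, with dyadic constant
term, so all sufficiently deep subcells are good. Cells outside [0, 1] are fixed, and only finitely
many cells remain. -/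
theorem badCells_finite_of_mem_lineF {f : ℝ ≃o ℝ} (hf : f ∈ lineF) : (badCells f).Finite := by
  obtain ⟨h0, h1, B, hB, hb⟩ := mem_lineF_iff.1 hf
  obtain ⟨n₀, hn₀⟩ := exists_common_level B hB
  have hcell : ∀ k : ℤ, 0 ≤ k → k < 2 ^ n₀ → ∃ N : ℕ, ∀ n ≥ N, ∀ j : ℤ, 0 ≤ j → j < 2 ^ n →
      IsGood f (subcell (k, n₀) n j) := by
    intro k hk hk'
    have hk0 : (0 : ℝ) ≤ k := by exact_mod_cast hk
    have hk1 : (k : ℝ) + 1 ≤ 2 ^ n₀ := by exact_mod_cast hk'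
    obtain ⟨s, c, h⟩ := hb (cellPt (k, n₀) 0) (cellPt (k, n₀) 1) (by unfold cellPt; positivity)
      (cellPt_strictMono _ one_pos)
      (by unfold cellPt; rw [div_le_one (by positivity)]; exact hk1) (by
        intro d hd
        obtain ⟨m, rfl⟩ := hn₀ n₀ le_rfl d hd
        unfold cellPt
        rcases le_or_gt m k with h | h
        · left
          have : (m : ℝ) ≤ k := by exact_mod_cast h
          rw [add_zero]
          gcongr
        · right
          have : (k : ℝ) + 1 ≤ m := by exact_mod_cast h
          gcongr)
    have hc : IsDyadicReal c := by
      have h2 := (IsDyadicReal.cellPt_zero (k, n₀))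
      have h3 := (h2.apply_of_mem_lineF hf).sub (h2.zpow_mul s)
      rwa [h _ le_rfl ((cellPt_strictMono _).monotone zero_le_one), add_sub_cancel_left] at h3
    exact exists_isGood_subcell hc fun t ht0 ht1 =>
      h _ ((cellPt_strictMono _).monotone ht0) ((cellPt_strictMono _).monotone ht1)
  choose! N hN using hcell
  set M := (Finset.Ico (0 : ℤ) (2 ^ n₀)).sup N with hM
  refine (Finset.finite_toSet (Finset.Ico (0 : ℤ) (2 ^ (n₀ + M)) ×ˢ
    Finset.range (n₀ + M))).subset ?_
  rintro ⟨k, n⟩ hbad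
  have hk0 : 0 ≤ k := by
    by_contra hk
    have hk' : (k : ℝ) + 1 ≤ 0 := by exact_mod_cast not_le.1 hk
    refine hbad ⟨_, cellMap_self fun x _ hx => h0 x (hx.trans ?_)⟩
    exact div_nonpos_of_nonpos_of_nonneg hk' (by positivity)
  have hk1 : k < 2 ^ n := by
    by_contra hk
    have hk' : (2 : ℝ) ^ n ≤ k := by exact_mod_cast not_lt.1 hk
    refine hbad ⟨_, cellMap_self fun x hx _ => h1 x (le_trans ?_ hx)⟩
    unfold cellPt
    rw [le_div_iff₀ (by positivity)]
    simpa using hk'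
  have hn : n < n₀ + M := by
    by_contra hn
    obtain ⟨m, rfl⟩ := Nat.exists_eq_add_of_le (show n₀ ≤ n by omega)
    obtain ⟨h2, h3, h4⟩ := eq_subcell k n₀ m
    refine hbad ?_
    rw [h2]
    have h5 : 0 ≤ k / 2 ^ m := Int.ediv_nonneg hk0 (by positivity)
    have h6 : k / 2 ^ m < 2 ^ n₀ := Int.ediv_lt_of_lt_mul (by positivity) (by rwa [← pow_add])
    refine hN _ h5 h6 m ?_ _ h3 h4
    have : N (k / 2 ^ m) ≤ M := Finset.le_sup (f := N) (by simp [h5, h6])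
    omega
  simp only [Finset.coe_product, Set.mem_prod, Finset.coe_Ico, Set.mem_Ico, Finset.coe_range,
    Set.mem_Iio]
  exact ⟨⟨hk0, hk1.trans (pow_lt_pow_right₀ (by norm_num) hn)⟩, hn⟩

theorem lineF_le_cellGroup : lineF ≤ cellGroup := fun _ hf =>
  ⟨badCells_finite_of_mem_lineF hf, badCells_finite_of_mem_lineF (inv_mem hf)⟩

/-! ### Linear generation -/

/-- A finite subset of `H` generates every element of `K`, with a word length that is bounded
linearly by the complexity. -/
def LinGen (H K : Set (ℝ ≃o ℝ)) : Prop :=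
  ∃ T : Finset (ℝ ≃o ℝ), (T : Set (ℝ ≃o ℝ)) ⊆ H ∧ ∃ C : ℕ, ∀ f ∈ K,
    IsWord (T : Set (ℝ ≃o ℝ)) (C * (complexity f + 1)) f

theorem LinGen.mono {H K K' : Set (ℝ ≃o ℝ)} (h : LinGen H K) (hK : K' ⊆ K) : LinGen H K' := by
  obtain ⟨T, hT, C, hC⟩ := h
  exact ⟨T, hT, C, fun f hf => hC f (hK hf)⟩

/-! ### Pushing maps -/

/-- An increasing continuous function that is the identity outside `[0, 1]`, as an order
isomorphism of the line. -/
noncomputable def lineIso (f : ℝ → ℝ) (hm : StrictMono f) (hc : Continuous f)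
    (h0 : ∀ x, x ≤ 0 → f x = x) (h1 : ∀ x, 1 ≤ x → f x = x) : ℝ ≃o ℝ :=
  hm.orderIsoOfSurjective f (hc.surjective
    (Filter.tendsto_id.congr' (by
      filter_upwards [Filter.eventually_ge_atTop 1] with x hx
      exact (h1 x hx).symm))
    (Filter.tendsto_id.congr' (by
      filter_upwards [Filter.eventually_le_atBot 0] with x hx
      exact (h0 x hx).symm)))

theorem lineIso_apply (f : ℝ → ℝ) (hm : StrictMono f) (hc : Continuous f)
    (h0 : ∀ x, x ≤ 0 → f x = x) (h1 : ∀ x, 1 ≤ x → f x = x) (x : ℝ) :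
    lineIso f hm hc h0 h1 x = f x := rfl

/-- The map that is the identity outside `[a, b]`, and that has slope `2` on `[a, a + e]`, slope `1`
on `[a + e, b - 2 * e]` and slope `1 / 2` on `[b - 2 * e, b]`. -/
noncomputable def pushMap (a b e x : ℝ) : ℝ :=
  max x (min (2 * x - a) (min (x + e) ((x + b) / 2)))

section pushMap

variable {a b e x : ℝ}

theorem pushMap_of_le (h : x ≤ a) : pushMap a b e x = x :=
  max_eq_left ((min_le_left _ _).trans (by linarith))

theorem pushMap_of_ge (h : b ≤ x) : pushMap a b e x = x :=
  max_eq_left ((min_le_right _ _).trans ((min_le_right _ _).trans (by linarith)))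

theorem pushMap_left (hab : 3 * e ≤ b - a) (h0 : a ≤ x) (h1 : x ≤ a + e) :
    pushMap a b e x = 2 * x - a := by
  unfold pushMap
  rw [min_eq_left (by apply le_min <;> linarith), max_eq_right (by linarith)]

theorem pushMap_mid (he : 0 < e) (h0 : a + e ≤ x) (h1 : x ≤ b - 2 * e) :
    pushMap a b e x = x + e := by
  unfold pushMap
  rw [min_eq_left (by linarith : x + e ≤ (x + b) / 2), min_eq_right (by linarith),
    max_eq_right (by linarith)]

theorem pushMap_right (hab : 3 * e ≤ b - a) (h0 : b - 2 * e ≤ x) (h1 : x ≤ b) :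
    pushMap a b e x = (x + b) / 2 := by
  unfold pushMap
  rw [min_eq_right (by linarith : (x + b) / 2 ≤ x + e), min_eq_right (by linarith),
    max_eq_right (by linarith)]

/-- The map is written by maxima and minima of increasing affine functions so that monotonicity and
continuity need no case distinction. -/
theorem pushMap_strictMono (a b e : ℝ) : StrictMono (pushMap a b e) := by
  refine StrictMono.max_of (f := fun x => x) strictMono_id (StrictMono.min_of
    (f := fun x => 2 * x - a) ?_ (StrictMono.min_of (f := fun x => x + e)
      (g := fun x => (x + b) / 2) ?_ ?_)) <;> intro x y h <;> dsimp <;> linarith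

theorem pushMap_continuous (a b e : ℝ) : Continuous (pushMap a b e) := by
  unfold pushMap
  fun_prop

end pushMap

/-- The condition 3e ≤ b - a leaves room for the end pieces of lengths e and 2e, and the break
points are dyadic with `a`, `b` and `e`. -/
theorem exists_push {a b e : ℝ} (ha : 0 ≤ a) (hb : b ≤ 1) (he : 0 < e) (hab : 3 * e ≤ b - a)
    (hda : IsDyadicReal a) (hdb : IsDyadicReal b) (hde : IsDyadicReal e) :
    ∃ f ∈ lineF, ∀ x, f x = pushMap a b e x := by
  classical
  refine ⟨lineIso (pushMap a b e) (pushMap_strictMono a b e) (pushMap_continuous a b e)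
    (fun x hx => pushMap_of_le (hx.trans ha)) (fun x hx => pushMap_of_ge (hb.trans hx)), ?_,
    fun x => rfl⟩
  rw [mem_lineF_iff]
  refine ⟨fun x hx => pushMap_of_le (hx.trans ha), fun x hx => pushMap_of_ge (hb.trans hx),
    {a, a + e, b - (e + e), b}, ?_, ?_⟩
  · intro d hd
    simp only [Finset.mem_insert, Finset.mem_singleton] at hd
    rcases hd with rfl | rfl | rfl | rfl
    · exact hda
    · exact hda.add hde
    · exact hdb.sub (hde.add hde)
    · exact hdb
  · intro p q _ hpq _ h
    simp only [Finset.mem_insert, Finset.mem_singleton, forall_eq_or_imp, forall_eq] at h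
    obtain ⟨h1, h2, h3, h4⟩ := h
    simp only [lineIso_apply]
    rcases h1.symm with h1 | h1
    · exact ⟨0, 0, fun x _ hx => by rw [pushMap_of_le (hx.trans h1)]; simp⟩
    rcases h4 with h4 | h4
    · exact ⟨0, 0, fun x hx _ => by rw [pushMap_of_ge (h4.trans hx)]; simp⟩
    rcases h2.symm with h2 | h2
    · refine ⟨1, -a, fun x hx hx' => ?_⟩
      rw [pushMap_left hab (by linarith) (by linarith), zpow_one]
      ring
    rcases h3.symm with h3 | h3
    · refine ⟨0, e, fun x hx hx' => ?_⟩
      rw [pushMap_mid he (by linarith) (by linarith), zpow_zero, one_mul]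
    · refine ⟨-1, b / 2, fun x hx hx' => ?_⟩
      rw [pushMap_right hab (by linarith) (by linarith), zpow_neg_one]
      ring

/-! ### A division of an interval into a bi-infinite sequence of cells -/

/-- The cells of a division of the open interval `(κ / 2 ^ ν, (κ + m + 2) / 2 ^ ν)` that is uniform
in the middle and that has ratio `1 / 2` towards both end points. -/
def vineCell (κ : ℤ) (ν m : ℕ) (k : ℤ) : ℤ × ℕ :=
  if k ≤ 0 then (κ * 2 ^ (-k).toNat + 1, ν + (-k).toNat)
  else if k ≤ m - 1 then (κ + 1 + k, ν)
  else ((κ + m + 2) * 2 ^ (k - (m - 1)).toNat - 2, ν + (k - (m - 1)).toNat)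

section vine

variable (κ : ℤ) (ν m : ℕ)

theorem vineCell_left (s : ℕ) : vineCell κ ν m (-s) = (κ * 2 ^ s + 1, ν + s) := by
  simp [vineCell]

theorem vineCell_mid {k : ℤ} (h0 : 0 ≤ k) (h1 : k ≤ m - 1) :
    vineCell κ ν m k = (κ + 1 + k, ν) := by
  unfold vineCell
  rcases h0.eq_or_lt with rfl | h0
  · simp
  · rw [if_neg (by omega), if_pos h1]

theorem vineCell_right (hm : 2 ≤ m) (s : ℕ) :
    vineCell κ ν m (m - 1 + s) = ((κ + m + 2) * 2 ^ s - 2, ν + s) := by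
  rcases Nat.eq_zero_or_pos s with rfl | hs
  · rw [vineCell_mid κ ν m (by omega) (by simp)]
    simp
  · unfold vineCell
    rw [if_neg (by omega), if_neg (by omega), add_sub_cancel_left, Int.toNat_natCast]

theorem cellPt_vineCell_left (s : ℕ) (t : ℝ) :
    cellPt (vineCell κ ν m (-s)) t = κ / 2 ^ ν + (1 + t) / 2 ^ ν / 2 ^ s := by
  rw [vineCell_left]
  unfold cellPt
  push_cast
  rw [pow_add]
  field_simp
  ring

theorem cellPt_vineCell_mid {k : ℤ} (h0 : 0 ≤ k) (h1 : k ≤ m - 1) (t : ℝ) :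
    cellPt (vineCell κ ν m k) t = κ / 2 ^ ν + (1 + (k + t)) / 2 ^ ν := by
  rw [vineCell_mid κ ν m h0 h1]
  unfold cellPt
  push_cast
  ring

theorem cellPt_vineCell_right (hm : 2 ≤ m) (s : ℕ) (t : ℝ) :
    cellPt (vineCell κ ν m (m - 1 + s)) t =
      (κ + m + 2) / 2 ^ ν - (2 - t) / 2 ^ ν / 2 ^ s := by
  rw [vineCell_right κ ν m hm]
  unfold cellPt
  push_cast
  rw [pow_add]
  field_simp
  ring

theorem vine_cases (k : ℤ) : (∃ s : ℕ, k = -(s + 1 : ℕ)) ∨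
    (0 ≤ k ∧ k + 1 ≤ m - 1) ∨ ∃ s : ℕ, k = m - 1 + s := by
  rcases lt_or_ge k 0 with h | h
  · exact Or.inl ⟨(-k - 1).toNat, by omega⟩
  · rcases lt_or_ge k (m - 1) with h' | h'
    · exact Or.inr (Or.inl ⟨h, by omega⟩)
    · exact Or.inr (Or.inr ⟨(k - (m - 1)).toNat, by omega⟩)

theorem cellPt_vineCell_succ (hm : 2 ≤ m) (k : ℤ) :
    cellPt (vineCell κ ν m (k + 1)) 0 = cellPt (vineCell κ ν m k) 1 := by
  rcases vine_cases m k with ⟨s, rfl⟩ | ⟨h0, h1⟩ | ⟨s, rfl⟩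
  · rw [show (-((s + 1 : ℕ) : ℤ) + 1) = -(s : ℤ) by push_cast; ring, cellPt_vineCell_left,
      cellPt_vineCell_left, pow_succ]
    field_simp
    ring
  · rw [cellPt_vineCell_mid κ ν m (by omega) h1, cellPt_vineCell_mid κ ν m h0 (by omega)]
    push_cast
    ring
  · rw [show ((m : ℤ) - 1 + s + 1) = m - 1 + (s + 1 : ℕ) by push_cast; ring,
      cellPt_vineCell_right κ ν m hm, cellPt_vineCell_right κ ν m hm, pow_succ]
    field_simp
    ring

/-- The map of the line onto the interval `(κ / 2 ^ ν, (κ + m + 2) / 2 ^ ν)` that maps the unit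
intervals affinely onto the cells of the division. -/
noncomputable def vineMap (x : ℝ) : ℝ := cellPt (vineCell κ ν m ⌊x⌋) (Int.fract x)

/-- The value `t = 1` is covered because consecutive cells share an end point. -/
theorem vineMap_add (hm : 2 ≤ m) (k : ℤ) {t : ℝ} (h0 : 0 ≤ t) (h1 : t ≤ 1) :
    vineMap κ ν m (k + t) = cellPt (vineCell κ ν m k) t := by
  rcases h1.eq_or_lt with rfl | h1
  · have : ((k : ℝ) + 1) = ((k + 1 : ℤ) : ℝ) := by push_cast; ring
    rw [← cellPt_vineCell_succ κ ν m hm]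
    unfold vineMap
    rw [this, Int.floor_intCast, Int.fract_intCast]
  · have h2 : ⌊(k : ℝ) + t⌋ = k := by
      rw [Int.floor_eq_iff]
      constructor <;> linarith
    unfold vineMap
    rw [Int.fract, h2, add_sub_cancel_left]

theorem vineMap_left (hm : 2 ≤ m) (s : ℕ) {t : ℝ} (h0 : 0 ≤ t) (h1 : t ≤ 1) :
    vineMap κ ν m (-s + t) = κ / 2 ^ ν + (1 + t) / 2 ^ ν / 2 ^ s := by
  have := vineMap_add κ ν m hm (-s) h0 h1
  push_cast at this
  rw [this, cellPt_vineCell_left]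

theorem vineMap_mid (hm : 2 ≤ m) {x : ℝ} (h0 : 0 ≤ x) (h1 : x ≤ m) :
    vineMap κ ν m x = κ / 2 ^ ν + (1 + x) / 2 ^ ν := by
  rcases h1.eq_or_lt with rfl | h1
  · have h2 := vineMap_add κ ν m hm (m - 1) zero_le_one le_rfl
    push_cast at h2
    rw [sub_add_cancel] at h2
    rw [h2, cellPt_vineCell_mid κ ν m (by omega) le_rfl]
    push_cast
    ring
  · have h2 : 0 ≤ ⌊x⌋ := Int.floor_nonneg.2 h0
    have h3 : ⌊x⌋ < m := Int.floor_lt.2 (by simpa using h1)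
    unfold vineMap
    rw [cellPt_vineCell_mid κ ν m h2 (by omega), Int.floor_add_fract]

theorem vineMap_right (hm : 2 ≤ m) (s : ℕ) {t : ℝ} (h0 : 0 ≤ t) (h1 : t ≤ 1) :
    vineMap κ ν m (m - 1 + s + t) = (κ + m + 2) / 2 ^ ν - (2 - t) / 2 ^ ν / 2 ^ s := by
  have := vineMap_add κ ν m hm (m - 1 + s) h0 h1
  push_cast at this
  rw [this, cellPt_vineCell_right κ ν m hm]

theorem cellPt_vineCell_strictMono (hm : 2 ≤ m) :
    StrictMono fun k => cellPt (vineCell κ ν m k) 0 :=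
  strictMono_int_of_lt_succ fun k => by
    rw [cellPt_vineCell_succ κ ν m hm]
    exact cellPt_strictMono _ one_pos

theorem vineMap_strictMono (hm : 2 ≤ m) : StrictMono (vineMap κ ν m) := by
  intro x y hxy
  rcases (Int.floor_mono hxy.le).eq_or_lt with h | h
  · unfold vineMap
    rw [h]
    refine cellPt_strictMono _ ?_
    unfold Int.fract
    rw [h]
    linarith
  · calc vineMap κ ν m x < cellPt (vineCell κ ν m ⌊x⌋) 1 := cellPt_strictMono _ (Int.fract_lt_one x)
      _ = cellPt (vineCell κ ν m (⌊x⌋ + 1)) 0 := (cellPt_vineCell_succ κ ν m hm _).symm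
      _ ≤ cellPt (vineCell κ ν m ⌊y⌋) 0 := (cellPt_vineCell_strictMono κ ν m hm).monotone h
      _ ≤ vineMap κ ν m y := (cellPt_strictMono _).monotone (Int.fract_nonneg y)

theorem lt_vineMap (hm : 2 ≤ m) (x : ℝ) : (κ : ℝ) / 2 ^ ν < vineMap κ ν m x := by
  obtain ⟨s, hs⟩ := exists_nat_gt (-x)
  refine lt_trans ?_ (vineMap_strictMono κ ν m hm (show -(s : ℝ) + 0 < x by linarith))
  rw [vineMap_left κ ν m hm s le_rfl zero_le_one]
  have : (0 : ℝ) < (1 + 0) / 2 ^ ν / 2 ^ s := by positivity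
  linarith

theorem vineMap_lt (hm : 2 ≤ m) (x : ℝ) : vineMap κ ν m x < (κ + m + 2) / 2 ^ ν := by
  obtain ⟨s, hs⟩ := exists_nat_gt x
  have hm' : (2 : ℝ) ≤ m := by exact_mod_cast hm
  refine (vineMap_strictMono κ ν m hm (show x < m - 1 + s + 0 by linarith)).trans ?_
  rw [vineMap_right κ ν m hm s le_rfl zero_le_one]
  have : (0 : ℝ) < (2 - 0) / 2 ^ ν / 2 ^ s := by positivity
  linarith

/-- The cells accumulate only at the two ends of the interval, so there is a last one that starts at
or before `y`, and it contains `y`. -/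
theorem exists_vineMap_eq (hm : 2 ≤ m) {y : ℝ} (h0 : (κ : ℝ) / 2 ^ ν < y)
    (h1 : y < (κ + m + 2) / 2 ^ ν) : ∃ x, vineMap κ ν m x = y := by
  have hcell : ∀ k : ℤ, vineMap κ ν m k = cellPt (vineCell κ ν m k) 0 := fun k => by
    simpa using vineMap_add κ ν m hm k le_rfl zero_le_one
  obtain ⟨k, hk, hk'⟩ := Int.exists_greatest_of_bdd (P := fun k : ℤ => vineMap κ ν m k ≤ y) (by
    obtain ⟨s, hs⟩ := pow_unbounded_of_one_lt (2 / 2 ^ ν / ((κ + m + 2) / 2 ^ ν - y))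
      (one_lt_two : (1 : ℝ) < 2)
    refine ⟨m - 1 + s, fun z hz => ?_⟩
    by_contra hlt
    have h2 : vineMap κ ν m ((m - 1 + s : ℤ) : ℝ) < y :=
      (vineMap_strictMono κ ν m hm (by exact_mod_cast not_le.1 hlt)).trans_le hz
    rw [hcell, cellPt_vineCell_right κ ν m hm] at h2
    rw [div_lt_iff₀ (by linarith)] at hs
    have h3 : (2 - 0 : ℝ) / 2 ^ ν / 2 ^ s < (κ + m + 2) / 2 ^ ν - y := by
      rw [div_lt_iff₀ (by positivity), sub_zero]
      linarith
    linarith) (by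
    obtain ⟨s, hs⟩ := pow_unbounded_of_one_lt (1 / 2 ^ ν / (y - κ / 2 ^ ν))
      (one_lt_two : (1 : ℝ) < 2)
    refine ⟨-s, ?_⟩
    rw [hcell, cellPt_vineCell_left]
    rw [div_lt_iff₀ (by linarith)] at hs
    have h3 : (1 + 0 : ℝ) / 2 ^ ν / 2 ^ s < y - κ / 2 ^ ν := by
      rw [div_lt_iff₀ (by positivity), add_zero]
      linarith
    linarith)
  rw [hcell] at hk
  have h2 : y < cellPt (vineCell κ ν m k) 1 := by
    rw [← cellPt_vineCell_succ κ ν m hm, ← hcell]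
    by_contra h
    have := hk' (k + 1) (not_lt.1 h)
    omega
  have h3 := cellPt_one_sub_zero (vineCell κ ν m k)
  set I := vineCell κ ν m k with hI
  have h4 : (0 : ℝ) < 2 ^ I.2 := by positivity
  refine ⟨k + 2 ^ I.2 * (y - cellPt I 0), ?_⟩
  rw [vineMap_add κ ν m hm k (mul_nonneg h4.le (by linarith)), ← hI]
  · unfold cellPt
    field_simp
    ring
  · have h5 : y - cellPt I 0 ≤ 1 / 2 ^ I.2 := by linarith
    calc 2 ^ I.2 * (y - cellPt I 0) ≤ 2 ^ I.2 * (1 / 2 ^ I.2) := by gcongr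
      _ = 1 := by field_simp

theorem exists_cellMap_vineMap (hm : 2 ≤ m) (I : ℤ × ℕ) : ∃ J, CellMap (vineMap κ ν m) I J := by
  obtain ⟨k, n⟩ := I
  obtain ⟨h1, h2, h3⟩ := eq_subcell k 0 n
  rw [zero_add] at h1
  rw [h1]
  refine ⟨_, CellMap.subcell (J := vineCell κ ν m (k / 2 ^ n)) ?_ h2 h3⟩
  intro t ht ht'
  simpa [cellPt] using vineMap_add κ ν m hm (k / 2 ^ n) ht ht'

/-- Small cells inside the interval are images of cells of the line. -/
theorem exists_cellMap_vineMap_of_lt (hm : 2 ≤ m) {J : ℤ × ℕ} (hJ : ν ≤ J.2)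
    (h0 : (κ : ℝ) / 2 ^ ν < cellPt J 0) (h1 : cellPt J 1 < (κ + m + 2) / 2 ^ ν) :
    ∃ I, CellMap (vineMap κ ν m) I J := by
  obtain ⟨k, n⟩ := J
  obtain ⟨p, rfl⟩ := Nat.exists_eq_add_of_le hJ
  have hsub : ∀ (q : ℤ) (s : ℕ) (j : ℤ), 0 ≤ j → j < 2 ^ s →
      subcell (vineCell κ ν m q) s j = (k, ν + p) →
      ∃ I, CellMap (vineMap κ ν m) I (k, ν + p) := by
    intro q s j hj hj' h
    rw [← h]
    refine ⟨_, CellMap.subcell (I := (q, 0)) ?_ hj hj'⟩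
    intro t ht ht'
    simpa [cellPt] using vineMap_add κ ν m hm q ht ht'
  have hk0 : κ * 2 ^ p < k := by
    unfold cellPt at h0
    rw [div_lt_div_iff₀ (by positivity) (by positivity), add_zero, pow_add] at h0
    have h2 : (κ : ℝ) * 2 ^ p < k := by
      have : (0 : ℝ) < 2 ^ ν := by positivity
      refine lt_of_mul_lt_mul_right ?_ this.le
      calc (κ : ℝ) * 2 ^ p * 2 ^ ν = κ * (2 ^ ν * 2 ^ p) := by ring
        _ < _ := h0
    exact_mod_cast h2
  have hk1 : k + 1 < (κ + m + 2) * 2 ^ p := by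
    unfold cellPt at h1
    rw [div_lt_div_iff₀ (by positivity) (by positivity), pow_add] at h1
    have h2 : (k : ℝ) + 1 < (κ + m + 2) * 2 ^ p := by
      have : (0 : ℝ) < 2 ^ ν := by positivity
      refine lt_of_mul_lt_mul_right ?_ this.le
      calc ((k : ℝ) + 1) * 2 ^ ν < _ := h1
        _ = _ := by ring
    exact_mod_cast h2
  -- In the left tail, `j` counts the cells of the same level between the end point and the given
  -- cell. The exponent `a` with 2^a ≤ j < 2^(a+1) shows in which cell of the division it lies; j ≠
  -- 0 because it does not touch the end point.
  by_cases hl : k < (κ + 1) * 2 ^ p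
  · obtain ⟨j, hj⟩ : ∃ j : ℕ, (j : ℤ) = k - κ * 2 ^ p :=
      ⟨(k - κ * 2 ^ p).toNat, Int.toNat_of_nonneg (by omega)⟩
    have hj0 : j ≠ 0 := by omega
    have hjp : j < 2 ^ p := by
      have : (j : ℤ) < 2 ^ p := by rw [hj]; linarith
      exact_mod_cast this
    have h2 := Nat.pow_log_le_self 2 hj0
    have h3 := Nat.lt_pow_succ_log_self (b := 2) (by norm_num) j
    set a := Nat.log 2 j with ha
    have hap : a < p := (Nat.pow_lt_pow_iff_right (by norm_num)).1 (h2.trans_lt hjp)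
    obtain ⟨s, rfl⟩ := Nat.exists_eq_add_of_lt hap
    have h2' : (2 : ℤ) ^ a ≤ j := by exact_mod_cast h2
    have h3' : (j : ℤ) < 2 ^ a * 2 := by exact_mod_cast h3
    refine hsub (-(s + 1 : ℕ)) a (j - 2 ^ a) (by omega) (by omega) ?_
    rw [vineCell_left]
    unfold subcell
    refine Prod.ext ?_ (by dsimp; omega)
    dsimp only
    rw [show k = j + κ * 2 ^ (a + s + 1) by omega]
    ring
  -- The right tail is the mirror image, with `j` counting the cells between the given cell and the
  -- right end.
  by_cases hr : (κ + m + 1) * 2 ^ p ≤ k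
  · obtain ⟨j, hj⟩ : ∃ j : ℕ, (j : ℤ) = (κ + m + 2) * 2 ^ p - 1 - k :=
      ⟨((κ + m + 2) * 2 ^ p - 1 - k).toNat, Int.toNat_of_nonneg (by omega)⟩
    have hj0 : j ≠ 0 := by omega
    have hjp : j < 2 ^ p := by
      have : (j : ℤ) < 2 ^ p := by rw [hj]; linarith
      exact_mod_cast this
    have h2 := Nat.pow_log_le_self 2 hj0
    have h3 := Nat.lt_pow_succ_log_self (b := 2) (by norm_num) j
    set a := Nat.log 2 j with ha
    have hap : a < p := (Nat.pow_lt_pow_iff_right (by norm_num)).1 (h2.trans_lt hjp)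
    obtain ⟨s, rfl⟩ := Nat.exists_eq_add_of_lt hap
    have h2' : (2 : ℤ) ^ a ≤ j := by exact_mod_cast h2
    have h3' : (j : ℤ) < 2 ^ a * 2 := by exact_mod_cast h3
    refine hsub (m - 1 + (s + 1 : ℕ)) a (2 ^ a * 2 - 1 - j) (by omega) (by omega) ?_
    rw [vineCell_right κ ν m hm]
    unfold subcell
    refine Prod.ext ?_ (by dsimp; omega)
    dsimp only
    rw [show k = (κ + m + 2) * 2 ^ (a + s + 1) - 1 - j by omega]
    ring
  · obtain ⟨h2, h3, h4⟩ := eq_subcell k ν p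
    have h5 : κ + 1 ≤ k / 2 ^ p := (Int.le_ediv_iff_mul_le (by positivity)).2 (not_lt.1 hl)
    have h6 : k / 2 ^ p < κ + m + 1 := Int.ediv_lt_of_lt_mul (by positivity) (not_le.1 hr)
    refine hsub (k / 2 ^ p - κ - 1) p _ h3 h4 ?_
    rw [vineCell_mid κ ν m (by omega) (by omega), h2]
    congr 2
    ring

/-- Pushing along the division corresponds to the translation. -/
theorem pushMap_vineMap (hm : 2 ≤ m) (x : ℝ) :
    pushMap (κ / 2 ^ ν) ((κ + m + 2) / 2 ^ ν) (1 / 2 ^ ν) (vineMap κ ν m x) =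
      vineMap κ ν m (x + 1) := by
  have hm' : (2 : ℝ) ≤ m := by exact_mod_cast hm
  have he : (0 : ℝ) < 1 / 2 ^ ν := by positivity
  have hd : ((κ : ℝ) + m + 2) / 2 ^ ν = κ / 2 ^ ν + (m + 2) * (1 / 2 ^ ν) := by ring
  have hab : 3 * (1 / 2 ^ ν : ℝ) ≤ (κ + m + 2) / 2 ^ ν - κ / 2 ^ ν := by
    rw [hd]; nlinarith
  have ht := Int.fract_nonneg x
  have ht' := (Int.fract_lt_one x).le
  -- In the left tail slope 2 carries each cell onto the next one, in the middle the push is a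
  -- translation by one cell, and in the right tail slope 1/2 carries each cell onto the next.
  rcases vine_cases m ⌊x⌋ with ⟨s, hs⟩ | ⟨h0, h1⟩ | ⟨s, hs⟩
  · have hx : x = -((s + 1 : ℕ) : ℝ) + Int.fract x := by
      rw [← Int.cast_natCast, ← Int.cast_neg, ← hs, Int.floor_add_fract]
    have e1 := vineMap_left κ ν m hm (s + 1) ht ht'
    have e2 := vineMap_left κ ν m hm s ht ht'
    rw [← hx] at e1
    rw [show x + 1 = -(s : ℝ) + Int.fract x by push_cast at hx; linarith, e1, e2,
      pushMap_left hab]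
    · rw [pow_succ]
      field_simp
      ring
    · have : (0 : ℝ) ≤ (1 + Int.fract x) / 2 ^ ν / 2 ^ (s + 1) := by positivity
      linarith
    · have h3 : (1 + Int.fract x) / 2 ^ ν / 2 ^ (s + 1) ≤ 1 / 2 ^ ν := by
        rw [div_right_comm]
        gcongr
        rw [div_le_one (by positivity), pow_succ]
        have : (1 : ℝ) ≤ 2 ^ s := one_le_pow₀ (by norm_num)
        linarith
      linarith
  · have h0' : (0 : ℝ) ≤ x := by
      have : (0 : ℝ) ≤ ⌊x⌋ := by exact_mod_cast h0
      linarith [Int.floor_le x]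
    have h1' : x + 1 ≤ m := by
      have : ((⌊x⌋ : ℝ) + 1) ≤ m - 1 := by exact_mod_cast h1
      linarith [Int.lt_floor_add_one x]
    rw [vineMap_mid κ ν m hm h0' (by linarith), vineMap_mid κ ν m hm (by linarith) h1',
      pushMap_mid he]
    · ring
    · have : (1 + x) / 2 ^ ν = (1 + x) * (1 / 2 ^ ν) := by ring
      rw [this]; nlinarith
    · have : (1 + x) / 2 ^ ν = (1 + x) * (1 / 2 ^ ν) := by ring
      rw [this, hd]; nlinarith
  · have hx : x = m - 1 + s + Int.fract x := by
      have := Int.floor_add_fract x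
      rw [hs] at this
      push_cast at this
      exact this.symm
    have e1 := vineMap_right κ ν m hm s ht ht'
    have e2 := vineMap_right κ ν m hm (s + 1) ht ht'
    rw [← hx] at e1
    rw [show x + 1 = m - 1 + (s + 1 : ℕ) + Int.fract x by
      conv_lhs => rw [hx]
      push_cast; ring, e1, e2, pushMap_right hab]
    · rw [pow_succ]
      field_simp
      ring
    · have h3 : (2 - Int.fract x) / 2 ^ ν / 2 ^ s ≤ 2 * (1 / 2 ^ ν) := by
        rw [div_right_comm, ← mul_div_assoc, mul_one]
        gcongr
        rw [div_le_iff₀ (by positivity)]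
        have : (1 : ℝ) ≤ 2 ^ s := one_le_pow₀ (by norm_num)
        linarith
      linarith
    · have : (0 : ℝ) ≤ (2 - Int.fract x) / 2 ^ ν / 2 ^ s :=
        div_nonneg (div_nonneg (by linarith) (by positivity)) (by positivity)
      linarith

/-- Pushing along the division from its first full cell on corresponds to `lineSplit`. -/
theorem pushMap_vineMap_split (hm : 2 ≤ m) (x : ℝ) :
    pushMap (κ / 2 ^ ν + 1 / 2 ^ ν) ((κ + m + 2) / 2 ^ ν) (1 / 2 ^ ν) (vineMap κ ν m x) =
      vineMap κ ν m (lineSplit x) := by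
  have hm' : (2 : ℝ) ≤ m := by exact_mod_cast hm
  have he : (0 : ℝ) < 1 / 2 ^ ν := by positivity
  have hd : ((κ : ℝ) + m + 2) / 2 ^ ν = κ / 2 ^ ν + (m + 2) * (1 / 2 ^ ν) := by ring
  have hmono := (vineMap_strictMono κ ν m hm).monotone
  have e0 := vineMap_mid κ ν m hm (x := 0) le_rfl (by linarith)
  have e1 := vineMap_mid κ ν m hm (x := 1) (by linarith) (by linarith)
  rcases le_total x 0 with h | h
  · rw [lineSplit_of_nonpos h, pushMap_of_le]
    have := hmono h
    rw [e0, add_zero] at this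
    exact this
  rcases le_total x 1 with h' | h'
  · rw [lineSplit_of_mem h h', vineMap_mid κ ν m hm h (by linarith),
      vineMap_mid κ ν m hm (by linarith) (by linarith), pushMap_left]
    · ring
    -- The shortened interval has m + 1 grid steps, and a push needs three; this is where m ≥ 2 is
    -- needed.
    · rw [hd]; nlinarith
    · have : (1 + x) / 2 ^ ν = (1 + x) * (1 / 2 ^ ν) := by ring
      rw [this]; nlinarith
    · have : (1 + x) / 2 ^ ν = (1 + x) * (1 / 2 ^ ν) := by ring
      rw [this]; nlinarith
  -- From the end of cell 0 on, the branch of slope 2 is irrelevant to the minimum for both starting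
  -- points, so the two pushes agree.
  · rw [lineSplit_of_one_le h', ← pushMap_vineMap κ ν m hm]
    have h2 := hmono h'
    rw [e1] at h2
    have h3 : (1 + 1 : ℝ) / 2 ^ ν = 1 / 2 ^ ν + 1 / 2 ^ ν := by ring
    rw [h3] at h2
    unfold pushMap
    rw [min_eq_right (a := 2 * vineMap κ ν m x - _), min_eq_right (a := 2 * vineMap κ ν m x - _)]
    · exact (min_le_left _ _).trans (by linarith)
    · exact (min_le_left _ _).trans (by linarith)

end vine

/-! ### Elements supported in a dyadic interval -/

/-- A relation between two groups that is compatible with the group operations transfers words. -/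
theorem IsWord.transfer {G G' : Type*} [Group G] [Group G'] {S : Set G} {T : Set G'}
    (R : G → G' → Prop) (h1 : R 1 1) (hmul : ∀ a b a' b', R a a' → R b b' → R (a * b) (a' * b'))
    (hinv : ∀ a a', R a a' → R a⁻¹ a'⁻¹) (hS : ∀ s ∈ S, ∃ t ∈ T, R s t) {n : ℕ} {g : G}
    (hg : IsWord S n g) : ∃ g', IsWord T n g' ∧ R g g' := by
  obtain ⟨l, hl, rfl, hn⟩ := hg
  suffices h : ∃ g', IsWord T l.length g' ∧ R l.prod g' by
    obtain ⟨g', h2, h3⟩ := h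
    exact ⟨g', h2.mono subset_rfl hn, h3⟩
  clear hn
  induction l with
  | nil => exact ⟨1, IsWord.one _ _, h1⟩
  | cons x l ih =>
    obtain ⟨g', h2, h3⟩ := ih fun y hy => hl y (List.mem_cons_of_mem _ hy)
    obtain ⟨x', hx', hR⟩ : ∃ x', IsWord T 1 x' ∧ R x x' := by
      rcases hl x List.mem_cons_self with hx | hx
      · obtain ⟨t, ht, hR⟩ := hS x hx
        exact ⟨t, IsWord.of_mem ht, hR⟩
      · obtain ⟨t, ht, hR⟩ := hS _ hx
        exact ⟨t⁻¹, (IsWord.of_mem ht).inv, by simpa using hinv _ _ hR⟩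
    refine ⟨x' * g', ?_, hmul _ _ _ _ hR h3⟩
    rw [List.length_cons, add_comm]
    exact hx'.mul h2

/-- The elements of `lineF` that are supported in `[c, d]`. -/
def intervalF (c d : ℝ) : Subgroup (ℝ ≃o ℝ) where
  carrier := {f | f ∈ lineF ∧ ∀ x, x ≤ c ∨ d ≤ x → f x = x}
  one_mem' := ⟨one_mem _, fun _ _ => rfl⟩
  mul_mem' := fun {f g} hf hg => ⟨mul_mem hf.1 hg.1, fun x hx => by
    change f (g x) = x
    rw [hg.2 x hx, hf.2 x hx]⟩
  inv_mem' := fun {f} hf => ⟨inv_mem hf.1, fun x hx => by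
    change f.symm x = x
    rw [OrderIso.symm_apply_eq, hf.2 x hx]⟩

/-- The conjugate of a homeomorphism of an open interval by a parametrization of the interval. -/
theorem exists_conj {θ : ℝ → ℝ} {c d : ℝ} (hθ : StrictMono θ) (h0 : ∀ x, c < θ x)
    (h1 : ∀ x, θ x < d) (hsurj : ∀ y, c < y → y < d → ∃ x, θ x = y) {f : ℝ ≃o ℝ} (hc : f c = c)
    (hd : f d = d) : ∃ g : ℝ ≃o ℝ, ∀ x, θ (g x) = f (θ x) := by
  have hc' : f.symm c = c := by rw [OrderIso.symm_apply_eq, hc]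
  have hd' : f.symm d = d := by rw [OrderIso.symm_apply_eq, hd]
  have key : ∀ e : ℝ ≃o ℝ, e c = c → e d = d → ∀ x, ∃ y, θ y = e (θ x) := by
    intro e hec hed x
    refine hsurj _ ?_ ?_
    · rw [← hec]; exact e.strictMono (h0 x)
    · rw [← hed]; exact e.strictMono (h1 x)
  choose F hF using key f hc hd
  choose G hG using key f.symm hc' hd'
  refine ⟨⟨⟨F, G, fun x => hθ.injective ?_, fun x => hθ.injective ?_⟩, ?_⟩, hF⟩
  · rw [hG, hF, f.symm_apply_apply]
  · rw [hF, hG, f.apply_symm_apply]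
  · intro x y
    change F x ≤ F y ↔ x ≤ y
    rw [← hθ.le_iff_le, hF, hF, f.le_iff_le, hθ.le_iff_le]

/-! ### Bad cells and germs under the parametrization -/

/-- The cells in `[0, 1]` of level less than `ν`. -/
def coarseCells (ν : ℕ) : Set (ℤ × ℕ) := {J | 0 ≤ J.1 ∧ J.1 < 2 ^ J.2 ∧ J.2 < ν}

theorem coarseCells_finite (ν : ℕ) : (coarseCells ν).Finite := by
  refine (Finset.finite_toSet (Finset.Ico (0 : ℤ) (2 ^ ν) ×ˢ Finset.range ν)).subset ?_
  rintro ⟨k, n⟩ ⟨h0, h1, h2⟩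
  simp only [Finset.coe_product, Set.mem_prod, Finset.coe_Ico, Set.mem_Ico, Finset.coe_range,
    Set.mem_Iio]
  exact ⟨⟨h0, h1.trans_le (pow_le_pow_right₀ (by norm_num) h2.le)⟩, h2⟩

theorem cellMap_injective {θ : ℝ → ℝ} (hθ : StrictMono θ) {I I' J : ℤ × ℕ}
    (h : CellMap θ I J) (h' : CellMap θ I' J) : I = I' :=
  cell_ext (hθ.injective ((h 0 le_rfl zero_le_one).trans (h' 0 le_rfl zero_le_one).symm))
    (hθ.injective ((h 1 zero_le_one le_rfl).trans (h' 1 zero_le_one le_rfl).symm))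

/-- A bad cell of `g` corresponds to a cell J in the interval. If J is good for `f`, its image lies
strictly inside the interval and cannot come from a cell of the line, so its level is below `ν`.
There is a fixed finite number of such images, and each determines J. -/
theorem badCells_conj {κ : ℤ} {ν m : ℕ} (hm : 2 ≤ m) (h0 : (0 : ℝ) ≤ κ / 2 ^ ν)
    (h1 : ((κ : ℝ) + m + 2) / 2 ^ ν ≤ 1) {f g : ℝ ≃o ℝ} (hf : (badCells f).Finite)
    (hc : f (κ / 2 ^ ν) = κ / 2 ^ ν)
    (hd : f ((κ + m + 2) / 2 ^ ν) = (κ + m + 2) / 2 ^ ν)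
    (hg : ∀ x, vineMap κ ν m (g x) = f (vineMap κ ν m x)) :
    (badCells g).Finite ∧ badCount g ≤ badCount f + (coarseCells ν).ncard := by
  have hθ := vineMap_strictMono κ ν m hm
  have hcoarse := finite_ncard_le_of_image
    (A := {J | ∃ J', CellMap f J J' ∧ J' ∈ coarseCells ν}) (fun J J' => CellMap f J J')
    (coarseCells_finite ν) (fun J hJ => hJ.imp fun J' h => And.symm h)
    (fun J J' K h h' => h.injective h')
  have key := finite_ncard_le_of_image (A := badCells g) (B := badCells f ∪
    {J | ∃ J', CellMap f J J' ∧ J' ∈ coarseCells ν}) (fun I J => CellMap (vineMap κ ν m) I J) ?_ ?_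
    (fun I I' J h h' => cellMap_injective hθ h h')
  · have h2 : ({J | ∃ J', CellMap f J J' ∧ J' ∈ coarseCells ν} : Set (ℤ × ℕ)).ncard ≤
        (coarseCells ν).ncard :=
      hcoarse.2
    have h3 := Set.ncard_union_le (badCells f) {J | ∃ J', CellMap f J J' ∧ J' ∈ coarseCells ν}
    exact ⟨key.1, by unfold badCount; omega⟩
  · exact hf.union hcoarse.1
  · intro I hI
    obtain ⟨J, hJ⟩ := exists_cellMap_vineMap κ ν m hm I
    refine ⟨J, ?_, hJ⟩
    by_cases hgood : IsGood f J
    · right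
      obtain ⟨J', hJ'⟩ := hgood
      refine ⟨J', hJ', ?_⟩
      have hl : (κ : ℝ) / 2 ^ ν < cellPt J' 0 := by
        rw [← hJ' 0 le_rfl zero_le_one, ← hJ 0 le_rfl zero_le_one]
        conv_lhs => rw [← hc]
        exact f.strictMono (lt_vineMap κ ν m hm _)
      have hr : cellPt J' 1 < (κ + m + 2) / 2 ^ ν := by
        rw [← hJ' 1 zero_le_one le_rfl, ← hJ 1 zero_le_one le_rfl]
        conv_rhs => rw [← hd]
        exact f.strictMono (vineMap_lt κ ν m hm _)
      have hlt : J'.2 < ν := by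
        by_contra hν
        obtain ⟨I', hI'⟩ := exists_cellMap_vineMap_of_lt κ ν m hm (not_lt.1 hν) hl hr
        refine hI ⟨I', fun t ht ht' => hθ.injective ?_⟩
        rw [hg, hJ t ht ht', hJ' t ht ht', hI' t ht ht']
      have hpos : (0 : ℝ) < 2 ^ J'.2 := by positivity
      have h2 := h0.trans_lt hl
      have h3 := hr.trans_le h1
      unfold cellPt at h2 h3
      rw [add_zero, lt_div_iff₀ hpos, zero_mul] at h2
      rw [div_lt_iff₀ hpos, one_mul] at h3
      refine ⟨by exact_mod_cast h2.le, ?_, hlt⟩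
      have h4 : J'.1 + 1 < 2 ^ J'.2 := by exact_mod_cast h3
      omega
    · exact Or.inl hgood

/-- One-sided germs at a dyadic fixed point, on the right for `o = 0` and on the left for
`o = -1`. -/
theorem exists_germ_aux {f : ℝ ≃o ℝ} (hf : (badCells f).Finite) {D : ℤ} {ν : ℕ}
    (hfix : f (D / 2 ^ ν) = D / 2 ^ ν) {o : ℤ} (ho : o = 0 ∨ o = -1) :
    ∃ r : ℤ, r ≤ ν + badCount f ∧ ∀ z : ℝ, 0 ≤ z → z ≤ 1 / 2 ^ (ν + badCount f) →
      f (D / 2 ^ ν + (1 + 2 * o) * z) = D / 2 ^ ν + (1 + 2 * o) * (2 ^ r * z) := by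
  set N := badCount f with hN
  -- These are the cells that touch the fixed point on the chosen side. The direction is given by
  -- the sign 1 + 2o, and `-o` is the coordinate of the fixed point in each of them.
  obtain ⟨J, hJ⟩ := isGood_of_badCount_le (c := fun i => (D * 2 ^ i + o, ν + i)) hf
    (fun i j h => by have := congrArg Prod.snd h; dsimp only at this; omega)
    (fun i hi => by
      have := hi.subcell (m := 1) (j := -o) (by omega) (by omega)
      unfold subcell at this
      dsimp only at this
      convert this using 2
      · ring
      · ring) hN.ge
  have hpow : (0 : ℝ) < 2 ^ (ν + N) := by positivity
  have hpt : ∀ t : ℝ, cellPt (D * 2 ^ N + o, ν + N) t = D / 2 ^ ν + (o + t) / 2 ^ (ν + N) := by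
    intro t
    unfold cellPt
    push_cast
    rw [pow_add]
    field_simp
    ring
  have hJ0 : cellPt J (-o) = D / 2 ^ ν := by
    rw [← hJ (-o) (by rcases ho with rfl | rfl <;> simp) (by rcases ho with rfl | rfl <;> simp),
      hpt, add_neg_cancel, zero_div, add_zero, hfix]
  refine ⟨ν + N - J.2, by omega, fun z hz hz' => ?_⟩
  rw [le_div_iff₀ hpow] at hz'
  have h0 : 0 ≤ z * 2 ^ (ν + N) := by positivity
  have h1 := hJ (-o + (1 + 2 * o) * (z * 2 ^ (ν + N)))
    (by rcases ho with rfl | rfl <;> push_cast <;> linarith)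
    (by rcases ho with rfl | rfl <;> push_cast <;> linarith)
  rw [hpt] at h1
  have h2 : (o + (-o + (1 + 2 * o) * (z * 2 ^ (ν + N)))) / 2 ^ (ν + N) = (1 + 2 * (o : ℝ)) * z := by
    field_simp
    ring
  rw [h2] at h1
  rw [h1, ← hJ0, zpow_sub₀ two_ne_zero, ← Nat.cast_add, zpow_natCast, zpow_natCast]
  unfold cellPt
  field_simp
  ring

/-- A good cell bounds the exponent only from above. The exponents of `f` and `f⁻¹` are opposite, so
the two upper bounds give a bound on both sides. -/
theorem exists_germ {f : ℝ ≃o ℝ} (hf : f ∈ cellGroup) {D : ℤ} {ν : ℕ}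
    (hfix : f (D / 2 ^ ν) = D / 2 ^ ν) {o : ℤ} (ho : o = 0 ∨ o = -1) :
    ∃ r : ℤ, |r| ≤ ν + complexity f ∧ ∀ z : ℝ, 0 ≤ z → z ≤ 1 / 2 ^ (ν + complexity f) →
      f (D / 2 ^ ν + (1 + 2 * o) * z) = D / 2 ^ ν + (1 + 2 * o) * (2 ^ r * z) := by
  have hfix' : f⁻¹ (D / 2 ^ ν) = D / 2 ^ ν := by
    change f.symm _ = _
    rw [OrderIso.symm_apply_eq, hfix]
  obtain ⟨r, hr, h⟩ := exists_germ_aux hf.1 hfix ho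
  obtain ⟨s, hs, h'⟩ := exists_germ_aux hf.2 hfix' ho
  have hrs : r + s = 0 := by
    set z : ℝ := min (1 / 2 ^ (ν + badCount f⁻¹)) (1 / 2 ^ (ν + badCount f) / 2 ^ s) with hz
    have hzpos : 0 < z := lt_min (by positivity) (by positivity)
    have h1 := h' z hzpos.le (min_le_left _ _)
    have h2 := h (2 ^ s * z) (by positivity) (by
      have := min_le_right (1 / 2 ^ (ν + badCount f⁻¹) : ℝ) (1 / 2 ^ (ν + badCount f) / 2 ^ s)
      rw [← hz, le_div_iff₀ (by positivity)] at this
      linarith)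
    rw [← h1] at h2
    change f (f.symm _) = _ at h2
    rw [f.apply_symm_apply] at h2
    have h3 : (1 + 2 * (o : ℝ)) ≠ 0 := by rcases ho with rfl | rfl <;> norm_num
    have h4 := mul_left_cancel₀ h3 (add_left_cancel h2)
    rw [← mul_assoc, ← zpow_add₀ two_ne_zero] at h4
    have h5 : (2 : ℝ) ^ (r + s) = 2 ^ (0 : ℤ) := by
      rw [zpow_zero]
      exact (mul_right_cancel₀ hzpos.ne' (by rw [one_mul]; exact h4)).symm
    exact zpow_right_injective₀ (by norm_num) (by norm_num) h5
  unfold complexity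
  refine ⟨r, by rw [abs_le]; push_cast; omega, fun z hz hz' => h z hz (hz'.trans ?_)⟩
  exact one_div_le_one_div_of_le (by positivity) (pow_le_pow_right₀ (by norm_num) (by omega))

/-- Slope 2^r at an end point moves the cells of the geometric tail by r places, which is a
translation after conjugation, with opposite signs at the two ends. The summand m + 1 skips the
uniform part; the rest bounds |r| and reaches the domain of the germ. -/
theorem isTame_conj {κ : ℤ} {ν m : ℕ} (hm : 2 ≤ m) {f g : ℝ ≃o ℝ} (hf : f ∈ cellGroup)
    (hc : f (κ / 2 ^ ν) = κ / 2 ^ ν)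
    (hd : f ((κ + m + 2) / 2 ^ ν) = (κ + m + 2) / 2 ^ ν)
    (hg : ∀ x, vineMap κ ν m (g x) = f (vineMap κ ν m x)) :
    IsTame (m + 1 + ν + complexity f) g := by
  have hθ := vineMap_strictMono κ ν m hm
  have hsmall : ∀ (w : ℝ) (j : ℕ), w ≤ 2 → complexity f + 1 ≤ j →
      w / 2 ^ ν / 2 ^ j ≤ 1 / 2 ^ (ν + complexity f) := by
    intro w j hw hj
    obtain ⟨i, rfl⟩ := Nat.exists_eq_add_of_le hj
    calc w / 2 ^ ν / 2 ^ (complexity f + 1 + i) ≤ 2 / 2 ^ ν / 2 ^ (complexity f + 1 + i) := by gcongr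
      _ = 1 / 2 ^ (ν + complexity f) / 2 ^ i := by
        rw [pow_add, pow_add, pow_add]
        field_simp
      _ ≤ 1 / 2 ^ (ν + complexity f) := div_le_self (by positivity) (one_le_pow₀ (by norm_num))
  constructor
  · obtain ⟨r, hr, h⟩ := exists_germ hf (D := κ + m + 2) (ν := ν) (by push_cast; exact hd)
      (o := -1) (Or.inr rfl)
    rw [abs_le] at hr
    refine ⟨-r, by rw [abs_le]; push_cast; omega, fun x hx => hθ.injective ?_⟩
    have hfl : (m + 1 + ν + complexity f : ℕ) ≤ ⌊x⌋ := Int.le_floor.2 (by exact_mod_cast hx)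
    obtain ⟨j, hj⟩ : ∃ j : ℕ, ⌊x⌋ = m - 1 + j := ⟨(⌊x⌋ - (m - 1)).toNat, by omega⟩
    obtain ⟨i, hi⟩ : ∃ i : ℕ, (i : ℤ) = j - r := ⟨(j - r).toNat, by omega⟩
    have ht := Int.fract_nonneg x
    have ht' := (Int.fract_lt_one x).le
    have hxe : x = m - 1 + j + Int.fract x := by
      have := Int.floor_add_fract x
      rw [hj] at this
      push_cast at this
      exact this.symm
    have e1 := vineMap_right κ ν m hm j ht ht'
    have e2 := vineMap_right κ ν m hm i ht ht'
    have hi' : (i : ℝ) = j - r := by exact_mod_cast hi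
    rw [← hxe] at e1
    rw [hg, e1, show x + ((-r : ℤ) : ℝ) = m - 1 + i + Int.fract x by push_cast; linarith, e2]
    have h1 := h ((2 - Int.fract x) / 2 ^ ν / 2 ^ j)
      (div_nonneg (div_nonneg (by linarith) (by positivity)) (by positivity))
      (hsmall _ _ (by linarith) (by omega))
    push_cast at h1
    rw [show (κ + m + 2 : ℝ) / 2 ^ ν - (2 - Int.fract x) / 2 ^ ν / 2 ^ j =
      (κ + m + 2) / 2 ^ ν + (1 + 2 * -1) * ((2 - Int.fract x) / 2 ^ ν / 2 ^ j) by ring, h1]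
    have h2 : (2 : ℝ) ^ i = 2 ^ j / 2 ^ r := by
      rw [← zpow_natCast, hi, zpow_sub₀ two_ne_zero, zpow_natCast]
    rw [h2]
    have h3 : (2 : ℝ) ^ r ≠ 0 := by positivity
    field_simp
    ring
  · obtain ⟨r, hr, h⟩ := exists_germ hf (D := κ) (ν := ν) hc (o := 0) (Or.inl rfl)
    rw [abs_le] at hr
    refine ⟨r, by rw [abs_le]; push_cast; omega, fun x hx => hθ.injective ?_⟩
    have hfl : ⌊x⌋ ≤ -((m + 1 + ν + complexity f : ℕ) : ℤ) := by
      have : (⌊x⌋ : ℝ) ≤ -((m + 1 + ν + complexity f : ℕ) : ℝ) := (Int.floor_le x).trans hx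
      exact_mod_cast this
    obtain ⟨j, hj⟩ : ∃ j : ℕ, ⌊x⌋ = -j := ⟨(-⌊x⌋).toNat, by omega⟩
    obtain ⟨i, hi⟩ : ∃ i : ℕ, (i : ℤ) = j - r := ⟨(j - r).toNat, by omega⟩
    have ht := Int.fract_nonneg x
    have ht' := (Int.fract_lt_one x).le
    have hxe : x = -j + Int.fract x := by
      have := Int.floor_add_fract x
      rw [hj] at this
      push_cast at this
      exact this.symm
    have e1 := vineMap_left κ ν m hm j ht ht'
    have e2 := vineMap_left κ ν m hm i ht ht'
    have hi' : (i : ℝ) = j - r := by exact_mod_cast hi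
    rw [← hxe] at e1
    rw [hg, e1, show x + (r : ℝ) = -i + Int.fract x by linarith, e2]
    have h1 := h ((1 + Int.fract x) / 2 ^ ν / 2 ^ j) (by positivity)
      (hsmall _ _ (by linarith) (by omega))
    push_cast at h1
    rw [show (κ : ℝ) / 2 ^ ν + (1 + Int.fract x) / 2 ^ ν / 2 ^ j =
      κ / 2 ^ ν + (1 + 2 * 0) * ((1 + Int.fract x) / 2 ^ ν / 2 ^ j) by ring, h1]
    have h2 : (2 : ℝ) ^ i = 2 ^ j / 2 ^ r := by
      rw [← zpow_natCast, hi, zpow_sub₀ two_ne_zero, zpow_natCast]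
    rw [h2]
    have h3 : (2 : ℝ) ^ r ≠ 0 := by positivity
    field_simp
    ring

theorem IsDyadicReal.exists_grid {c d : ℝ} (hc : IsDyadicReal c) (hd : IsDyadicReal d)
    (hcd : c < d) : ∃ (κ : ℤ) (ν m : ℕ), 2 ≤ m ∧ c = κ / 2 ^ ν ∧ d = (κ + m + 2) / 2 ^ ν := by
  obtain ⟨n₁, h1⟩ := hc.exists_level
  obtain ⟨n₂, h2⟩ := hd.exists_level
  obtain ⟨κ, hκ⟩ := h1 (n₁ + n₂) (by omega)
  obtain ⟨D, hD⟩ := h2 (n₁ + n₂) (by omega)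
  have hlt : κ < D := by
    rw [hκ, hD] at hcd
    have := (div_lt_div_iff_of_pos_right (by positivity : (0 : ℝ) < 2 ^ (n₁ + n₂))).1 hcd
    exact_mod_cast this
  -- Halving the grid twice gives at least four steps between the end points, hence m ≥ 2.
  refine ⟨κ * 4, n₁ + n₂ + 2, (D * 4 - κ * 4 - 2).toNat, by omega, ?_, ?_⟩
  · rw [hκ, pow_add]
    push_cast
    field_simp
    ring
  · have h3 : (((D * 4 - κ * 4 - 2).toNat : ℤ) : ℝ) = ((D * 4 - κ * 4 - 2 : ℤ) : ℝ) := by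
      rw [Int.toNat_of_nonneg (by omega)]
    rw [Int.cast_natCast] at h3
    rw [hD, h3, pow_add]
    push_cast
    field_simp
    ring

/-- The elements of `F` supported in a dyadic interval are generated by two elements, linearly in
terms of the complexity. -/
theorem linGen_intervalF {c d : ℝ} (hc : IsDyadicReal c) (hd : IsDyadicReal d) (hc0 : 0 ≤ c)
    (hcd : c < d) (hd1 : d ≤ 1) : LinGen (intervalF c d) (intervalF c d) := by
  classical
  obtain ⟨κ, ν, m, hm, rfl, rfl⟩ := hc.exists_grid hd hcd
  have hm' : (2 : ℝ) ≤ m := by exact_mod_cast hm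
  have he : (0 : ℝ) < 1 / 2 ^ ν := by positivity
  have hde : IsDyadicReal (1 / 2 ^ ν) := ⟨1, ν, by simp⟩
  have hdd : ((κ : ℝ) + m + 2) / 2 ^ ν = κ / 2 ^ ν + (m + 2) * (1 / 2 ^ ν) := by ring
  obtain ⟨X, hX, hX'⟩ := exists_push hc0 hd1 he (by rw [hdd]; nlinarith) hc hd hde
  obtain ⟨Y, hY, hY'⟩ := exists_push (a := κ / 2 ^ ν + 1 / 2 ^ ν) (by positivity) hd1 he
    (by rw [hdd]; nlinarith) (hc.add hde) hd hde
  have hXm : X ∈ intervalF (κ / 2 ^ ν) ((κ + m + 2) / 2 ^ ν) := ⟨hX, fun x hx => by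
    rw [hX']
    rcases hx with hx | hx
    · exact pushMap_of_le hx
    · exact pushMap_of_ge hx⟩
  have hYm : Y ∈ intervalF (κ / 2 ^ ν) ((κ + m + 2) / 2 ^ ν) := ⟨hY, fun x hx => by
    rw [hY']
    rcases hx with hx | hx
    · exact pushMap_of_le (by linarith)
    · exact pushMap_of_ge hx⟩
  have hT : (({X, Y} : Finset (ℝ ≃o ℝ)) : Set (ℝ ≃o ℝ)) ⊆
      intervalF (κ / 2 ^ ν) ((κ + m + 2) / 2 ^ ν) := by
    intro g hg
    simp only [Finset.coe_insert, Finset.coe_singleton, Set.mem_insert_iff,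
      Set.mem_singleton_iff] at hg
    rcases hg with rfl | rfl
    · exact hXm
    · exact hYm
  set E := (coarseCells ν).ncard with hE
  refine ⟨{X, Y}, hT, 261 * (m + 1 + ν + 2 * E), fun f hf => ?_⟩
  have hfG := lineF_le_cellGroup hf.1
  have hfc := hf.2 _ (Or.inl le_rfl)
  have hfd := hf.2 _ (Or.inr le_rfl)
  obtain ⟨g, hg⟩ := exists_conj (vineMap_strictMono κ ν m hm) (lt_vineMap κ ν m hm)
    (vineMap_lt κ ν m hm) (fun y => exists_vineMap_eq κ ν m hm) hfc hfd
  have hfc' : f⁻¹ (κ / 2 ^ ν) = κ / 2 ^ ν := (inv_mem hf).2 _ (Or.inl le_rfl)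
  have hfd' : f⁻¹ ((κ + m + 2) / 2 ^ ν) = (κ + m + 2) / 2 ^ ν := (inv_mem hf).2 _ (Or.inr le_rfl)
  have hg' : ∀ x, vineMap κ ν m (g⁻¹ x) = f⁻¹ (vineMap κ ν m x) := by
    intro x
    change _ = f.symm _
    rw [eq_comm, OrderIso.symm_apply_eq, ← hg]
    change _ = vineMap κ ν m (g (g.symm x))
    rw [g.apply_symm_apply]
  have hb1 := badCells_conj hm hc0 hd1 hfG.1 hfc hfd hg
  have hb2 := badCells_conj hm hc0 hd1 hfG.2 hfc' hfd' hg'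
  -- The coarse cells are charged twice, once for `f` and once for `f⁻¹`; hence 2E.
  have hword := isWord_of_isTame (f := g) ⟨hb1.1, hb2.1⟩
    (b := m + 1 + ν + complexity f + 2 * E) (by unfold complexity; omega)
    ((isTame_conj hm hfG hfc hfd hg).mono (by omega))
  -- The word for `g` is read with `X` and `Y` in place of `lineShift` and `lineSplit`; the relation
  -- is conjugacy by `vineMap`.
  obtain ⟨f', hf', hR⟩ := hword.transfer (T := (({X, Y} : Finset (ℝ ≃o ℝ)) : Set (ℝ ≃o ℝ)))
    (fun a a' => ∀ x, vineMap κ ν m (a x) = a' (vineMap κ ν m x)) (fun x => by simp)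
    (fun a b a' b' ha hb x => by
      change vineMap κ ν m (a (b x)) = a' (b' _)
      rw [ha, hb])
    (fun a a' ha x => by
      change _ = a'.symm _
      rw [eq_comm, OrderIso.symm_apply_eq, ← ha]
      change _ = vineMap κ ν m (a (a.symm x))
      rw [a.apply_symm_apply])
    (by
      rintro s (rfl | hs)
      · refine ⟨X, by simp, fun x => ?_⟩
        rw [hX', pushMap_vineMap κ ν m hm, lineShift_apply]
      · rw [Set.mem_singleton_iff] at hs
        subst hs
        refine ⟨Y, by simp, fun x => ?_⟩
        rw [hY', pushMap_vineMap_split κ ν m hm])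
  have hff : f = f' := by
    have hf'm : f' ∈ intervalF (κ / 2 ^ ν) ((κ + m + 2) / 2 ^ ν) :=
      (Subgroup.closure_le _).2 hT hf'.mem_closure
    ext x
    by_cases hx : x ≤ κ / 2 ^ ν ∨ (κ + m + 2) / 2 ^ ν ≤ x
    · rw [hf.2 x hx, hf'm.2 x hx]
    · push Not at hx
      obtain ⟨y, rfl⟩ := exists_vineMap_eq κ ν m hm hx.1 hx.2
      rw [← hg, hR]
  rw [hff] at hf' ⊢
  refine hf'.mono subset_rfl ?_
  rw [mul_assoc]
  gcongr
  nlinarith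

/-! ### Cutting at dyadic fixed points -/

/-- `h` agrees with `f` on `[p, q]` and is the identity elsewhere. -/
def IsCut (p q : ℝ) (f h : ℝ → ℝ) : Prop :=
  (∀ x, p ≤ x → x ≤ q → h x = f x) ∧ ∀ x, x ≤ p ∨ q ≤ x → h x = x

theorem exists_isCut {p q : ℝ} {f : ℝ ≃o ℝ} (hp : f p = p) (hq : f q = q) :
    ∃ h : ℝ ≃o ℝ, IsCut p q f h := by
  classical
  have hp' : f.symm p = p := by rw [OrderIso.symm_apply_eq, hp]
  have hq' : f.symm q = q := by rw [OrderIso.symm_apply_eq, hq]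
  have hmem : ∀ e : ℝ ≃o ℝ, e p = p → e q = q → ∀ x, p < x ∧ x < q → p < e x ∧ e x < q := by
    intro e hep heq x hx
    refine ⟨?_, ?_⟩
    · rw [← hep]; exact e.strictMono hx.1
    · rw [← heq]; exact e.strictMono hx.2
  have hinv : ∀ e : ℝ ≃o ℝ, e p = p → e q = q → ∀ x,
      (if p < (if p < x ∧ x < q then e x else x) ∧ (if p < x ∧ x < q then e x else x) < q
        then e.symm (if p < x ∧ x < q then e x else x)
        else (if p < x ∧ x < q then e x else x)) = x := by
    intro e hep heq x
    by_cases h : p < x ∧ x < q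
    · simp only [if_pos h, if_pos (hmem e hep heq x h), e.symm_apply_apply]
    · simp only [if_neg h]
  have hmono : StrictMono fun x => if p < x ∧ x < q then f x else x := by
    intro x y hxy
    by_cases hx : p < x ∧ x < q <;> by_cases hy : p < y ∧ y < q
    · simp only [if_pos hx, if_pos hy]
      exact f.strictMono hxy
    · simp only [if_pos hx, if_neg hy]
      have : q ≤ y := by
        by_contra h
        exact hy ⟨hx.1.trans hxy, not_le.1 h⟩
      exact (hmem f hp hq x hx).2.trans_le this
    · simp only [if_neg hx, if_pos hy]
      have : x ≤ p := by
        by_contra h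
        exact hx ⟨not_le.1 h, hxy.trans hy.2⟩
      exact this.trans_lt (hmem f hp hq y hy).1
    · simpa only [if_neg hx, if_neg hy]
  refine ⟨⟨⟨fun x => if p < x ∧ x < q then f x else x,
    fun x => if p < x ∧ x < q then f.symm x else x, hinv f hp hq, fun x => ?_⟩,
    hmono.le_iff_le⟩, ?_, ?_⟩
  · have := hinv f.symm hp' hq' x
    rwa [f.symm_symm] at this
  · intro x h1 h2
    change (if p < x ∧ x < q then f x else x) = f x
    split_ifs with h
    · rfl
    · rcases h1.eq_or_lt with rfl | h1
      · exact hp.symm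
      · have : x = q := le_antisymm h2 (not_lt.1 fun h2 => h ⟨h1, h2⟩)
        rw [this, hq]
  · intro x hx
    change (if p < x ∧ x < q then f x else x) = x
    rw [if_neg (by rintro ⟨h1, h2⟩; rcases hx with h | h <;> linarith)]

theorem IsCut.inv {p q : ℝ} {f h : ℝ ≃o ℝ} (hh : IsCut p q f h) (hp : f p = p) (hq : f q = q) :
    IsCut p q (f⁻¹ : ℝ ≃o ℝ) (h⁻¹ : ℝ ≃o ℝ) := by
  refine ⟨fun x h1 h2 => ?_, fun x hx => ?_⟩
  · change h.symm x = f.symm x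
    have hp' : f.symm p = p := by rw [OrderIso.symm_apply_eq, hp]
    have hq' : f.symm q = q := by rw [OrderIso.symm_apply_eq, hq]
    rw [OrderIso.symm_apply_eq, hh.1, f.apply_symm_apply]
    · rw [← hp']; exact f.symm.monotone h1
    · rw [← hq']; exact f.symm.monotone h2
  · change h.symm x = x
    rw [OrderIso.symm_apply_eq, hh.2 x hx]

theorem IsCut.mem_lineF {p q : ℝ} {f h : ℝ ≃o ℝ} (hh : IsCut p q f h) (hf : f ∈ lineF)
    (hp : IsDyadicReal p) (hq : IsDyadicReal q) : h ∈ lineF := by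
  classical
  obtain ⟨h0, h1, B, hB, hb⟩ := mem_lineF_iff.1 hf
  have hor : ∀ x, f x = x → h x = x := by
    intro x hx
    by_cases hpq : p ≤ x ∧ x ≤ q
    · rw [hh.1 x hpq.1 hpq.2, hx]
    · refine hh.2 x ?_
      by_contra hc
      push Not at hc
      exact hpq ⟨hc.1.le, hc.2.le⟩
  rw [mem_lineF_iff]
  refine ⟨fun x hx => hor x (h0 x hx), fun x hx => hor x (h1 x hx), insert p (insert q B), ?_, ?_⟩
  · intro d hd
    simp only [Finset.mem_insert] at hd
    rcases hd with rfl | rfl | hd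
    · exact hp
    · exact hq
    · exact hB d hd
  · intro a b ha hab hb1 hd
    simp only [Finset.mem_insert, forall_eq_or_imp] at hd
    obtain ⟨hd1, hd2, hd3⟩ := hd
    rcases hd1.symm with hd1 | hd1
    · exact ⟨0, 0, fun x _ hx => by rw [hh.2 x (Or.inl (hx.trans hd1))]; simp⟩
    rcases hd2 with hd2 | hd2
    · exact ⟨0, 0, fun x hx _ => by rw [hh.2 x (Or.inr (hd2.trans hx))]; simp⟩
    obtain ⟨k, c, h2⟩ := hb a b ha hab hb1 hd3
    exact ⟨k, c, fun x hx hx' => by rw [hh.1 x (hd1.trans hx) (hx'.trans hd2), h2 x hx hx']⟩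

/-- The cells that contain `p` in their interior. -/
def crossingCells (p : ℝ) : Set (ℤ × ℕ) := {I | cellPt I 0 < p ∧ p < cellPt I 1}

/-- From the level on at which `p` is a grid point no cell crosses it, and on each lower level the
only candidate is the cell at `p`. -/
theorem crossingCells_finite {p : ℝ} (hp : IsDyadicReal p) : (crossingCells p).Finite := by
  obtain ⟨ν, hν⟩ := hp.exists_level
  refine ((Finset.range ν).finite_toSet.image (cellAt p)).subset ?_
  rintro ⟨k, n⟩ ⟨h0, h1⟩
  have hpos : (0 : ℝ) < 2 ^ n := by positivity
  unfold cellPt at h0 h1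
  rw [div_lt_iff₀ hpos, add_zero] at h0
  rw [lt_div_iff₀ hpos] at h1
  dsimp only at h0 h1
  have hn : n < ν := by
    by_contra hn
    obtain ⟨K, rfl⟩ := hν n (not_lt.1 hn)
    rw [div_mul_cancel₀ _ hpos.ne'] at h0 h1
    have h2 : k < K := by exact_mod_cast h0
    have h3 : K < k + 1 := by exact_mod_cast h1
    omega
  refine ⟨n, by simpa using hn, ?_⟩
  unfold cellAt
  have : ⌊2 ^ n * p⌋ = k := by
    rw [Int.floor_eq_iff]
    constructor <;> linarith
  rw [this]

/-- A cell that crosses neither `p` nor `q` lies either inside [p, q], where the cut agrees with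
`f`, or outside, where it is the identity. -/
theorem IsCut.badCount_le {p q : ℝ} {f h : ℝ ≃o ℝ} (hh : IsCut p q f h)
    (hf : (badCells f).Finite) (hp : IsDyadicReal p) (hq : IsDyadicReal q) :
    badCount h ≤ badCount f + ((crossingCells p).ncard + (crossingCells q).ncard) := by
  have hsub : badCells h ⊆ badCells f ∪ (crossingCells p ∪ crossingCells q) := by
    intro I hI
    by_contra hc
    simp only [Set.mem_union, not_or] at hc
    obtain ⟨h1, h2, h3⟩ := hc
    have h2' : p ≤ cellPt I 0 ∨ cellPt I 1 ≤ p := by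
      by_contra h
      push Not at h
      exact h2 h
    have h3' : q ≤ cellPt I 0 ∨ cellPt I 1 ≤ q := by
      by_contra h
      push Not at h
      exact h3 h
    rcases h2' with h2' | h2'
    · rcases h3' with h3' | h3'
      · exact hI ⟨I, cellMap_self fun x hx _ => hh.2 x (Or.inr (h3'.trans hx))⟩
      · obtain ⟨J, hJ⟩ : IsGood f I := not_not.1 h1
        refine hI ⟨J, fun t ht ht' => ?_⟩
        rw [hh.1, hJ t ht ht']
        · exact h2'.trans ((cellPt_strictMono I).monotone ht)
        · exact ((cellPt_strictMono I).monotone ht').trans h3'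
    · exact hI ⟨I, cellMap_self fun x _ hx => hh.2 x (Or.inl (hx.trans h2'))⟩
  have hfin := (crossingCells_finite hp).union (crossingCells_finite hq)
  have h1 := Set.ncard_le_ncard hsub (hf.union hfin)
  have h2 := Set.ncard_union_le (badCells f) (crossingCells p ∪ crossingCells q)
  have h3 := Set.ncard_union_le (crossingCells p) (crossingCells q)
  unfold badCount
  omega

/-- Cutting increases the complexity by at most a constant. -/
theorem exists_cut {p q : ℝ} (hp : IsDyadicReal p) (hq : IsDyadicReal q) :
    ∃ c : ℕ, ∀ f ∈ lineF, f p = p → f q = q →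
      ∃ h ∈ lineF, IsCut p q f h ∧ complexity h ≤ complexity f + c := by
  refine ⟨2 * ((crossingCells p).ncard + (crossingCells q).ncard), fun f hf hfp hfq => ?_⟩
  obtain ⟨h, hh⟩ := exists_isCut hfp hfq
  refine ⟨h, hh.mem_lineF hf hp hq, hh, ?_⟩
  have h1 := hh.badCount_le (badCells_finite_of_mem_lineF hf) hp hq
  have h2 := (hh.inv hfp hfq).badCount_le (badCells_finite_of_mem_lineF (inv_mem hf)) hp hq
  unfold complexity
  omega

theorem LinGen.mono_left {H H' K : Set (ℝ ≃o ℝ)} (h : LinGen H K) (hH : H ⊆ H') :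
    LinGen H' K := by
  obtain ⟨T, hT, C, hC⟩ := h
  exact ⟨T, hT.trans hH, C, hC⟩

theorem LinGen.mul {H A B K : Set (ℝ ≃o ℝ)} (hA : LinGen H A) (hB : LinGen H B) (c : ℕ)
    (h : ∀ f ∈ K, ∃ a ∈ A, ∃ b ∈ B, f = a * b ∧ complexity a ≤ c * (complexity f + 1) ∧
      complexity b ≤ c * (complexity f + 1)) : LinGen H K := by
  classical
  obtain ⟨T, hT, C, hC⟩ := hA
  obtain ⟨T', hT', C', hC'⟩ := hB
  refine ⟨T ∪ T', by rw [Finset.coe_union]; exact Set.union_subset hT hT',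
    C * (c + 1) + C' * (c + 1), fun f hf => ?_⟩
  obtain ⟨a, ha, b, hb, rfl, hca, hcb⟩ := h f hf
  refine (((hC a ha).mono (by simp) le_rfl).mul ((hC' b hb).mono (by simp) le_rfl)).mono
    subset_rfl ?_
  rw [add_mul, mul_assoc, mul_assoc]
  gcongr <;> linarith

/-- If the elements of `K` fix the dyadic points in `D`, then linear generation has to be checked
on the complementary intervals of `D` only. -/
theorem linGen_of_gaps {H K : Set (ℝ ≃o ℝ)} {D : Finset ℝ} (hD : ∀ d ∈ D, IsDyadicReal d)
    (hKF : K ⊆ lineF) (hfix : ∀ f ∈ K, ∀ d ∈ D, f d = d)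
    (hK : ∀ f ∈ K, ∀ h ∈ lineF, (∀ x, h x = f x ∨ h x = x) → h ∈ K)
    (hgap : ∀ p q, IsDyadicReal p → IsDyadicReal q → 0 ≤ p → p < q → q ≤ 1 →
      (∀ d ∈ D, d ≤ p ∨ q ≤ d) → LinGen H (K ∩ intervalF p q)) (n : ℕ) :
    ∀ p q, IsDyadicReal p → IsDyadicReal q → 0 ≤ p → p < q → q ≤ 1 →
      (D.filter fun d => p < d ∧ d < q).card ≤ n → LinGen H (K ∩ intervalF p q) := by
  classical
  induction n with
  | zero =>
    intro p q hp hq h0 hpq h1 hn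
    refine hgap p q hp hq h0 hpq h1 fun d hd => ?_
    by_contra hc
    push Not at hc
    have : D.filter (fun d => p < d ∧ d < q) = ∅ := by simpa using hn
    exact Finset.filter_eq_empty_iff.1 this hd hc
  | succ n ih =>
    intro p q hp hq h0 hpq h1 hn
    -- Cutting at a point of `D` inside (p, q) gives two elements of `K`, supported on the two sides
    -- of it, on intervals with fewer points of `D` inside.
    by_cases hne : ∃ d ∈ D, p < d ∧ d < q
    · obtain ⟨d, hd, hpd, hdq⟩ := hne
      have hcard : ∀ p' q', p ≤ p' → q' ≤ q → (d ≤ p' ∨ q' ≤ d) →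
          (D.filter fun d => p' < d ∧ d < q').card ≤ n := by
        intro p' q' hp' hq' hd'
        have hlt : (D.filter fun d => p' < d ∧ d < q').card <
            (D.filter fun d => p < d ∧ d < q).card := by
          refine Finset.card_lt_card ((Finset.ssubset_iff_of_subset ?_).2 ⟨d, ?_, ?_⟩)
          · intro x hx
            simp only [Finset.mem_filter] at hx ⊢
            exact ⟨hx.1, hp'.trans_lt hx.2.1, hx.2.2.trans_le hq'⟩
          · simp [hd, hpd, hdq]
          · simp only [Finset.mem_filter, not_and, not_lt]
            intro _ h
            rcases hd' with h' | h' <;> linarith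
        omega
      have hdd := hD d hd
      have hA := ih p d hp hdd h0 hpd (by linarith) (hcard p d le_rfl hdq.le (Or.inr le_rfl))
      have hB := ih d q hdd hq (by linarith) hdq h1 (hcard d q hpd.le le_rfl (Or.inl le_rfl))
      obtain ⟨c, hc⟩ := exists_cut hp hdd
      obtain ⟨c', hc'⟩ := exists_cut hdd hq
      refine hA.mul hB (1 + c + c') fun f hf => ?_
      have hfp := hf.2.2 p (Or.inl le_rfl)
      have hfq := hf.2.2 q (Or.inr le_rfl)
      have hfd := hfix f hf.1 d hd
      obtain ⟨a, ha, hca, hcc⟩ := hc f (hKF hf.1) hfp hfd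
      obtain ⟨b, hb, hcb, hcc'⟩ := hc' f (hKF hf.1) hfd hfq
      have hor : ∀ (p' q' : ℝ) (h : ℝ ≃o ℝ), IsCut p' q' f h → ∀ x, h x = f x ∨ h x = x := by
        intro p' q' h hh x
        by_cases hx : p' ≤ x ∧ x ≤ q'
        · exact Or.inl (hh.1 x hx.1 hx.2)
        · right
          refine hh.2 x ?_
          by_contra hx'
          push Not at hx'
          exact hx ⟨hx'.1.le, hx'.2.le⟩
      refine ⟨a, ⟨hK f hf.1 a ha (hor p d a hca), ha, hca.2⟩, b,
        ⟨hK f hf.1 b hb (hor d q b hcb), hb, hcb.2⟩, ?_, ?_, ?_⟩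
      · ext x
        change f x = a (b x)
        rcases le_total x d with hx | hx
        · rw [hcb.2 x (Or.inl hx)]
          rcases le_total p x with hx' | hx'
          · rw [hca.1 x hx' hx]
          · rw [hca.2 x (Or.inl hx'), hf.2.2 x (Or.inl hx')]
        · have hbx : b x = f x := by
            rcases le_total x q with hx' | hx'
            · rw [hcb.1 x hx hx']
            · rw [hcb.2 x (Or.inr hx'), hf.2.2 x (Or.inr hx')]
          have hdf : d ≤ f x := by
            rw [← hfd]; exact f.monotone hx
          rw [hbx, hca.2 _ (Or.inr hdf)]
      · nlinarith
      · nlinarith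
    · refine hgap p q hp hq h0 hpq h1 fun d hd => ?_
      by_contra hc
      push Not at hc
      exact hne ⟨d, hd, hc⟩

/-! ### Slopes and contractions at points that are not dyadic -/

/-- Near its fixed point `u`, the map `f` is linear with slope `2 ^ s`. -/
def HasExp (f : ℝ → ℝ) (u : ℝ) (s : ℤ) : Prop :=
  ∃ ε > 0, ∀ x, |x - u| < ε → f x = u + 2 ^ s * (x - u)

namespace HasExp

theorem one (u : ℝ) : HasExp (1 : ℝ ≃o ℝ) u 0 :=
  ⟨1, one_pos, fun x _ => by simp⟩

theorem mul {f g : ℝ ≃o ℝ} {u : ℝ} {s t : ℤ} (hf : HasExp f u s) (hg : HasExp g u t) :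
    HasExp (f * g : ℝ ≃o ℝ) u (s + t) := by
  obtain ⟨ε, hε, h⟩ := hf
  obtain ⟨ε', hε', h'⟩ := hg
  have hpos : (0 : ℝ) < 2 ^ t := by positivity
  refine ⟨min ε' (ε / 2 ^ t), lt_min hε' (by positivity), fun x hx => ?_⟩
  change f (g x) = _
  have h1 := hx.trans_le (min_le_right _ _)
  rw [lt_div_iff₀ hpos] at h1
  rw [h' x (hx.trans_le (min_le_left _ _)), h _ (by
    rw [add_sub_cancel_left, abs_mul, abs_of_pos hpos]
    linarith), add_sub_cancel_left, zpow_add₀ two_ne_zero, mul_assoc]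

theorem inv {f : ℝ ≃o ℝ} {u : ℝ} {s : ℤ} (hf : HasExp f u s) :
    HasExp (f⁻¹ : ℝ ≃o ℝ) u (-s) := by
  obtain ⟨ε, hε, h⟩ := hf
  have hpos : (0 : ℝ) < 2 ^ s := by positivity
  refine ⟨ε * 2 ^ s, by positivity, fun x hx => ?_⟩
  change f.symm x = _
  rw [OrderIso.symm_apply_eq, h]
  · rw [add_sub_cancel_left, ← mul_assoc, ← zpow_add₀ two_ne_zero, add_neg_cancel, zpow_zero]
    ring
  · rw [add_sub_cancel_left, abs_mul, zpow_neg, abs_of_pos (inv_pos.2 hpos), mul_comm,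
      ← div_eq_mul_inv, div_lt_iff₀ hpos]
    exact hx

theorem unique {f : ℝ → ℝ} {u : ℝ} {s t : ℤ} (hs : HasExp f u s) (ht : HasExp f u t) : s = t := by
  obtain ⟨ε, hε, h⟩ := hs
  obtain ⟨ε', hε', h'⟩ := ht
  set z := min ε ε' / 2 with hz
  have hmin : 0 < min ε ε' := lt_min hε hε'
  have hzpos : 0 < z := by positivity
  have habs : |u + z - u| = z := by rw [add_sub_cancel_left, abs_of_pos hzpos]
  have h1 := h (u + z) (by rw [habs]; linarith [min_le_left ε ε'])
  have h2 := h' (u + z) (by rw [habs]; linarith [min_le_right ε ε'])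
  rw [h1, add_sub_cancel_left] at h2
  exact zpow_right_injective₀ (by norm_num) (by norm_num)
    (mul_right_cancel₀ hzpos.ne' (add_left_cancel h2))

theorem zpow {f : ℝ ≃o ℝ} {u : ℝ} {s : ℤ} (hf : HasExp f u s) (k : ℤ) :
    HasExp (f ^ k : ℝ ≃o ℝ) u (k * s) := by
  have hn : ∀ n : ℕ, HasExp (f ^ n : ℝ ≃o ℝ) u (n * s) := by
    intro n
    induction n with
    | zero => simpa using one u
    | succ n ih =>
      rw [pow_succ, Nat.cast_succ, add_mul, one_mul]
      exact ih.mul hf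
  obtain ⟨n, rfl | rfl⟩ := k.eq_nat_or_neg
  · simpa using hn n
  · rw [zpow_neg, zpow_natCast, neg_mul]
    exact (hn n).inv

end HasExp

/-- On the cell at `u` of level `badCount f`, `f` is linear around `u`. -/
theorem exists_linear_on_cellAt {f : ℝ ≃o ℝ} (hf : (badCells f).Finite) {u : ℝ}
    (hfix : f u = u) : ∃ s : ℤ, s ≤ badCount f ∧
      ∀ x, cellPt (cellAt u (badCount f)) 0 ≤ x → x ≤ cellPt (cellAt u (badCount f)) 1 →
        f x = u + 2 ^ s * (x - u) := by
  set n := badCount f with hn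
  obtain ⟨J, hJ⟩ := isGood_cellAt hf u hn.ge
  have hpos : (0 : ℝ) < 2 ^ n := by positivity
  have hu := cellPt_cellAt u n
  have hu' := hJ _ (Int.fract_nonneg (2 ^ n * u)) (Int.fract_lt_one _).le
  rw [hu, hfix] at hu'
  refine ⟨n - J.2, by omega, fun x h0 h1 => ?_⟩
  have hpt : ∀ t : ℝ, cellPt (cellAt u n) t = u + (t - Int.fract (2 ^ n * u)) / 2 ^ n := by
    intro t
    conv_rhs => rw [← hu]
    rw [cellPt_cellAt]
    nth_rewrite 2 [← hu]
    unfold cellPt cellAt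
    dsimp only
    ring
  rw [hpt] at h0 h1
  have hx : cellPt (cellAt u n) (Int.fract (2 ^ n * u) + 2 ^ n * (x - u)) = x := by
    rw [hpt]; field_simp; ring
  have h2 := hJ (Int.fract (2 ^ n * u) + 2 ^ n * (x - u))
    (by
      have : (0 - Int.fract (2 ^ n * u)) / 2 ^ n ≤ x - u := by linarith
      rw [div_le_iff₀ hpos] at this
      linarith)
    (by
      have : x - u ≤ (1 - Int.fract (2 ^ n * u)) / 2 ^ n := by linarith
      rw [le_div_iff₀ hpos] at this
      linarith)
  rw [hx] at h2
  rw [h2]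
  conv_rhs => rw [hu']
  nth_rewrite 2 [← hu']
  unfold cellPt
  rw [zpow_sub₀ two_ne_zero, zpow_natCast, zpow_natCast]
  ring

/-- The distance of a rational point to the end points of the cells around it. -/
theorem le_dist_cellAt {u : ℝ} (hu : ¬ IsDyadicReal u) {a : ℤ} {b : ℕ} (hb : 0 < b)
    (hab : u = a / b) (n : ℕ) :
    cellPt (cellAt u n) 0 ≤ u - 1 / (b * 2 ^ n) ∧ u + 1 / (b * 2 ^ n) ≤ cellPt (cellAt u n) 1 := by
  have hb' : (0 : ℝ) < b := by exact_mod_cast hb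
  have hpos : (0 : ℝ) < 2 ^ n := by positivity
  set k := ⌊2 ^ n * u⌋ with hk
  have h0 : (k : ℝ) < 2 ^ n * u := by
    refine lt_of_le_of_ne (Int.floor_le _) fun h => hu ⟨k, n, ?_⟩
    rw [h]; field_simp
  have h1 : 2 ^ n * u < k + 1 := Int.lt_floor_add_one _
  have hub : 2 ^ n * u * b = 2 ^ n * a := by rw [hab]; field_simp
  -- Two different integers differ by at least 1, so 2^n u is at distance at least 1/b from the
  -- neighbouring integers.
  have h2 : k * b + 1 ≤ 2 ^ n * a := by
    have : (k : ℝ) * b < 2 ^ n * a := by rw [← hub]; gcongr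
    have h3 : k * b < 2 ^ n * a := by exact_mod_cast this
    omega
  have h3 : 2 ^ n * a + 1 ≤ (k + 1) * b := by
    have : 2 ^ n * (a : ℝ) < (k + 1) * b := by rw [← hub]; gcongr
    have h3 : 2 ^ n * a < (k + 1) * b := by exact_mod_cast this
    omega
  have h2' : (k : ℝ) * b + 1 ≤ 2 ^ n * a := by exact_mod_cast h2
  have h3' : 2 ^ n * (a : ℝ) + 1 ≤ (k + 1) * b := by exact_mod_cast h3
  unfold cellPt cellAt
  rw [← hk, hab]
  dsimp only
  constructor
  · rw [div_sub_div _ _ hb'.ne' (by positivity), div_le_div_iff₀ hpos (by positivity)]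
    nlinarith [mul_le_mul_of_nonneg_right h2' (show (0 : ℝ) ≤ b * 2 ^ n by positivity)]
  · rw [div_add_div _ _ hb'.ne' (by positivity), div_le_div_iff₀ (by positivity) hpos]
    nlinarith [mul_le_mul_of_nonneg_right h3' (show (0 : ℝ) ≤ b * 2 ^ n by positivity)]

/-- The good cell at `u` bounds the exponent from above and contains `u` in its interior, since `u`
is not dyadic; `f⁻¹` supplies the lower bound. -/
theorem exists_hasExp {f : ℝ ≃o ℝ} (hf : f ∈ cellGroup) {u : ℝ} (hu : ¬ IsDyadicReal u)
    {a : ℤ} {b : ℕ} (hb : 0 < b) (hab : u = a / b) (hfix : f u = u) :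
    ∃ s : ℤ, s.natAbs ≤ complexity f ∧ HasExp f u s := by
  have hb' : (0 : ℝ) < b := by exact_mod_cast hb
  have key : ∀ e : ℝ ≃o ℝ, (badCells e).Finite → e u = u →
      ∃ s : ℤ, s ≤ badCount e ∧ HasExp e u s := by
    intro e he hue
    obtain ⟨s, hs, h⟩ := exists_linear_on_cellAt he hue
    obtain ⟨h0, h1⟩ := le_dist_cellAt hu hb hab (badCount e)
    refine ⟨s, hs, 1 / (b * 2 ^ badCount e), by positivity, fun x hx => ?_⟩
    rw [abs_lt] at hx
    exact h x (by linarith) (by linarith)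
  obtain ⟨s, hs, h⟩ := key f hf.1 hfix
  obtain ⟨t, ht, h'⟩ := key f⁻¹ hf.2 (by
    change f.symm u = u
    rw [OrderIso.symm_apply_eq, hfix])
  have hst := h'.unique h.inv
  exact ⟨s, by unfold complexity; omega, h⟩

/-- An element with slope `1` at `u` is the identity in a neighbourhood whose size is controlled by
the complexity. -/
theorem apply_eq_self_of_hasExp_zero {f : ℝ ≃o ℝ} (hf : f ∈ cellGroup) {u : ℝ}
    (hu : ¬ IsDyadicReal u) {a : ℤ} {b : ℕ} (hb : 0 < b) (hab : u = a / b) (hfix : f u = u)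
    (h0 : HasExp f u 0) {x : ℝ} (hx : |x - u| ≤ 1 / (b * 2 ^ badCount f)) : f x = x := by
  have hb' : (0 : ℝ) < b := by exact_mod_cast hb
  obtain ⟨s, -, h⟩ := exists_linear_on_cellAt hf.1 hfix
  obtain ⟨h1, h2⟩ := le_dist_cellAt hu hb hab (badCount f)
  have hs : s = 0 := by
    refine HasExp.unique ⟨1 / (b * 2 ^ badCount f), by positivity, fun x hx => ?_⟩ h0
    rw [abs_lt] at hx
    exact h x (by linarith) (by linarith)
  subst hs
  rw [abs_le] at hx
  rw [h x (by linarith) (by linarith)]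
  simp

/-- Linear generation can be checked for the elements with slope `1` at a given point. -/
theorem LinGen.of_hasExp_zero {H : Set (ℝ ≃o ℝ)} {K : Subgroup (ℝ ≃o ℝ)} (hKH : (K : Set _) ⊆ H)
    (hK : K ≤ cellGroup) {u : ℝ} (hu : ¬ IsDyadicReal u) {a : ℤ} {b : ℕ} (hb : 0 < b)
    (hab : u = a / b) (hfix : ∀ f ∈ K, f u = u)
    (h : LinGen H {f | f ∈ K ∧ HasExp f u 0}) : LinGen H K := by
  classical
  -- The exponents at `u` form a subgroup of ℤ, so one element `g` of `K` whose exponent generates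
  -- it can correct every slope.
  let A : AddSubgroup ℤ :=
    { carrier := {s | ∃ f ∈ K, HasExp f u s}
      zero_mem' := ⟨1, one_mem _, HasExp.one u⟩
      add_mem' := fun ⟨f, hf, hs⟩ ⟨g, hg, ht⟩ => ⟨f * g, mul_mem hf hg, hs.mul ht⟩
      neg_mem' := fun ⟨f, hf, hs⟩ => ⟨f⁻¹, inv_mem hf, hs.inv⟩ }
  obtain ⟨d, hd⟩ := Int.subgroup_cyclic A
  obtain ⟨g, hg, hgd⟩ : d ∈ A := by rw [hd]; exact AddSubgroup.mem_closure_singleton_self d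
  obtain ⟨T, hT, C, hC⟩ := h
  refine ⟨insert g T, ?_, C * (complexity g + 1) + 1, fun f hf => ?_⟩
  · rw [Finset.coe_insert]
    exact Set.insert_subset (hKH hg) hT
  obtain ⟨s, hs, hfs⟩ := exists_hasExp (hK hf) hu hb hab (hfix f hf)
  obtain ⟨j, hj, hjs⟩ : ∃ j : ℤ, j * d = s ∧ j.natAbs ≤ s.natAbs := by
    have hsA : s ∈ A := ⟨f, hf, hfs⟩
    rw [hd, AddSubgroup.mem_closure_singleton] at hsA
    obtain ⟨j, hj⟩ := hsA
    rw [smul_eq_mul] at hj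
    -- If all exponents vanish, the multiplier must be chosen as 0 to satisfy the size bound.
    rcases eq_or_ne d 0 with rfl | hd0
    · exact ⟨0, by simpa using hj, by simp⟩
    · refine ⟨j, hj, ?_⟩
      rw [← hj, Int.natAbs_mul]
      exact Nat.le_mul_of_pos_right _ (Int.natAbs_pos.2 hd0)
  have hf0 : f * g ^ (-j) ∈ K := mul_mem hf (zpow_mem hg _)
  have he : HasExp (f * g ^ (-j) : ℝ ≃o ℝ) u 0 := by
    have := hfs.mul (hgd.zpow (-j))
    rwa [neg_mul, hj, add_neg_cancel] at this
  have hM : complexity (f * g ^ (-j)) ≤ complexity f + complexity f * complexity g := by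
    refine (complexity_mul (hK hf) (zpow_mem (hK hg) _)).trans (add_le_add le_rfl ?_)
    refine (complexity_zpow (hK hg) _).trans ?_
    rw [Int.natAbs_neg]
    gcongr
    omega
  have hw := ((hC _ ⟨hf0, he⟩).mono (T := ((insert g T : Finset _) : Set (ℝ ≃o ℝ))) (by simp)
    le_rfl).mul ((IsWord.of_mem (T := ((insert g T : Finset _) : Set (ℝ ≃o ℝ))) (g := g)
      (by simp)).zpow j)
  have hfe : f * g ^ (-j) * g ^ j = f := by rw [mul_assoc, ← zpow_add]; simp
  rw [hfe] at hw
  refine hw.mono subset_rfl ?_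
  rw [mul_one, add_mul, one_mul, mul_assoc]
  refine add_le_add ?_ (by omega)
  gcongr
  nlinarith

/-- Linear generation can be checked after conjugation by powers of a fixed element. -/
theorem LinGen.of_conj {H K K' : Set (ℝ ≃o ℝ)} {g : ℝ ≃o ℝ} (hg : g ∈ H) (hgG : g ∈ cellGroup)
    (hK : K ⊆ cellGroup) (c : ℕ)
    (h : ∀ f ∈ K, ∃ i : ℕ, i ≤ c * (complexity f + 1) ∧ (g ^ i)⁻¹ * f * g ^ i ∈ K')
    (hK' : LinGen H K') : LinGen H K := by
  classical
  obtain ⟨T, hT, C, hC⟩ := hK'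
  refine ⟨insert g T, ?_, C * (1 + 2 * c * complexity g) + 2 * c, fun f hf => ?_⟩
  · rw [Finset.coe_insert]
    exact Set.insert_subset hg hT
  obtain ⟨i, hi, hmem⟩ := h f hf
  have hgi := (IsWord.of_mem (T := ((insert g T : Finset _) : Set (ℝ ≃o ℝ))) (g := g)
    (by simp)).pow i
  have hw := (hgi.mul ((hC _ hmem).mono (T := ((insert g T : Finset _) : Set (ℝ ≃o ℝ)))
    (by simp) le_rfl)).mul hgi.inv
  have hfe : g ^ i * ((g ^ i)⁻¹ * f * g ^ i) * (g ^ i)⁻¹ = f := by group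
  rw [hfe] at hw
  have hM : complexity ((g ^ i)⁻¹ * f * g ^ i) ≤ complexity f + 2 * (i * complexity g) := by
    have hgiG := pow_mem hgG i
    have h1 := complexity_mul (mul_mem (inv_mem hgiG) (hK hf)) hgiG
    have h2 := complexity_mul (inv_mem hgiG) (hK hf)
    have h3 := complexity_pow hgG i
    rw [complexity_inv] at h2
    omega
  refine hw.mono subset_rfl ?_
  have h4 : i * complexity g ≤ c * (complexity f + 1) * complexity g := by gcongr
  have h5 : C * (complexity ((g ^ i)⁻¹ * f * g ^ i) + 1) ≤
      C * (1 + 2 * c * complexity g) * (complexity f + 1) := by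
    rw [mul_assoc C]
    exact Nat.mul_le_mul_left C (by linarith)
  rw [mul_one, add_mul]
  linarith

/-! ### Contractions -/

/-- A map that contracts `[l, r]` towards `u` with ratio `q` and that is the identity away
from `u`. -/
noncomputable def contractMap (u q l r x : ℝ) : ℝ :=
  max (min x (max (2 * x - (2 * r - (u + q * (r - u)))) (u + q * (x - u))))
    (min (2 * x - (2 * l - (u + q * (l - u)))) (u + q * (x - u)))

section contractMap

variable {u q l r x : ℝ}

theorem contractMap_of_le (hq' : q ≤ 1) (hl : l < u)
    (hx : x ≤ 2 * l - (u + q * (l - u))) : contractMap u q l r x = x := by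
  have h1 : x ≤ u := by nlinarith
  have h2 : x ≤ u + q * (x - u) := by nlinarith
  unfold contractMap
  rw [min_eq_left (h2.trans (le_max_right _ _)), max_eq_left ((min_le_left _ _).trans (by linarith))]

theorem contractMap_left (hq' : q ≤ 1)
    (hx : 2 * l - (u + q * (l - u)) ≤ x) (hx' : x ≤ l) :
    contractMap u q l r x = 2 * x - (2 * l - (u + q * (l - u))) := by
  have h2 : x ≤ u + q * (x - u) := by nlinarith
  unfold contractMap
  rw [min_eq_left (h2.trans (le_max_right _ _)), min_eq_left (by nlinarith),
    max_eq_right (by linarith)]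

theorem contractMap_mid (hq' : q ≤ 1) (hx : l ≤ x) (hx' : x ≤ r) :
    contractMap u q l r x = u + q * (x - u) := by
  unfold contractMap
  rw [min_eq_right (by nlinarith : u + q * (x - u) ≤ 2 * x - (2 * l - (u + q * (l - u)))),
    max_eq_right (by nlinarith : 2 * x - (2 * r - (u + q * (r - u))) ≤ u + q * (x - u)),
    max_eq_right (min_le_right _ _)]

theorem contractMap_right (hq' : q ≤ 1)
    (hx : r ≤ x) (hx' : x ≤ 2 * r - (u + q * (r - u))) :
    contractMap u q l r x = 2 * x - (2 * r - (u + q * (r - u))) := by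
  have h2 : u + q * (x - u) ≤ x := by nlinarith
  have h3 : u + q * (x - u) ≤ 2 * x - (2 * r - (u + q * (r - u))) := by nlinarith
  unfold contractMap
  rw [max_eq_left h3, min_eq_right (by linarith), max_eq_left ((min_le_right _ _).trans h3)]

theorem contractMap_of_ge (hq' : q ≤ 1) (hr : u < r)
    (hx : 2 * r - (u + q * (r - u)) ≤ x) : contractMap u q l r x = x := by
  have h1 : u ≤ x := by nlinarith
  have h2 : u + q * (x - u) ≤ x := by nlinarith
  unfold contractMap
  rw [min_eq_left (le_trans (by linarith) (le_max_left _ _)),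
    max_eq_left ((min_le_right _ _).trans h2)]

theorem contractMap_strictMono (hq : 0 < q) : StrictMono (contractMap u q l r) := by
  have h1 : StrictMono fun x => u + q * (x - u) := fun x y h => by dsimp only; gcongr
  have h2 : ∀ c : ℝ, StrictMono fun x => 2 * x - c := fun c x y h => by dsimp only; gcongr
  exact ((StrictMono.min_of (f := fun x => x) strictMono_id ((h2 _).max_of h1)).max_of
    ((h2 _).min_of h1))

theorem contractMap_continuous : Continuous (contractMap u q l r) := by
  unfold contractMap
  fun_prop

end contractMap

theorem exists_dyadic_btwn {a b : ℝ} (h : a < b) : ∃ d, IsDyadicReal d ∧ a < d ∧ d < b := by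
  obtain ⟨n, hn⟩ := exists_pow_lt_of_lt_one (sub_pos.2 h) (by norm_num : (1 / 2 : ℝ) < 1)
  have hpos : (0 : ℝ) < 2 ^ n := by positivity
  rw [div_pow, one_pow, div_lt_iff₀ hpos] at hn
  refine ⟨((⌊2 ^ n * a⌋ + 1 : ℤ) : ℝ) / 2 ^ n, ⟨_, n, rfl⟩, ?_, ?_⟩
  · rw [lt_div_iff₀ hpos]
    push_cast
    linarith [Int.lt_floor_add_one (2 ^ n * a)]
  · rw [div_lt_iff₀ hpos]
    push_cast
    nlinarith [Int.floor_le (2 ^ n * a)]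

/-- A rational point is the fixed point of a dyadic contraction with ratio a power of `1 / 2`. -/
theorem exists_dyadic_period (a : ℤ) {b : ℕ} (hb : 0 < b) :
    ∃ P : ℕ, 0 < P ∧ IsDyadicReal ((a / b : ℝ) * (1 - 1 / 2 ^ P)) := by
  obtain ⟨s, b', hb', rfl⟩ := Nat.exists_eq_two_pow_mul_odd hb.ne'
  have hcop : Nat.Coprime 2 b' := (Nat.coprime_two_left).2 hb'
  have hpos : 0 < b' := hb'.pos
  -- With P the totient of the odd part b' of the denominator, b' divides 2^P - 1 and cancels; only
  -- a power of 2 is left.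
  have hmod := (Nat.ModEq.pow_totient hcop).symm
  obtain ⟨t, ht⟩ := (Nat.modEq_iff_dvd' Nat.one_le_two_pow).1 hmod
  have ht' : (2 : ℝ) ^ b'.totient - 1 = b' * t := by
    have : (2 ^ b'.totient : ℕ) = b' * t + 1 := by
      have := Nat.one_le_two_pow (n := b'.totient)
      omega
    have h2 : ((2 ^ b'.totient : ℕ) : ℝ) = b' * t + 1 := by rw [this]; push_cast; ring
    push_cast at h2
    linarith
  refine ⟨b'.totient, Nat.totient_pos.2 hpos, a * t, s + b'.totient, ?_⟩
  have hb0 : (b' : ℝ) ≠ 0 := by positivity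
  push_cast
  rw [pow_add]
  field_simp
  rw [ht']
  ring

/-- The constant term u(1 - 2^(-P)) of the contraction is dyadic, although `u` need not be. On
either side a piece of slope 2 leads back to the diagonal, at the point 2l - l' or 2r - r', where l'
and r' are the images of l and r. Choosing l and r within δ/2 of `u` keeps the support within δ. -/
theorem exists_contraction {u : ℝ} {a : ℤ} {b : ℕ} (hb : 0 < b) (hab : u = a / b) {δ : ℝ}
    (hδ : 0 < δ) (h0 : 0 ≤ u - δ) (h1 : u + δ ≤ 1) :
    ∃ g ∈ lineF, ∃ l r : ℝ, ∃ P : ℕ, 0 < P ∧ IsDyadicReal l ∧ IsDyadicReal r ∧ u - δ < l ∧ l < u ∧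
      u < r ∧ r < u + δ ∧ (∀ x, l ≤ x → x ≤ r → g x = u + 1 / 2 ^ P * (x - u)) ∧
      ∀ x, δ ≤ |x - u| → g x = x := by
  classical
  obtain ⟨P, hP, hper⟩ := exists_dyadic_period a hb
  rw [← hab] at hper
  obtain ⟨l, hl, hl1, hl2⟩ := exists_dyadic_btwn (show u - δ / 2 < u by linarith)
  obtain ⟨r, hr, hr1, hr2⟩ := exists_dyadic_btwn (show u < u + δ / 2 by linarith)
  set q : ℝ := 1 / 2 ^ P with hq
  have hq0 : 0 < q := by positivity
  have hq1 : q ≤ 1 := by rw [hq, div_le_one (by positivity)]; exact one_le_pow₀ (by norm_num)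
  have hqd : ∀ x, IsDyadicReal x → IsDyadicReal (2 * x - (u + q * (x - u))) := by
    intro x hx
    have h3 := ((hx.add hx).sub (hx.zpow_mul (-P))).sub hper
    convert h3 using 1
    rw [hq, zpow_neg, zpow_natCast]
    ring
  have hlb : u - δ ≤ 2 * l - (u + q * (l - u)) := by nlinarith
  have hrb : 2 * r - (u + q * (r - u)) ≤ u + δ := by nlinarith
  have hll : 2 * l - (u + q * (l - u)) ≤ l := by nlinarith
  have hrr : r ≤ 2 * r - (u + q * (r - u)) := by nlinarith
  have hle : ∀ x, x ≤ u - δ → contractMap u q l r x = x := fun x hx =>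
    contractMap_of_le hq1 hl2 (hx.trans hlb)
  have hge : ∀ x, u + δ ≤ x → contractMap u q l r x = x := fun x hx =>
    contractMap_of_ge hq1 hr1 (hrb.trans hx)
  have hz : ∀ x, x ≤ 0 → contractMap u q l r x = x := fun x hx => hle x (by linarith)
  have ho : ∀ x, 1 ≤ x → contractMap u q l r x = x := fun x hx => hge x (by linarith)
  refine ⟨lineIso (contractMap u q l r) (contractMap_strictMono hq0) contractMap_continuous hz ho,
    ?_, l, r, P, hP, hl, hr, by linarith, hl2, hr1, by linarith, ?_, ?_⟩
  · rw [mem_lineF_iff]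
    refine ⟨hz, ho, {2 * l - (u + q * (l - u)), l, r, 2 * r - (u + q * (r - u))}, ?_, ?_⟩
    · intro d hd
      simp only [Finset.mem_insert, Finset.mem_singleton] at hd
      rcases hd with rfl | rfl | rfl | rfl
      · exact hqd _ hl
      · exact hl
      · exact hr
      · exact hqd _ hr
    · intro p p' _ hpp _ h
      simp only [Finset.mem_insert, Finset.mem_singleton, forall_eq_or_imp, forall_eq] at h
      obtain ⟨h1, h2, h3, h4⟩ := h
      simp only [lineIso_apply]
      rcases h1.symm with h1 | h1
      · exact ⟨0, 0, fun x _ hx => by rw [contractMap_of_le hq1 hl2 (hx.trans h1)]; simp⟩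
      rcases h4 with h4 | h4
      · exact ⟨0, 0, fun x hx _ => by rw [contractMap_of_ge hq1 hr1 (h4.trans hx)]; simp⟩
      rcases h2.symm with h2 | h2
      · refine ⟨1, -(2 * l - (u + q * (l - u))), fun x hx hx' => ?_⟩
        rw [contractMap_left hq1 (h1.trans hx) (hx'.trans h2), zpow_one]
        ring
      rcases h3 with h3 | h3
      · refine ⟨1, -(2 * r - (u + q * (r - u))), fun x hx hx' => ?_⟩
        rw [contractMap_right hq1 (h3.trans hx) (hx'.trans h4), zpow_one]
        ring
      · refine ⟨-P, u - q * u, fun x hx hx' => ?_⟩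
        rw [contractMap_mid hq1 (h2.trans hx) (hx'.trans h3), hq, zpow_neg, zpow_natCast]
        ring
  · intro x hx hx'
    exact contractMap_mid hq1 hx hx'
  · intro x hx
    rcases le_abs'.1 hx with hx | hx
    · exact hle x (by linarith)
    · exact hge x (by linarith)

/-! ### Stabilizers of finite sets of rational numbers -/

/-- The elements of `lineF` that fix the points of `V` and that are the identity on `[l w, r w]`
for all `w ∈ W`. -/
def fixF (V W : Finset ℝ) (l r : ℝ → ℝ) : Subgroup (ℝ ≃o ℝ) where
  carrier := {f | f ∈ lineF ∧ (∀ v ∈ V, f v = v) ∧ ∀ w ∈ W, ∀ x, l w ≤ x → x ≤ r w → f x = x}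
  one_mem' := ⟨one_mem _, fun _ _ => rfl, fun _ _ _ _ _ => rfl⟩
  mul_mem' := fun {f g} hf hg => ⟨mul_mem hf.1 hg.1,
    fun v hv => by
      change f (g v) = v
      rw [hg.2.1 v hv, hf.2.1 v hv],
    fun w hw x h1 h2 => by
      change f (g x) = x
      rw [hg.2.2 w hw x h1 h2, hf.2.2 w hw x h1 h2]⟩
  inv_mem' := fun {f} hf => ⟨inv_mem hf.1,
    fun v hv => by
      change f.symm v = v
      rw [OrderIso.symm_apply_eq, hf.2.1 v hv],
    fun w hw x h1 h2 => by
      change f.symm x = x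
      rw [OrderIso.symm_apply_eq, hf.2.2 w hw x h1 h2]⟩

theorem exists_separation (S : Finset ℝ) :
    ∃ δ > 0, ∀ x ∈ S, ∀ y ∈ S, x ≠ y → 2 * δ ≤ |x - y| := by
  classical
  rcases S.offDiag.eq_empty_or_nonempty with h | h
  · refine ⟨1, one_pos, fun x hx y hy hxy => ?_⟩
    have : (x, y) ∈ S.offDiag := Finset.mem_offDiag.2 ⟨hx, hy, hxy⟩
    rw [h] at this
    simp at this
  · obtain ⟨p, hp, hmin⟩ := S.offDiag.exists_min_image (fun p => |p.1 - p.2|) h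
    have hne := (Finset.mem_offDiag.1 hp).2.2
    refine ⟨|p.1 - p.2| / 2, half_pos (abs_pos.2 (sub_ne_zero.2 hne)), fun x hx y hy hxy => ?_⟩
    have := hmin (x, y) (Finset.mem_offDiag.2 ⟨hx, hy, hxy⟩)
    dsimp only at this
    linarith

theorem pow_apply_eq_self {g : ℝ ≃o ℝ} {x : ℝ} (h : g x = x) (i : ℕ) : (g ^ i) x = x := by
  induction i with
  | zero => rfl
  | succ i ih =>
    rw [pow_succ]
    change (g ^ i) (g x) = x
    rw [h, ih]

theorem contraction_pow_apply {g : ℝ ≃o ℝ} {u l r : ℝ} {P : ℕ} (hl : l ≤ u) (hr : u ≤ r)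
    (hg : ∀ x, l ≤ x → x ≤ r → g x = u + 1 / 2 ^ P * (x - u)) (i : ℕ) :
    ∀ x, l ≤ x → x ≤ r → (g ^ i) x = u + (1 / 2 ^ P) ^ i * (x - u) := by
  induction i with
  | zero => intro x _ _; simp
  | succ i ih =>
    intro x h1 h2
    have hq0 : (0 : ℝ) ≤ 1 / 2 ^ P := by positivity
    have hq1 : (1 / 2 ^ P : ℝ) ≤ 1 := by
      rw [div_le_one (by positivity)]; exact one_le_pow₀ (by norm_num)
    rw [pow_succ]
    change (g ^ i) (g x) = _
    rw [hg x h1 h2, ih _ (by nlinarith) (by nlinarith), add_sub_cancel_left, pow_succ, mul_assoc]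

theorem exists_int_div_nat (q : ℚ) : ∃ (a : ℤ) (b : ℕ), 0 < b ∧ ((q : ℚ) : ℝ) = a / b :=
  ⟨q.num, q.den, q.pos, Rat.cast_def q⟩

/-- The stabilizer in `F` of a finite set of rational points is generated by a finite set, with
word lengths that are bounded linearly by the complexity. -/
theorem linGen_fixF (V : Finset ℝ) (hV : ∀ v ∈ V, 0 < v ∧ v < 1)
    (hrat : ∀ v ∈ V, ∃ q : ℚ, v = q) :
    LinGen {f | f ∈ lineF ∧ ∀ v ∈ V, f v = v} {f | f ∈ lineF ∧ ∀ v ∈ V, f v = v} := by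
  classical
  set H : Set (ℝ ≃o ℝ) := {f | f ∈ lineF ∧ ∀ v ∈ V, f v = v} with hH
  -- With 0 and 1 included, intervals of radius δ around points of `V` stay in [0, 1], and each
  -- contraction fixes the other points of `V`.
  obtain ⟨δ, hδ, hsep⟩ := exists_separation (insert 0 (insert 1 V))
  have hfrac : ∀ v ∈ V, ∃ (a : ℤ) (b : ℕ), 0 < b ∧ v = a / b := by
    intro v hv
    obtain ⟨q, rfl⟩ := hrat v hv
    exact exists_int_div_nat q
  have hcontr : ∀ u ∈ V, ∃ (g : ℝ ≃o ℝ) (l r : ℝ), g ∈ lineF ∧ ∃ P : ℕ, 0 < P ∧ IsDyadicReal l ∧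
      IsDyadicReal r ∧ u - δ < l ∧ l < u ∧ u < r ∧ r < u + δ ∧
      (∀ x, l ≤ x → x ≤ r → g x = u + 1 / 2 ^ P * (x - u)) ∧ ∀ x, δ ≤ |x - u| → g x = x := by
    intro u hu
    obtain ⟨a, b, hb, hab⟩ := hfrac u hu
    obtain ⟨hu0, hu1⟩ := hV u hu
    have h0 := hsep u (by simp [hu]) 0 (by simp) hu0.ne'
    have h1 := hsep u (by simp [hu]) 1 (by simp) hu1.ne
    rw [sub_zero, abs_of_pos hu0] at h0
    rw [abs_sub_comm, abs_of_pos (by linarith)] at h1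
    obtain ⟨g, hg, l, r, h⟩ := exists_contraction hb hab hδ (by linarith) (by linarith)
    exact ⟨g, l, r, hg, h⟩
  choose! g l r hg P hP hl hr hl1 hl2 hr1 hr2 hmid hout using hcontr
  have hgfix : ∀ u ∈ V, ∀ v ∈ V, g u v = v := by
    intro u hu v hv
    rcases eq_or_ne v u with rfl | hvu
    · rw [hmid v hu v (hl2 v hu).le (hr1 v hu).le, sub_self, mul_zero, add_zero]
    · refine hout u hu v ?_
      have := hsep v (by simp [hv]) u (by simp [hu]) hvu
      linarith
  set N := V.filter fun v => ¬ IsDyadicReal v with hN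
  have hNV : N ⊆ V := Finset.filter_subset _ _
  have hKH : ∀ W, (fixF V W l r : Set (ℝ ≃o ℝ)) ⊆ H := fun W f hf => ⟨hf.1, hf.2.1⟩
  have hKG : ∀ W, fixF V W l r ≤ cellGroup := fun W f hf => lineF_le_cellGroup hf.1
  -- the group of the elements that are the identity near all points of `N`
  have hbase : LinGen H (fixF V N l r : Set (ℝ ≃o ℝ)) := by
    -- The common dyadic fixed points: those of `V` and the ends of the intervals on which the group
    -- is trivial.
    set D : Finset ℝ := (V.filter fun v => IsDyadicReal v) ∪ (N.image l ∪ N.image r) with hD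
    have hDmem : ∀ d, d ∈ D ↔ (d ∈ V ∧ IsDyadicReal d) ∨ (∃ w ∈ N, l w = d) ∨
        ∃ w ∈ N, r w = d := by
      intro d
      simp [hD]
    have h := linGen_of_gaps (H := H) (K := (fixF V N l r : Set (ℝ ≃o ℝ))) (D := D) ?_ ?_ ?_ ?_ ?_
      D.card 0 1 IsDyadicReal.zero ⟨1, 0, by simp⟩ le_rfl one_pos le_rfl (Finset.card_filter_le _ _)
    · refine h.mono fun f hf => ⟨hf, hf.1, fun x hx => ?_⟩
      obtain ⟨h0, h1, -⟩ := mem_lineF_iff.1 hf.1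
      rcases hx with hx | hx
      · exact h0 x hx
      · exact h1 x hx
    · intro d hd
      rcases (hDmem d).1 hd with ⟨-, h⟩ | ⟨w, hw, rfl⟩ | ⟨w, hw, rfl⟩
      · exact h
      · exact hl w (hNV hw)
      · exact hr w (hNV hw)
    · exact fun f hf => hf.1
    · intro f hf d hd
      rcases (hDmem d).1 hd with ⟨h, -⟩ | ⟨w, hw, rfl⟩ | ⟨w, hw, rfl⟩
      · exact hf.2.1 d h
      · exact hf.2.2 w hw _ le_rfl ((hl2 w (hNV hw)).trans (hr1 w (hNV hw))).le
      · exact hf.2.2 w hw _ ((hl2 w (hNV hw)).trans (hr1 w (hNV hw))).le le_rfl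
    · intro f hf h hh hor
      refine ⟨hh, fun v hv => ?_, fun w hw x h1 h2 => ?_⟩
      · rcases hor v with h3 | h3
        · rw [h3, hf.2.1 v hv]
        · exact h3
      · rcases hor x with h3 | h3
        · rw [h3, hf.2.2 w hw x h1 h2]
        · exact h3
    · intro p q hp hq h0 hpq h1 hgap
      -- A gap of `D` either lies in some [l w, r w], where only the identity remains, or contains
      -- no point of `V`, and then all of `intervalF p q` lies in `H`.
      by_cases hcov : ∃ w ∈ N, l w ≤ p ∧ q ≤ r w
      · obtain ⟨w, hw, hlp, hqr⟩ := hcov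
        refine ⟨∅, by simp, 0, fun f hf => ?_⟩
        have hf1 : f = 1 := by
          ext x
          change f x = x
          by_cases hx : x ≤ p ∨ q ≤ x
          · exact hf.2.2 x hx
          · push Not at hx
            exact hf.1.2.2 w hw x (hlp.trans hx.1.le) (hx.2.le.trans hqr)
        rw [hf1]
        exact IsWord.one _ _
      · have hfree : ∀ v ∈ V, v ≤ p ∨ q ≤ v := by
          intro v hv
          by_cases hvd : IsDyadicReal v
          · exact hgap v ((hDmem v).2 (Or.inl ⟨hv, hvd⟩))
          · have hvN : v ∈ N := Finset.mem_filter.2 ⟨hv, hvd⟩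
            by_contra hc
            push Not at hc
            refine hcov ⟨v, hvN, ?_, ?_⟩
            · rcases hgap (l v) ((hDmem _).2 (Or.inr (Or.inl ⟨v, hvN, rfl⟩))) with h | h
              · exact h
              · linarith [hl2 v hv]
            · rcases hgap (r v) ((hDmem _).2 (Or.inr (Or.inr ⟨v, hvN, rfl⟩))) with h | h
              · linarith [hr1 v hv]
              · exact h
        refine ((linGen_intervalF hp hq h0 hpq h1).mono_left ?_).mono Set.inter_subset_right
        exact fun f hf => ⟨hf.1, fun v hv => hf.2 v (hfree v hv)⟩
  -- one point of `N` at a time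
  have hstep : ∀ u ∈ N, ∀ W ⊆ N, u ∉ W → LinGen H (fixF V (insert u W) l r : Set (ℝ ≃o ℝ)) →
      LinGen H (fixF V W l r : Set (ℝ ≃o ℝ)) := by
    intro u hu W hW huW h
    have huV := hNV hu
    have hud : ¬ IsDyadicReal u := (Finset.mem_filter.1 hu).2
    obtain ⟨a, b, hb, hab⟩ := hfrac u huV
    obtain ⟨hu0, hu1⟩ := hV u huV
    have hb' : (0 : ℝ) < b := by exact_mod_cast hb
    refine LinGen.of_hasExp_zero (hKH W) (hKG W) hud hb hab (fun f hf => hf.2.1 u huV) ?_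
    -- The exponent `badCount f` + b suffices: each step at least halves distances to `u`, and 2^b ≥
    -- b, so [l u, r u] is brought within 1/(b * 2^`badCount f`) of `u`, where `f` is the identity.
    refine LinGen.of_conj (g := g u) ⟨hg u huV, hgfix u huV⟩ (lineF_le_cellGroup (hg u huV))
      (fun f hf => hKG W hf.1) (b + 1) (fun f hf => ⟨badCount f + b, ?_, ?_⟩) h
    · have : badCount f ≤ complexity f := by unfold complexity; omega
      nlinarith
    · have hgi : g u ^ (badCount f + b) ∈ lineF := pow_mem (hg u huV) _
      have hconj : ∀ x, f ((g u ^ (badCount f + b)) x) = (g u ^ (badCount f + b)) x →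
          ((g u ^ (badCount f + b))⁻¹ * f * g u ^ (badCount f + b)) x = x := by
        intro x hx
        change (g u ^ (badCount f + b)).symm (f ((g u ^ (badCount f + b)) x)) = x
        rw [hx, OrderIso.symm_apply_apply]
      refine ⟨mul_mem (mul_mem (inv_mem hgi) hf.1.1) hgi, fun v hv => hconj v ?_,
        fun w hw x h1 h2 => hconj x ?_⟩
      · rw [pow_apply_eq_self (hgfix u huV v hv), hf.1.2.1 v hv]
      · rcases Finset.mem_insert.1 hw with rfl | hwW
        · rw [contraction_pow_apply (hl2 w huV).le (hr1 w huV).le (hmid w huV) _ x h1 h2]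
          refine apply_eq_self_of_hasExp_zero (hKG W hf.1) hud hb hab (hf.1.2.1 w huV) hf.2 ?_
          have h3 : |x - w| ≤ 1 := by
            have h4 := hsep w (by simp [huV]) 0 (by simp) hu0.ne'
            have h5 := hsep w (by simp [huV]) 1 (by simp) hu1.ne
            rw [sub_zero, abs_of_pos hu0] at h4
            rw [abs_sub_comm, abs_of_pos (by linarith)] at h5
            rw [abs_le]
            constructor <;> linarith [hl1 w huV, hr2 w huV]
          have h6 : ((1 : ℝ) / 2 ^ P w) ^ (badCount f + b) ≤ 1 / (b * 2 ^ badCount f) := by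
            rw [div_pow, one_pow]
            refine one_div_le_one_div_of_le (by positivity) ?_
            have h7 : (2 : ℝ) ≤ 2 ^ P w := by
              calc (2 : ℝ) = 2 ^ 1 := by norm_num
                _ ≤ 2 ^ P w := pow_le_pow_right₀ (by norm_num) (hP w huV)
            calc (b : ℝ) * 2 ^ badCount f ≤ 2 ^ b * 2 ^ badCount f := by
                  gcongr
                  exact_mod_cast Nat.lt_two_pow_self.le
              _ = 2 ^ (badCount f + b) := by rw [pow_add, mul_comm]
              _ ≤ (2 ^ P w) ^ (badCount f + b) := by gcongr
          rw [add_sub_cancel_left, abs_mul, abs_of_nonneg (by positivity)]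
          calc ((1 : ℝ) / 2 ^ P w) ^ (badCount f + b) * |x - w|
              ≤ ((1 : ℝ) / 2 ^ P w) ^ (badCount f + b) * 1 := by gcongr
            _ ≤ 1 / (b * 2 ^ badCount f) := by rw [mul_one]; exact h6
        -- The interval around another point of `W` is more than δ away from `u`, so the contraction
        -- fixes it and the earlier progress is kept.
        · have hwV := hNV (hW hwW)
          have hne : w ≠ u := by
            rintro rfl
            exact huW hwW
          have h3 := hsep w (by simp [hwV]) u (by simp [huV]) hne
          have h4 : |x - w| < δ := by
            rw [abs_lt]
            constructor <;> linarith [hl1 w hwV, hr2 w hwV]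
          have h5 : |w - u| ≤ |w - x| + |x - u| := abs_sub_le w x u
          rw [abs_sub_comm w x] at h5
          rw [pow_apply_eq_self (hout u huV x (by linarith)), hf.1.2.2 w hwW x h1 h2]
  have hall : ∀ W ⊆ N, LinGen H (fixF V W l r : Set (ℝ ≃o ℝ)) →
      LinGen H (fixF V ∅ l r : Set (ℝ ≃o ℝ)) := by
    intro W
    induction W using Finset.induction_on with
    | empty => exact fun _ h => h
    | insert u W huW ih =>
      intro hsub h
      have hW := (Finset.subset_insert u W).trans hsub
      exact ih hW (hstep u (hsub (Finset.mem_insert_self u W)) W hW huW h)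
  exact (hall N subset_rfl hbase).mono fun f hf => ⟨hf.1, hf.2, by simp⟩

/-! ### Return to Thompson's group and conclusion -/

/-- The homomorphism by which Thompson's group acts on the line. -/
noncomputable def thompsonToLine : thompsonF →* (ℝ ≃o ℝ) := lineExt.comp thompsonF.subtype

theorem thompsonToLine_injective : Function.Injective thompsonToLine :=
  lineExt_injective.comp Subtype.val_injective

theorem thompsonToLine_mem (f : thompsonF) : thompsonToLine f ∈ lineF := ⟨f, f.2, rfl⟩

/-- The action on the line is faithful and its image contains the generators found there, so words
lift letter by letter. -/
theorem exists_isWord_thompsonStab (U : Set unitInterval) (hfin : U.Finite)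
    (hU : ∀ u ∈ U, 0 < u ∧ u < 1) (hrat : ∀ u ∈ U, ∃ q : ℚ, ((u : unitInterval) : ℝ) = (q : ℝ)) :
    ∃ T : Finset thompsonF, (T : Set thompsonF) ⊆ thompsonStab U ∧ ∃ C : ℕ,
      ∀ f ∈ thompsonStab U,
        IsWord (T : Set thompsonF) (C * (complexity (thompsonToLine f) + 1)) f := by
  classical
  set V : Finset ℝ := hfin.toFinset.image fun u => (u : ℝ) with hVdef
  have hmem : ∀ v, v ∈ V ↔ ∃ u ∈ U, (u : ℝ) = v := by intro v; simp [hVdef]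
  have hstab : ∀ f : thompsonF, f ∈ thompsonStab U ↔
      thompsonToLine f ∈ {f : ℝ ≃o ℝ | f ∈ lineF ∧ ∀ v ∈ V, f v = v} := by
    intro f
    constructor
    · refine fun hf => ⟨thompsonToLine_mem f, fun v hv => ?_⟩
      obtain ⟨u, hu, rfl⟩ := (hmem v).1 hv
      change lineExt f u = u
      rw [lineExt_coe, hf u hu]
    · intro hf u hu
      have : lineExt f u = u := hf.2 u ((hmem _).2 ⟨u, hu, rfl⟩)
      rw [lineExt_coe] at this
      exact Subtype.ext this
  obtain ⟨T, hT, C, hC⟩ := linGen_fixF V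
    (fun v hv => by
      obtain ⟨u, hu, rfl⟩ := (hmem v).1 hv
      exact hU u hu)
    (fun v hv => by
      obtain ⟨u, hu, rfl⟩ := (hmem v).1 hv
      exact hrat u hu)
  have hlift : ∀ t ∈ T, ∃ t', thompsonToLine t' = t := by
    intro t ht
    obtain ⟨t', ht', rfl⟩ := (hT ht).1
    exact ⟨⟨t', ht'⟩, rfl⟩
  choose! F hF using hlift
  refine ⟨T.image F, ?_, C, fun f hf => ?_⟩
  · intro t ht
    rw [Finset.coe_image] at ht
    obtain ⟨s, hs, rfl⟩ := ht
    have := hT hs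
    rw [← hF s hs] at this
    exact (hstab _).2 this
  · obtain ⟨f', hf', hR⟩ := (hC _ ((hstab f).1 hf)).transfer
      (T := ((T.image F : Finset _) : Set thompsonF))
      (fun a a' => thompsonToLine a' = a) (map_one _)
      (fun a b a' b' ha hb => by rw [map_mul, ha, hb]) (fun a a' ha => by rw [map_inv, ha])
      (fun s hs => ⟨F s, by rw [Finset.coe_image]; exact Set.mem_image_of_mem F hs, hF s hs⟩)
    rwa [thompsonToLine_injective hR] at hf'

theorem theoremt (U : Set unitInterval) (hfin : U.Finite)
    (hU : ∀ u ∈ U, 0 < u ∧ u < 1)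
    (hrat : ∀ u ∈ U, ∃ q : ℚ, ((u : unitInterval) : ℝ) = (q : ℝ)) :
    IsUndistorted (thompsonStab U) := by
  -- The stabilizer of the empty set is all of `F`, so this is a finite generating set of `F`.
  obtain ⟨S₀, -, C₀, hC₀⟩ := exists_isWord_thompsonStab ∅ Set.finite_empty (by simp) (by simp)
  obtain ⟨T₀, hT₀, C, hC⟩ := exists_isWord_thompsonStab U hfin hU hrat
  have hG : ∀ f, thompsonToLine f ∈ cellGroup := fun f => lineF_le_cellGroup (thompsonToLine_mem f)
  refine isUndistorted_of_norm _ (fun f => complexity (thompsonToLine f))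
    (by simp [complexity_one]) (fun f g => ?_) (fun f => ?_) S₀ T₀ ?_ hT₀ C hC
  · rw [map_mul]
    exact complexity_mul (hG f) (hG g)
  · rw [map_inv]
    exact complexity_inv _
  · rw [eq_top_iff]
    exact fun f _ => (hC₀ f fun u hu => absurd hu (Set.notMem_empty u)).mem_closure
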